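/- Let $\mathbb K$ be an algebraically closed field, $I$ a countable index set, $A=(a_{ij})_{i,j\in I}$ a symmetrizable Borcherds–Cartan matrix (integers with $a_{ii}\in\{2,0,-2,-4,\dots\}$, $a_{ij}\le 0$ for $i\ne j$, and $r_ia_{ij}=r_ja_{ji}$ for fixed integers $r_i>0$), and put $(\alpha_i,\alpha_j)=r_ia_{ij}$. For $\nu\in\mathbb N[I]$ let $\mathrm{Seq}(\nu)$ be the set of words in $I$ of content $\nu$, and let $R(\nu)$ be the $\mathbb Z$-graded $\mathbb K$-algebra generated by string diagrams on the words of $\mathrm{Seq}(\nu)$: the idempotents $1_{\boldsymbol i}$ (degree $0$), the dots $x_{k,\boldsymbol i}$ (degree $2r_{i_k}$) and the crossings $\tau_{k,\boldsymbol i}$ (degree $-(\alpha_{i_k},\alpha_{i_{k+1}})$, exchanging the letters $i_k,i_{k+1}$). Diagrams are multiplied by stacking (a product is zero if the words do not match), $\sum_{\boldsymbol i}1_{\boldsymbol i}=1$, distant dots and crossings commute, and the following local relations hold, where $x_1,x_2,x_3$ and $\tau_1,\tau_2$ denote the dots and crossings on the adjacent strands involved, labelled from left to right at the bottom. * On strands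 $i,j$, $\tau_1^2$ equals $0$ if $i=j$; $1$ if $i\neq j$ and $(\alpha_i,\alpha_j)=0$; $x_1^{-a_{ij}}+x_2^{-a_{ji}}$ otherwise. * On strands $i,i$ with $a_{ii}=2$: $x_1\tau_1-\tau_1x_2=1=\tau_1x_1-x_2\tau_1$. On strands $i,j$ with $i\ne j$, or $i=j$ and $a_{ii}\le 0$: $x_1\tau_1=\tau_1x_2$ and $\tau_1x_1=x_2\tau_1$. * On strands $i,j,i$ with $a_{ii}=2$, $i\neq j$ and $(\alpha_i,\alpha_j)\neq0$: $\tau_1\tau_2\tau_1-\tau_2\tau_1\tau_2=\sum_{c=0}^{-a_{ij}-1}x_1^{c}x_3^{-a_{ij}-1-c}$. On all other triples of strands: $\tau_1\tau_2\tau_1=\tau_2\tau_1\tau_2$. Horizontal juxtaposition gives a (non-unital) homomorphism $R(\nu_1)\otimes\cdots\otimes R(\nu_r)\to R(\nu_1+\cdots+\nu_r)$; let $1_{\nu_1,\dots,\nu_r}$ be the image of $1$. For a graded $R(\nu_1)\otimes\cdots\otimes R(\nu_r)$-module $M$ put $$\mathrm{Ind}\,M=R(\nu_1+\cdots+\nu_r)\,1_{\nu_1,\dots,\nu_r}\otimes_{R(\nu_1)\otimes\cdots\otimes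 R(\nu_r)}M .$$ A nonzero graded module is gr-irreducible if its only graded submodules are $0$ and itself, and $\mathrm{hd}\,M$ is the quotient of $M$ by the intersection of its maximal graded submodules. For $i\in I$ and a graded $R(\nu)$-module $M$, $\varepsilon_i(M)$ is the largest $m\ge 0$ such that $1_{\boldsymbol k}M\ne0$ for some $\boldsymbol k\in\mathrm{Seq}(\nu)$ ending with $m$ letters $i$. For $a_{ii}\le 0$ and $n\ge0$, $V(i^n)$ is the one-dimensional graded $R(ni)$-module in degree $0$ on which all $x_k$ and $\tau_k$ act by $0$; for a composition $\mu=(\mu_1,\dots,\mu_r)$ of $n$ put $V(i^\mu)=V(i^{\mu_1})\otimes\cdots\otimes V(i^{\mu_r})$, a module over $R(\mu_1i)\otimes\cdots\otimes R(\mu_ri)$. **Lemma.** Let $i\in I$ with $a_{ii}\le0$ (the case $a_{ii}=0$ included), let $\nu\in\mathbb N[I]$, and let $K$ be a finite-dimensional gr-irreducible graded $R(\nu)$-module with $\varepsilon_i(K)=0$. Let $\mu=(\mu_1,\dots,\mu_r)$ be a composition of $n\ge 0$ and $$M=\mathrm{Ind}\;K\otimes V(i^\mu),$$ a graded $R(\nu+ni)$-module.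 Then $\mathrm{hd}\,M$ is gr-irreducible, $\varepsilon_i(\mathrm{hd}\,M)=n$, and there is an isomorphism of graded $R(\nu+ni)$-modules (preserving degrees) $$\mathrm{hd}\,M\;\cong\;\mathrm{hd}\;\mathrm{Ind}\;K\otimes V(i^n).$$ -/

import Mathlib

universe u

open scoped TensorProduct

noncomputable section

namespace Borcherds

/-! Graded vector spaces -/

section Grading

variable {k : Type u} [Field k]

theorem isInternal_of_proj {M : Type u} [AddCommGroup M] [Module k M] (gr : ℤ → Submodule k M)
    (htop : ⨆ d, gr d = ⊤)
    (hproj : ∀ d, ∃ p : M →ₗ[k] M, (∀ m ∈ gr d, p m = m) ∧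
      ∀ c, c ≠ d → ∀ m ∈ gr c, p m = 0) :
    DirectSum.IsInternal gr := by
  refine DirectSum.isInternal_submodule_of_iSupIndep_of_iSup_eq_top ?_ htop
  intro d
  rw [Submodule.disjoint_def]
  intro m hm hm'
  obtain ⟨p, h1, h2⟩ := hproj d
  have h3 : (⨆ c, ⨆ (_ : c ≠ d), gr c) ≤ LinearMap.ker p :=
    iSup₂_le fun c hc m hm => h2 c hc m hm
  rw [← h1 m hm]
  exact h3 hm'

theorem exists_coaction {M : Type u} [AddCommGroup M] [Module k M] {gr : ℤ → Submodule k M}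
    (h : DirectSum.IsInternal gr) :
    ∃ δ : M →ₗ[k] (ℤ →₀ M), ∀ d, ∀ m ∈ gr d, δ m = Finsupp.single d m := by
  classical
  let e := LinearEquiv.ofBijective (DirectSum.coeLinearMap gr) h
  refine ⟨(DirectSum.toModule k ℤ (ℤ →₀ M)
    fun d => (Finsupp.lsingle d).comp (gr d).subtype) ∘ₗ e.symm.toLinearMap, fun d m hm => ?_⟩
  have : e.symm m = DirectSum.lof k ℤ (fun d => gr d) d ⟨m, hm⟩ := by
    rw [LinearEquiv.symm_apply_eq]
    exact (DirectSum.coeLinearMap_lof gr d ⟨m, hm⟩).symm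
  simp [this]

theorem isInternal_of_coaction {M : Type u} [AddCommGroup M] [Module k M]
    (gr : ℤ → Submodule k M) (htop : ⨆ d, gr d = ⊤) (δ : M →ₗ[k] (ℤ →₀ M))
    (h : ∀ d, ∀ m ∈ gr d, δ m = Finsupp.single d m) : DirectSum.IsInternal gr := by
  refine isInternal_of_proj gr htop fun d => ⟨(Finsupp.lapply d).comp δ, fun m hm => ?_,
    fun c hc m hm => ?_⟩
  · simp [h d m hm]
  · simp [h c m hm, hc]

/-- The grading of a tensor product: degree `d` is spanned by the `m ⊗ n` with
`m`, `n` homogeneous and `deg m + deg n = d`. -/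
def tensorGr {M N : Type u} [AddCommGroup M] [Module k M] [AddCommGroup N] [Module k N]
    (gM : ℤ → Submodule k M) (gN : ℤ → Submodule k N) (d : ℤ) : Submodule k (M ⊗[k] N) :=
  Submodule.span k {t | ∃ p q : ℤ, p + q = d ∧ ∃ m ∈ gM p, ∃ n ∈ gN q, m ⊗ₜ[k] n = t}

theorem tmul_mem_tensorGr {M N : Type u} [AddCommGroup M] [Module k M] [AddCommGroup N]
    [Module k N] {gM : ℤ → Submodule k M} {gN : ℤ → Submodule k N} {p q d : ℤ} (h : p + q = d)
    {m : M} (hm : m ∈ gM p) {n : N} (hn : n ∈ gN q) : m ⊗ₜ[k] n ∈ tensorGr gM gN d :=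
  Submodule.subset_span ⟨p, q, h, m, hm, n, hn, rfl⟩

theorem tensorGr_iSup {M N : Type u} [AddCommGroup M] [Module k M] [AddCommGroup N] [Module k N]
    (gM : ℤ → Submodule k M) (gN : ℤ → Submodule k N)
    (hM : ⨆ d, gM d = ⊤) (hN : ⨆ d, gN d = ⊤) : ⨆ d, tensorGr gM gN d = ⊤ := by
  rw [eq_top_iff]
  rintro t -
  induction t using TensorProduct.induction_on with
  | zero => exact zero_mem _
  | add x y hx hy => exact add_mem hx hy
  | tmul m n =>
    have hm : m ∈ ⨆ d, gM d := hM ▸ Submodule.mem_top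
    have hn : n ∈ ⨆ d, gN d := hN ▸ Submodule.mem_top
    induction hm using Submodule.iSup_induction' with
    | zero => simp
    | add x y _ _ hx hy => rw [TensorProduct.add_tmul]; exact add_mem hx hy
    | mem p m hm =>
      induction hn using Submodule.iSup_induction' with
      | zero => simp
      | add x y _ _ hx hy => rw [TensorProduct.tmul_add]; exact add_mem hx hy
      | mem q n hn =>
        exact Submodule.mem_iSup_of_mem (p + q) (tmul_mem_tensorGr rfl hm hn)

theorem tensorGr_internal {M N : Type u} [AddCommGroup M] [Module k M] [AddCommGroup N]
    [Module k N] {gM : ℤ → Submodule k M} {gN : ℤ → Submodule k N}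
    (hM : DirectSum.IsInternal gM) (hN : DirectSum.IsInternal gN) :
    DirectSum.IsInternal (tensorGr gM gN) := by
  obtain ⟨δ, hδ⟩ := exists_coaction hM
  obtain ⟨ε, hε⟩ := exists_coaction hN
  let η : M ⊗[k] N →ₗ[k] ℤ →₀ M ⊗[k] N :=
    (Finsupp.lmapDomain (M ⊗[k] N) k (fun x : ℤ × ℤ => x.1 + x.2)) ∘ₗ
      (finsuppTensorFinsupp k k M N ℤ ℤ).toLinearMap ∘ₗ TensorProduct.map δ ε
  refine isInternal_of_coaction _
    (tensorGr_iSup _ _ hM.submodule_iSup_eq_top hN.submodule_iSup_eq_top) η fun d t ht => ?_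
  refine Submodule.span_induction (p := fun t _ => η t = Finsupp.single d t) ?_ ?_ ?_ ?_ ht
  · rintro _ ⟨p, q, rfl, m, hm, n, hn, rfl⟩
    simp [η, hδ p m hm, hε q n hn, Finsupp.mapDomain_single]
  · simp
  · intro x y _ _ hx hy
    rw [map_add, hx, hy, Finsupp.single_add]
  · intro c x _ hx
    rw [map_smul, hx, Finsupp.smul_single]

end Grading

/-! Graded algebras and graded modules -/

/-- A `ℤ`-graded (associative, unital) `k`-algebra. -/
structure GrAlg (k : Type u) [Field k] : Type (u + 1) where
  carrier : Type u
  [ring : Ring carrier]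
  [algebra : Algebra k carrier]
  gr : ℤ → Submodule k carrier
  internal : DirectSum.IsInternal gr
  one_mem : (1 : carrier) ∈ gr 0
  mul_mem : ∀ {c d : ℤ} {a b : carrier}, a ∈ gr c → b ∈ gr d → a * b ∈ gr (c + d)

attribute [instance] GrAlg.ring GrAlg.algebra

instance (k : Type u) [Field k] : CoeSort (GrAlg k) (Type u) := ⟨GrAlg.carrier⟩

/-- A `ℤ`-graded left module over a graded algebra. -/
structure GrMod {k : Type u} [Field k] (B : GrAlg k) : Type (u + 1) where
  carrier : Type u
  [addCommGroup : AddCommGroup carrier]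
  [kmodule : Module k carrier]
  [module : Module B carrier]
  [tower : IsScalarTower k B carrier]
  gr : ℤ → Submodule k carrier
  internal : DirectSum.IsInternal gr
  smul_mem : ∀ {c d : ℤ} {a : B} {m : carrier}, a ∈ B.gr c → m ∈ gr d → a • m ∈ gr (c + d)

attribute [instance] GrMod.addCommGroup GrMod.kmodule GrMod.module GrMod.tower

instance {k : Type u} [Field k] (B : GrAlg k) : CoeSort (GrMod B) (Type u) := ⟨GrMod.carrier⟩

section Constructions

variable {k : Type u} [Field k]

/-- The grading of the base field, concentrated in degree zero. -/
def unitGr (k : Type u) [Field k] (d : ℤ) : Submodule k k := if d = 0 then ⊤ else ⊥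

theorem unitGr_internal : DirectSum.IsInternal (unitGr k) := by
  refine isInternal_of_coaction _ ?_ (Finsupp.lsingle 0) ?_
  · rw [eq_top_iff]
    exact le_iSup_of_le 0 (by simp [unitGr])
  · intro d m hm
    by_cases hd : d = 0
    · simp [hd]
    · simp only [unitGr, if_neg hd, Submodule.mem_bot] at hm
      simp [hm]

theorem mul_mem_unitGr {c d : ℤ} {a b : k} (ha : a ∈ unitGr k c) (hb : b ∈ unitGr k d) :
    a * b ∈ unitGr k (c + d) := by
  by_cases hc : c = 0
  · by_cases hd : d = 0
    · simp [unitGr, hc, hd]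
    · simp only [unitGr, if_neg hd, Submodule.mem_bot] at hb
      simp [hb]
  · simp only [unitGr, if_neg hc, Submodule.mem_bot] at ha
    simp [ha]

/-- The base field as a graded algebra (the empty tensor product of graded algebras). -/
def GrAlg.unit (k : Type u) [Field k] : GrAlg k where
  carrier := k
  gr := unitGr k
  internal := unitGr_internal
  one_mem := by simp [unitGr]
  mul_mem := mul_mem_unitGr

/-- The base field as a graded module over itself (the empty tensor product of modules). -/
def GrMod.unit (k : Type u) [Field k] : GrMod (k := k) (GrAlg.unit k) where
  carrier := k
  addCommGroup := inferInstanceAs (AddCommGroup k)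
  kmodule := inferInstanceAs (Module k k)
  module := inferInstanceAs (Module k k)
  tower := inferInstanceAs (IsScalarTower k k k)
  gr := unitGr k
  internal := unitGr_internal
  smul_mem := fun ha hm => mul_mem_unitGr (k := k) ha hm

/-- The tensor product `B ⊗ C` of graded algebras, `(b ⊗ c)(b' ⊗ c') = bb' ⊗ cc'`. -/
def GrAlg.tensor (B C : GrAlg k) : GrAlg k where
  carrier := B ⊗[k] C
  gr := tensorGr B.gr C.gr
  internal := tensorGr_internal B.internal C.internal
  one_mem := tmul_mem_tensorGr (add_zero 0) B.one_mem C.one_mem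
  mul_mem := by
    intro c d a b ha hb
    induction ha using Submodule.span_induction with
    | zero => simp
    | add x y _ _ hx hy => rw [add_mul]; exact add_mem hx hy
    | smul r x _ hx => rw [smul_mul_assoc]; exact Submodule.smul_mem _ _ hx
    | mem x hx =>
      obtain ⟨p, q, rfl, m, hm, n, hn, rfl⟩ := hx
      induction hb using Submodule.span_induction with
      | zero => simp
      | add x y _ _ hx hy => rw [mul_add]; exact add_mem hx hy
      | smul r x _ hx => rw [mul_smul_comm]; exact Submodule.smul_mem _ _ hx
      | mem x hx =>
        obtain ⟨p', q', rfl, m', hm', n', hn', rfl⟩ := hx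
        rw [Algebra.TensorProduct.tmul_mul_tmul]
        exact tmul_mem_tensorGr (by ring) (B.mul_mem hm hm') (C.mul_mem hn hn')

/-- The action of `B ⊗ C` on `M ⊗ N`, as an algebra homomorphism. -/
def tensorAct {B C : GrAlg k} (M : GrMod B) (N : GrMod C) :
    B ⊗[k] C →ₐ[k] Module.End k (M ⊗[k] N) :=
  (Module.endTensorEndAlgHom (R := k) (S := k) (A := k) (M := M) (N := N)).comp
    (Algebra.TensorProduct.map (Algebra.lsmul k k M) (Algebra.lsmul k k N))

theorem tensorAct_tmul {B C : GrAlg k} (M : GrMod B) (N : GrMod C) (b : B) (c : C) (m : M)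
    (n : N) : tensorAct M N (b ⊗ₜ c) (m ⊗ₜ n) = (b • m) ⊗ₜ (c • n) := rfl

theorem tensorAct_mem {B C : GrAlg k} (M : GrMod B) (N : GrMod C) {c d : ℤ} {a : B ⊗[k] C}
    {t : M ⊗[k] N} (ha : a ∈ tensorGr B.gr C.gr c) (ht : t ∈ tensorGr M.gr N.gr d) :
    tensorAct M N a t ∈ tensorGr M.gr N.gr (c + d) := by
  induction ha using Submodule.span_induction with
  | zero => simp
  | add x y _ _ hx hy => rw [map_add]; exact add_mem hx hy
  | smul r x _ hx => rw [map_smul]; exact Submodule.smul_mem _ _ hx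
  | mem x hx =>
    obtain ⟨p, q, rfl, b, hb, c, hc, rfl⟩ := hx
    induction ht using Submodule.span_induction with
    | zero => simp
    | add x y _ _ hx hy => rw [map_add]; exact add_mem hx hy
    | smul r x _ hx => rw [map_smul]; exact Submodule.smul_mem _ _ hx
    | mem x hx =>
      obtain ⟨p', q', rfl, m', hm', n', hn', rfl⟩ := hx
      rw [tensorAct_tmul]
      exact tmul_mem_tensorGr (by ring) (M.smul_mem hb hm') (N.smul_mem hc hn')

/-- The outer tensor product `M ⊗ N`, a graded `B ⊗ C`-module with
`(b ⊗ c)(m ⊗ n) = bm ⊗ cn`. -/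
def GrMod.tensor {B C : GrAlg k} (M : GrMod B) (N : GrMod C) : GrMod (B.tensor C) where
  carrier := M ⊗[k] N
  module := Module.compHom (M ⊗[k] N) (tensorAct M N).toRingHom
  tower :=
    letI : Module (B.tensor C) (M ⊗[k] N) := Module.compHom (M ⊗[k] N) (tensorAct M N).toRingHom
    ⟨fun r x y => LinearMap.congr_fun (map_smul (tensorAct M N) r x) y⟩
  gr := tensorGr M.gr N.gr
  internal := tensorGr_internal M.internal N.internal
  smul_mem := tensorAct_mem M N

variable {B : GrAlg k}

/-- Graded submodules: `N = ∑_d N ∩ M_d`. -/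
def GrMod.IsGradedSub (M : GrMod B) (N : Submodule B M) : Prop :=
  N.restrictScalars k ≤ ⨆ d, N.restrictScalars k ⊓ M.gr d

/-- A graded module is gr-irreducible if it is nonzero and has no graded submodules
other than zero and itself. -/
def GrMod.IsGrIrreducible (M : GrMod B) : Prop :=
  Nontrivial M ∧ ∀ N : Submodule B M, M.IsGradedSub N → N = ⊥ ∨ N = ⊤

/-- Maximal (proper) graded submodules. -/
def GrMod.IsMaxGradedSub (M : GrMod B) (N : Submodule B M) : Prop :=
  M.IsGradedSub N ∧ N ≠ ⊤ ∧ ∀ N' : Submodule B M, M.IsGradedSub N' → N ≤ N' → N' = N ∨ N' = ⊤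

/-- The graded radical: the intersection of all maximal graded submodules. -/
def GrMod.grRad (M : GrMod B) : Submodule B M := sInf {N | M.IsMaxGradedSub N}

theorem GrMod.isGradedSub_iff (M : GrMod B) {δ : M →ₗ[k] (ℤ →₀ M)}
    (hδ : ∀ d, ∀ m ∈ M.gr d, δ m = Finsupp.single d m) (N : Submodule B M) :
    M.IsGradedSub N ↔ ∀ m ∈ N, ∀ d, δ m d ∈ N := by
  constructor
  · intro h m hm d
    have h1 : (⨆ d, N.restrictScalars k ⊓ M.gr d) ≤
        (N.restrictScalars k).comap ((Finsupp.lapply d).comp δ) := by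
      refine iSup_le fun c x hx => ?_
      rw [Submodule.mem_comap, LinearMap.comp_apply, hδ c x hx.2, Finsupp.lapply_apply,
        Finsupp.single_apply]
      split_ifs
      · exact hx.1
      · exact zero_mem _
    exact h1 (h hm)
  · intro h m hm
    have key : ∀ x : M, (∀ d, δ x d ∈ M.gr d) ∧ (δ x).sum (fun _ y => y) = x := by
      intro x
      have hx : x ∈ ⨆ d, M.gr d := M.internal.submodule_iSup_eq_top ▸ Submodule.mem_top
      induction hx using Submodule.iSup_induction' with
      | zero => simp
      | mem c x hx =>
        rw [hδ c x hx]
        refine ⟨fun d => ?_, by simp⟩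
        rw [Finsupp.single_apply]
        split_ifs with hcd
        · exact hcd ▸ hx
        · exact zero_mem _
      | add x y _ _ hx hy =>
        refine ⟨fun d => ?_, ?_⟩
        · rw [map_add, Finsupp.add_apply]
          exact add_mem (hx.1 d) (hy.1 d)
        · rw [map_add, Finsupp.sum_add_index' (by simp) (by simp), hx.2, hy.2]
    rw [← (key m).2]
    exact Submodule.sum_mem _ fun d _ =>
      Submodule.mem_iSup_of_mem d ⟨h m hm d, (key m).1 d⟩

theorem GrMod.grRad_isGradedSub (M : GrMod B) : M.IsGradedSub M.grRad := by
  obtain ⟨δ, hδ⟩ := exists_coaction M.internal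
  rw [M.isGradedSub_iff hδ]
  intro m hm d
  simp only [GrMod.grRad, Submodule.mem_sInf, Set.mem_ofPred_eq] at hm ⊢
  exact fun N hN => (M.isGradedSub_iff hδ N).1 hN.1 m (hm N hN) d

/-- The quotient of a graded module by a graded submodule. -/
def GrMod.quot (M : GrMod B) (N : Submodule B M) (hN : M.IsGradedSub N) : GrMod B where
  carrier := M ⧸ N
  gr d := (M.gr d).map (N.mkQ.restrictScalars k)
  internal := by
    obtain ⟨δ, hδ⟩ := exists_coaction M.internal
    have hN' := (M.isGradedSub_iff hδ N).1 hN
    refine isInternal_of_proj _ ?_ fun d => ?_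
    · rw [← Submodule.map_iSup, M.internal.submodule_iSup_eq_top, Submodule.map_top,
        LinearMap.range_eq_top]
      exact N.mkQ_surjective
    · let f : M →ₗ[k] M ⧸ N := (N.mkQ.restrictScalars k) ∘ₗ (Finsupp.lapply d) ∘ₗ δ
      have hf : N.restrictScalars k ≤ LinearMap.ker f := fun x hx =>
        (Submodule.Quotient.mk_eq_zero N).2 (hN' x hx d)
      let g : (M ⧸ N) →ₗ[k] M ⧸ N :=
        ((N.restrictScalars k).liftQ f hf) ∘ₗ
          (Submodule.Quotient.restrictScalarsEquiv k N).symm.toLinearMap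
      have hg : ∀ x : M, g (N.mkQ x) = N.mkQ (δ x d) := fun x => rfl
      refine ⟨g, ?_, ?_⟩
      · rintro _ ⟨x, hx, rfl⟩
        change g (N.mkQ x) = N.mkQ x
        rw [hg, hδ d x hx, Finsupp.single_eq_same]
      · rintro c hc _ ⟨x, hx, rfl⟩
        change g (N.mkQ x) = 0
        rw [hg, hδ c x hx, Finsupp.single_eq_of_ne (Ne.symm hc), map_zero]
  smul_mem := by
    rintro c d a _ ha ⟨x, hx, rfl⟩
    exact ⟨a • x, M.smul_mem ha hx, rfl⟩

/-- The (graded) head `hd M` of a graded module: the quotient by the graded radical. -/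
def GrMod.hd (M : GrMod B) : GrMod B := M.quot M.grRad M.grRad_isGradedSub

/-- Isomorphism of graded modules: a grading-preserving module isomorphism. -/
def GrMod.Iso (M N : GrMod B) : Prop :=
  ∃ f : M ≃ₗ[B] N, ∀ (d : ℤ) (m : M), m ∈ M.gr d ↔ f m ∈ N.gr d

end Constructions

/-! The quiver Hecke algebras -/

/-- A symmetrizable Borcherds-Cartan matrix `(a i j)` together with its symmetrizing
positive integers `r i`.  (The remaining data of a Borcherds-Cartan datum, the weight lattice and
the coroots, do not enter the algebras `R(ν)`, which only involve `(α_i, α_j) = r_i a_{ij}`.) -/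
structure BorcherdsCartan (I : Type u) where
  a : I → I → ℤ
  r : I → ℤ
  diag : ∀ i, a i i = 2 ∨ (a i i ≤ 0 ∧ Even (a i i))
  off_diag : ∀ i j, i ≠ j → a i j ≤ 0
  r_pos : ∀ i, 0 < r i
  symm : ∀ i j, r i * a i j = r j * a j i

namespace BorcherdsCartan

variable {I : Type u}

/-- The real indices. -/
def IsReal (D : BorcherdsCartan I) (i : I) : Prop := D.a i i = 2

/-- The imaginary indices. -/
def IsImaginary (D : BorcherdsCartan I) (i : I) : Prop := D.a i i ≤ 0

/-- The symmetric bilinear form on simple roots, `(α_i, α_j) = r_i a_{ij}`. -/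
def form (D : BorcherdsCartan I) (i j : I) : ℤ := D.r i * D.a i j

end BorcherdsCartan

theorem finite_words {I : Type u} (ν : Multiset I) :
    {s : List I | (s : Multiset I) = ν}.Finite := by
  classical
  refine (Multiset.finite_toSet ν.lists).subset fun s hs => ?_
  simpa [Multiset.mem_lists_iff] using hs.symm

/-- The finite set `Seq(ν)` of words in `I` of content `ν`.  Elements of `ℕ[I]` are represented
by finite multisets. -/
def words {I : Type u} (ν : Multiset I) : Finset (List I) := (finite_words ν).toFinset

/-- Generators: `e s` is the identity diagram of the word `s`; `x u i v` is the diagram of the word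
`u i v` with a dot on the strand `i`; `t u i j v` is the diagram from `u i j v` (bottom) to
`u j i v` (top) crossing the strands `i` and `j`. -/
inductive Gen (I : Type u) : Type u
  | e (s : List I)
  | x (u : List I) (i : I) (v : List I)
  | t (u : List I) (i j : I) (v : List I)

namespace KLR

variable (k : Type u) [Field k] {I : Type u}

/-- Identity diagram, in the free algebra. -/
def fe (s : List I) : FreeAlgebra k (Gen I) := FreeAlgebra.ι k (Gen.e s)
/-- Dotted diagram, in the free algebra. -/
def fx (u : List I) (i : I) (v : List I) : FreeAlgebra k (Gen I) := FreeAlgebra.ι k (Gen.x u i v)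
/-- Crossing, in the free algebra. -/
def ft (u : List I) (i j : I) (v : List I) : FreeAlgebra k (Gen I) :=
  FreeAlgebra.ι k (Gen.t u i j v)

/-- The defining relations of `R(ν)`; a product `a * b` is the diagram `a` on top of `b`.
Generators are provided for all words, and those of content different from `ν` are set to zero,
so that `R(ν)` is generated by the diagrams on words in `Seq(ν)`. -/
inductive Rel (D : BorcherdsCartan I) (ν : Multiset I) :
    FreeAlgebra k (Gen I) → FreeAlgebra k (Gen I) → Prop
  -- composition of diagrams with identity diagrams
  | e_content (s : List I) (h : (s : Multiset I) ≠ ν) : Rel D ν (fe k s) 0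
  | e_sum : Rel D ν (∑ s ∈ words ν, fe k s) 1
  | e_idem (s : List I) : Rel D ν (fe k s * fe k s) (fe k s)
  | e_orth (s s' : List I) (h : s ≠ s') : Rel D ν (fe k s * fe k s') 0
  | e_x (u i v) : Rel D ν (fe k (u ++ i :: v) * fx k u i v) (fx k u i v)
  | x_e (u i v) : Rel D ν (fx k u i v * fe k (u ++ i :: v)) (fx k u i v)
  | e_t (u i j v) : Rel D ν (fe k (u ++ j :: i :: v) * ft k u i j v) (ft k u i j v)
  | t_e (u i j v) : Rel D ν (ft k u i j v * fe k (u ++ i :: j :: v)) (ft k u i j v)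
  -- distant dots and crossings can be moved past each other
  | x_x (u i v j w) : Rel D ν
      (fx k u i (v ++ j :: w) * fx k (u ++ i :: v) j w)
      (fx k (u ++ i :: v) j w * fx k u i (v ++ j :: w))
  | x_t (u i v a b w) : Rel D ν
      (fx k u i (v ++ b :: a :: w) * ft k (u ++ i :: v) a b w)
      (ft k (u ++ i :: v) a b w * fx k u i (v ++ a :: b :: w))
  | t_x (u a b v i w) : Rel D ν
      (fx k (u ++ b :: a :: v) i w * ft k u a b (v ++ i :: w))
      (ft k u a b (v ++ i :: w) * fx k (u ++ a :: b :: v) i w)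
  | t_t (u i j v a b w) : Rel D ν
      (ft k u i j (v ++ b :: a :: w) * ft k (u ++ i :: j :: v) a b w)
      (ft k (u ++ j :: i :: v) a b w * ft k u i j (v ++ a :: b :: w))
  -- double crossings
  | sq_same (u i v) : Rel D ν (ft k u i i v * ft k u i i v) 0
  | sq_orth (u i j v) (h : i ≠ j) (h' : D.form i j = 0) : Rel D ν
      (ft k u j i v * ft k u i j v) (fe k (u ++ i :: j :: v))
  | sq_ne (u i j v) (h : i ≠ j) (h' : D.form i j ≠ 0) : Rel D ν
      (ft k u j i v * ft k u i j v)
      (fx k u i (j :: v) ^ (-D.a i j).toNat * fe k (u ++ i :: j :: v)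
        + fx k (u ++ [i]) j v ^ (-D.a j i).toNat * fe k (u ++ i :: j :: v))
  -- dots and crossings of strands with the same real label
  | real_left (u i v) (h : D.IsReal i) : Rel D ν
      (fx k u i (i :: v) * ft k u i i v)
      (ft k u i i v * fx k (u ++ [i]) i v + fe k (u ++ i :: i :: v))
  | real_right (u i v) (h : D.IsReal i) : Rel D ν
      (ft k u i i v * fx k u i (i :: v))
      (fx k (u ++ [i]) i v * ft k u i i v + fe k (u ++ i :: i :: v))
  -- dots slide through all other crossings
  | slide_left (u i j v) (h : i ≠ j ∨ D.IsImaginary i) : Rel D ν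
      (fx k u j (i :: v) * ft k u i j v) (ft k u i j v * fx k (u ++ [i]) j v)
  | slide_right (u i j v) (h : i ≠ j ∨ D.IsImaginary i) : Rel D ν
      (ft k u i j v * fx k u i (j :: v)) (fx k (u ++ [j]) i v * ft k u i j v)
  -- braid relations
  | braid_real (u i j v) (h : D.IsReal i) (h' : i ≠ j) (h'' : D.form i j ≠ 0) : Rel D ν
      (ft k u j i (i :: v) * ft k (u ++ [j]) i i v * ft k u i j (i :: v))
      (ft k (u ++ [i]) i j v * ft k u i i (j :: v) * ft k (u ++ [i]) j i v
        + ∑ c ∈ Finset.range (-D.a i j).toNat,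
            fx k u i (j :: i :: v) ^ c * fx k (u ++ [i, j]) i v ^ ((-D.a i j).toNat - 1 - c)
              * fe k (u ++ i :: j :: i :: v))
  | braid (u i j l v) (h : ¬ (i = l ∧ D.IsReal i ∧ i ≠ j ∧ D.form i j ≠ 0)) : Rel D ν
      (ft k u j l (i :: v) * ft k (u ++ [j]) i l v * ft k u i j (l :: v))
      (ft k (u ++ [l]) i j v * ft k u i l (j :: v) * ft k (u ++ [i]) j l v)

end KLR

/-- The degrees of the generating diagrams. -/
def Gen.deg {I : Type u} (D : BorcherdsCartan I) : Gen I → ℤ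
  | .e _ => 0
  | .x _ i _ => 2 * D.r i
  | .t _ i j _ => -D.form i j

/-- The underlying algebra of `R(ν)`. -/
def KLRAlg (k : Type u) [Field k] {I : Type u} (D : BorcherdsCartan I) (ν : Multiset I) : Type u :=
  RingQuot (KLR.Rel k D ν)

namespace KLR

section

variable (k : Type u) [Field k] {I : Type u} (D : BorcherdsCartan I) (ν : Multiset I)

instance : Ring (KLRAlg k D ν) := inferInstanceAs (Ring (RingQuot (Rel k D ν)))
instance : Algebra k (KLRAlg k D ν) := inferInstanceAs (Algebra k (RingQuot (Rel k D ν)))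

/-- The canonical projection from the free algebra. -/
def mk : FreeAlgebra k (Gen I) →ₐ[k] KLRAlg k D ν := RingQuot.mkAlgHom k (Rel k D ν)

theorem mk_surjective : Function.Surjective (mk k D ν) := RingQuot.mkAlgHom_surjective k _

/-- The generators of `R(ν)`. -/
def gen (g : Gen I) : KLRAlg k D ν := mk k D ν (FreeAlgebra.ι k g)

/-- The idempotent `1_s` of `R(ν)`; it is zero if `s` is not of content `ν`. -/
def e (s : List I) : KLRAlg k D ν := gen k D ν (.e s)
/-- A dot in `R(ν)`. -/
def x (u : List I) (i : I) (v : List I) : KLRAlg k D ν := gen k D ν (.x u i v)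
/-- A crossing in `R(ν)`. -/
def t (u : List I) (i j : I) (v : List I) : KLRAlg k D ν := gen k D ν (.t u i j v)

@[simp] theorem mk_fe (s : List I) : mk k D ν (fe k s) = e k D ν s := rfl
@[simp] theorem mk_fx (u : List I) (i : I) (v : List I) :
    mk k D ν (fx k u i v) = x k D ν u i v := rfl
@[simp] theorem mk_ft (u : List I) (i j : I) (v : List I) :
    mk k D ν (ft k u i j v) = t k D ν u i j v := rfl

variable {k D ν}

theorem mk_rel {a b : FreeAlgebra k (Gen I)} (h : Rel k D ν a b) : mk k D ν a = mk k D ν b :=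
  RingQuot.mkAlgHom_rel k h

/-- Homomorphisms out of `R(ν)`. -/
def lift {A : Type u} [Ring A] [Algebra k A] (f : Gen I → A)
    (h : ∀ a b, Rel k D ν a b → FreeAlgebra.lift k f a = FreeAlgebra.lift k f b) :
    KLRAlg k D ν →ₐ[k] A :=
  RingQuot.liftAlgHom k ⟨FreeAlgebra.lift k f, fun {a b} hab => h a b hab⟩

@[simp] theorem lift_gen {A : Type u} [Ring A] [Algebra k A] (f : Gen I → A)
    (h : ∀ a b, Rel k D ν a b → FreeAlgebra.lift k f a = FreeAlgebra.lift k f b) (g : Gen I) :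
    lift (D := D) (ν := ν) f h (gen k D ν g) = f g := by
  unfold lift gen mk
  exact (RingQuot.liftAlgHom_mkAlgHom_apply (S := k) _ _ _).trans (FreeAlgebra.lift_ι_apply _ _)

/-- `HasDeg a d`: `a` is a product of generators of total degree `d`. -/
inductive HasDeg : KLRAlg k D ν → ℤ → Prop
  | one : HasDeg 1 0
  | gen_mul (g : Gen I) {a : KLRAlg k D ν} {d : ℤ} (h : HasDeg a d) :
      HasDeg (gen k D ν g * a) (g.deg D + d)

theorem HasDeg.mul {a b : KLRAlg k D ν} {c d : ℤ} (ha : HasDeg a c) (hb : HasDeg b d) :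
    HasDeg (a * b) (c + d) := by
  induction ha with
  | one => simpa using hb
  | gen_mul g _ ih => rw [mul_assoc, add_assoc]; exact .gen_mul g ih

variable (k D ν) in
/-- The grading of `R(ν)`. -/
def gr (d : ℤ) : Submodule k (KLRAlg k D ν) := Submodule.span k {a | HasDeg a d}

theorem gen_mem_gr (g : Gen I) : gen k D ν g ∈ gr k D ν (g.deg D) :=
  Submodule.subset_span (by simpa using HasDeg.gen_mul g HasDeg.one)

theorem one_mem_gr : (1 : KLRAlg k D ν) ∈ gr k D ν 0 := Submodule.subset_span .one

theorem mul_mem_gr {c d : ℤ} {a b : KLRAlg k D ν} (ha : a ∈ gr k D ν c) (hb : b ∈ gr k D ν d) :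
    a * b ∈ gr k D ν (c + d) := by
  induction ha using Submodule.span_induction with
  | zero => simp
  | add x y _ _ hx hy => rw [add_mul]; exact add_mem hx hy
  | smul r x _ hx => rw [smul_mul_assoc]; exact Submodule.smul_mem _ _ hx
  | mem x hx =>
    induction hb using Submodule.span_induction with
    | zero => simp
    | add x y _ _ hx hy => rw [mul_add]; exact add_mem hx hy
    | smul r x _ hx => rw [mul_smul_comm]; exact Submodule.smul_mem _ _ hx
    | mem y hy => exact Submodule.subset_span (HasDeg.mul hx hy)

theorem gr_iSup : ⨆ d, gr k D ν d = ⊤ := by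
  rw [eq_top_iff]
  rintro a -
  obtain ⟨a, rfl⟩ := mk_surjective k D ν a
  induction a using FreeAlgebra.induction with
  | grade0 r =>
    rw [AlgHom.commutes, Algebra.algebraMap_eq_smul_one]
    exact Submodule.smul_mem _ _ (Submodule.mem_iSup_of_mem 0 one_mem_gr)
  | grade1 g => exact Submodule.mem_iSup_of_mem _ (gen_mem_gr g)
  | add a b ha hb => rw [map_add]; exact add_mem ha hb
  | mul a b ha hb =>
    rw [map_mul]
    generalize mk k D ν a = a at *
    generalize mk k D ν b = b at *
    induction ha using Submodule.iSup_induction' with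
    | zero => simp
    | add x y _ _ hx hy => rw [add_mul]; exact add_mem hx hy
    | mem c a ha =>
      induction hb using Submodule.iSup_induction' with
      | zero => simp
      | add x y _ _ hx hy => rw [mul_add]; exact add_mem hx hy
      | mem d b hb => exact Submodule.mem_iSup_of_mem _ (mul_mem_gr ha hb)

/-- The homogeneous generators, as Laurent monomials. -/
def dgen (D : BorcherdsCartan I) (ν : Multiset I) (g : Gen I) : AddMonoidAlgebra (KLRAlg k D ν) ℤ :=
  AddMonoidAlgebra.single (g.deg D) (gen k D ν g)

theorem single_eq {A : Type u} [Ring A] {c d : ℤ} {a b : A} (h : c = d) (h' : a = b) :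
    (AddMonoidAlgebra.single c a : AddMonoidAlgebra A ℤ) = .single d b := by rw [h, h']

theorem dgen_rel (a b : FreeAlgebra k (Gen I)) (h : Rel k D ν a b) :
    FreeAlgebra.lift k (dgen (k := k) D ν) a = FreeAlgebra.lift k (dgen D ν) b := by
  have hE : ∀ s, FreeAlgebra.lift k (dgen (k := k) D ν) (fe k s) = .single 0 (e k D ν s) :=
    fun s => FreeAlgebra.lift_ι_apply _ _
  have hX : ∀ u i v, FreeAlgebra.lift k (dgen (k := k) D ν) (fx k u i v)
      = .single (2 * D.r i) (x k D ν u i v) :=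
    fun u i v => FreeAlgebra.lift_ι_apply _ _
  have hT : ∀ u i j v, FreeAlgebra.lift k (dgen (k := k) D ν) (ft k u i j v)
      = .single (-D.form i j) (t k D ν u i j v) :=
    fun u i j v => FreeAlgebra.lift_ι_apply _ _
  have hs : ∀ i j, D.form i j = D.form j i := D.symm
  have hr := mk_rel h
  cases h with
  | e_content s h => simp at hr; simp [hE, hr]
  | e_sum =>
    simp only [map_sum, mk_fe, map_one] at hr
    simp only [map_sum, hE, map_one, AddMonoidAlgebra.one_def, ← hr]
    exact (map_sum (AddMonoidAlgebra.singleAddHom (R := KLRAlg k D ν) (0 : ℤ)) _ _).symm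
  | e_orth s s' h =>
    simp only [map_mul, mk_fe, map_zero] at hr
    simp only [map_mul, hE, map_zero, AddMonoidAlgebra.single_mul_single, hr,
      AddMonoidAlgebra.single_zero]
  | sq_same u i v =>
    simp only [map_mul, mk_ft, map_zero] at hr
    simp only [map_mul, hT, map_zero, AddMonoidAlgebra.single_mul_single, hr,
      AddMonoidAlgebra.single_zero]
  | e_idem | e_x | x_e | e_t | t_e | x_x | x_t | t_x | t_t | slide_left | slide_right | braid =>
    simp only [map_mul, mk_fe, mk_fx, mk_ft] at hr
    simp only [map_mul, hE, hX, hT, AddMonoidAlgebra.single_mul_single]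
    refine single_eq ?_ hr
    ring
  | sq_orth u i j v h h' =>
    simp only [map_mul, mk_fe, mk_ft] at hr
    simp only [map_mul, hE, hT, AddMonoidAlgebra.single_mul_single]
    exact single_eq (by rw [hs j i, h']; rfl) hr
  | sq_ne u i j v h h' =>
    simp only [map_mul, map_add, map_pow, mk_fe, mk_fx, mk_ft] at hr
    simp only [map_mul, map_add, map_pow, hE, hX, hT, AddMonoidAlgebra.single_mul_single,
      AddMonoidAlgebra.single_pow]
    have h1 := Int.toNat_of_nonneg (neg_nonneg.2 (D.off_diag i j h))
    have h2 := Int.toNat_of_nonneg (neg_nonneg.2 (D.off_diag j i h.symm))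
    have h3 := hs i j
    rw [hr, AddMonoidAlgebra.single_add]
    congr 1 <;> refine single_eq ?_ rfl <;> rw [nsmul_eq_mul] <;> first | rw [h1] | rw [h2]
    · rw [← h3]; simp only [BorcherdsCartan.form]; ring
    · rw [h3]; simp only [BorcherdsCartan.form]; ring
  | real_left u i v h | real_right u i v h =>
    simp only [map_mul, map_add, mk_fe, mk_fx, mk_ft] at hr
    simp only [map_mul, map_add, hE, hX, hT, AddMonoidAlgebra.single_mul_single]
    have h1 : D.form i i = 2 * D.r i := by
      simp only [BorcherdsCartan.form, show D.a i i = 2 from h]; ring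
    rw [h1, hr, show 2 * D.r i + -(2 * D.r i) = 0 by ring,
      show -(2 * D.r i) + 2 * D.r i = 0 by ring, AddMonoidAlgebra.single_add]
  | braid_real u i j v h h' h'' =>
    simp only [map_mul, map_add, map_pow, map_sum, mk_fe, mk_fx, mk_ft] at hr
    simp only [map_mul, map_add, map_pow, map_sum, hE, hX, hT,
      AddMonoidAlgebra.single_mul_single, AddMonoidAlgebra.single_pow]
    have h1 := Int.toNat_of_nonneg (neg_nonneg.2 (D.off_diag i j h'))
    have h2 : D.form i i = 2 * D.r i := by
      simp only [BorcherdsCartan.form, show D.a i i = 2 from h]; ring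
    rw [hr, AddMonoidAlgebra.single_add]
    congr 1
    · refine single_eq ?_ rfl
      ring
    · refine (map_sum (AddMonoidAlgebra.singleAddHom (R := KLRAlg k D ν) _) _ _).trans ?_
      refine Finset.sum_congr rfl fun c hc => single_eq ?_ rfl
      rw [Finset.mem_range] at hc
      have h3 : ((((-D.a i j).toNat - 1 - c : ℕ) : ℤ)) = -D.a i j - 1 - c := by omega
      rw [nsmul_eq_mul, nsmul_eq_mul, h3, hs j i, h2]
      simp only [BorcherdsCartan.form]; ring

theorem gr_internal : DirectSum.IsInternal (gr k D ν) := by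
  let f : KLRAlg k D ν →ₐ[k] AddMonoidAlgebra (KLRAlg k D ν) ℤ := lift (dgen D ν) dgen_rel
  have hf : ∀ {a : KLRAlg k D ν} {d : ℤ}, HasDeg a d → f a = .single d a := by
    intro a d h
    induction h with
    | one => rw [map_one]; rfl
    | gen_mul g _ ih =>
      rw [map_mul, ih, lift_gen, dgen, AddMonoidAlgebra.single_mul_single]
  have hf' : ∀ d, ∀ a ∈ gr k D ν d, f a = .single d a := by
    intro d a ha
    induction ha using Submodule.span_induction with
    | zero => simp
    | add x y _ _ hx hy => rw [map_add, hx, hy, AddMonoidAlgebra.single_add]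
    | smul r x _ hx => rw [map_smul, hx, AddMonoidAlgebra.smul_single]
    | mem a h => exact hf h
  refine isInternal_of_proj _ gr_iSup fun d => ⟨
    { toFun := fun a => (f a).coeff d
      map_add' := fun a b => by simp
      map_smul' := fun r a => by simp }, fun a ha => ?_, fun c hc a ha => ?_⟩
  · change (f a).coeff d = a
    rw [hf' d a ha, AddMonoidAlgebra.coeff_single, Finsupp.single_eq_same]
  · change (f a).coeff d = 0
    rw [hf' c a ha, AddMonoidAlgebra.coeff_single, Finsupp.single_eq_of_ne (Ne.symm hc)]

end

end KLR

/-- The quiver Hecke algebra `R(ν)` as a graded algebra. -/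
def klr (k : Type u) [Field k] {I : Type u} (D : BorcherdsCartan I) (ν : Multiset I) :
    GrAlg k where
  carrier := KLRAlg k D ν
  gr := KLR.gr k D ν
  internal := KLR.gr_internal
  one_mem := KLR.one_mem_gr
  mul_mem := KLR.mul_mem_gr

/-! Horizontal juxtaposition of diagrams -/

/-- Put the identity diagram of `l` to the left and that of `r` to the right of a generator. -/
def Gen.place {I : Type u} (l r : List I) : Gen I → Gen I
  | .e s => .e (l ++ (s ++ r))
  | .x u i v => .x (l ++ u) i (v ++ r)
  | .t u i j v => .t (l ++ u) i j (v ++ r)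

theorem Gen.deg_place {I : Type u} (D : BorcherdsCartan I) (l r : List I) (g : Gen I) :
    (g.place l r).deg D = g.deg D := by cases g <;> rfl

namespace KLR

section Place

variable {k : Type u} [Field k] {I : Type u} {D : BorcherdsCartan I}

theorem e_mul_e_of_ne {κ : Multiset I} {s s' : List I} (h : s ≠ s') :
    e k D κ s * e k D κ s' = 0 := by
  simpa using mk_rel (k := k) (D := D) (ν := κ) (Rel.e_orth s s' h)

theorem e_eq_zero {κ : Multiset I} {s : List I} (h : (s : Multiset I) ≠ κ) : e k D κ s = 0 := by
  simpa using mk_rel (k := k) (D := D) (ν := κ) (Rel.e_content s h)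

theorem mem_words {ν : Multiset I} {s : List I} : s ∈ words ν ↔ (s : Multiset I) = ν := by
  simp [words]

variable (k D) in
/-- The image `∑ 1_l ⊗ g ⊗ 1_r` of a generator, over all words `l`, `r` of content `α`, `β`. -/
def midGen (α β κ : Multiset I) (g : Gen I) : KLRAlg k D κ :=
  ∑ q ∈ words α ×ˢ words β, gen k D κ (g.place q.1 q.2)

variable (k D) in
/-- The idempotent `1_α ⊗ 1_ν ⊗ 1_β`. -/
def midOne (α ν β κ : Multiset I) : KLRAlg k D κ := ∑ s ∈ words ν, midGen k D α β κ (.e s)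

/-- `F` is a family of diagrams from `l w r` to `l w' r`. -/
def IsLoc {κ : Multiset I} (w' w : List I) (F : List I × List I → KLRAlg k D κ) : Prop :=
  ∀ q, e k D κ (q.1 ++ (w' ++ q.2)) * F q = F q ∧ F q * e k D κ (q.1 ++ (w ++ q.2)) = F q

theorem length_eq_of_mem_words {ν : Multiset I} {s s' : List I} (h : s ∈ words ν)
    (h' : s' ∈ words ν) : s.length = s'.length := by
  rw [mem_words] at h h'
  rw [← Multiset.coe_card, ← Multiset.coe_card, h, h']

theorem sum_mul_sum {α β κ : Multiset I} {w'' w' w : List I} {F G : List I × List I → KLRAlg k D κ}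
    (hF : IsLoc w'' w' F) (hG : IsLoc w' w G) :
    (∑ q ∈ words α ×ˢ words β, F q) * (∑ q ∈ words α ×ˢ words β, G q)
      = ∑ q ∈ words α ×ˢ words β, F q * G q := by
  rw [Finset.sum_mul]
  refine Finset.sum_congr rfl fun q hq => ?_
  rw [Finset.mul_sum]
  refine Finset.sum_eq_single q (fun q' hq' hne => ?_) fun h => absurd hq h
  rw [← (hF q).2, ← (hG q').1, mul_assoc, ← mul_assoc (e k D κ _), e_mul_e_of_ne, zero_mul,
    mul_zero]
  rw [Finset.mem_product] at hq hq'
  intro h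
  obtain ⟨h1, h2⟩ := List.append_inj h (length_eq_of_mem_words hq.1 hq'.1)
  exact hne (Prod.ext h1 (List.append_cancel_left h2)).symm

theorem isLoc_e {κ : Multiset I} (s : List I) :
    IsLoc s s (fun q => e k D κ (q.1 ++ (s ++ q.2))) := by
  intro q
  have := mk_rel (k := k) (D := D) (ν := κ) (Rel.e_idem (q.1 ++ (s ++ q.2)))
  simp only [map_mul, mk_fe] at this
  exact ⟨this, this⟩

theorem isLoc_x {κ : Multiset I} (u : List I) (i : I) (v : List I) :
    IsLoc (u ++ i :: v) (u ++ i :: v) (fun q => x k D κ (q.1 ++ u) i (v ++ q.2)) := by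
  intro q
  have h1 := mk_rel (k := k) (D := D) (ν := κ) (Rel.e_x (q.1 ++ u) i (v ++ q.2))
  have h2 := mk_rel (k := k) (D := D) (ν := κ) (Rel.x_e (q.1 ++ u) i (v ++ q.2))
  simp only [map_mul, mk_fe, mk_fx, List.append_assoc, List.cons_append] at h1 h2 ⊢
  exact ⟨h1, h2⟩

theorem isLoc_t {κ : Multiset I} (u : List I) (i j : I) (v : List I) :
    IsLoc (u ++ j :: i :: v) (u ++ i :: j :: v)
      (fun q => t k D κ (q.1 ++ u) i j (v ++ q.2)) := by
  intro q
  have h1 := mk_rel (k := k) (D := D) (ν := κ) (Rel.e_t (q.1 ++ u) i j (v ++ q.2))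
  have h2 := mk_rel (k := k) (D := D) (ν := κ) (Rel.t_e (q.1 ++ u) i j (v ++ q.2))
  simp only [map_mul, mk_fe, mk_ft, List.append_assoc, List.cons_append] at h1 h2 ⊢
  exact ⟨h1, h2⟩

theorem midOne_mul {α ν β κ : Multiset I} (h : α + ν + β = κ) {w' w : List I}
    {F : List I × List I → KLRAlg k D κ} (hF : IsLoc w' w F) :
    midOne k D α ν β κ * ∑ q ∈ words α ×ˢ words β, F q = ∑ q ∈ words α ×ˢ words β, F q := by
  by_cases hw : w' ∈ words ν
  · rw [midOne, Finset.sum_mul, Finset.sum_eq_single w' _ fun h => absurd hw h]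
    · refine (sum_mul_sum (isLoc_e w') hF).trans (Finset.sum_congr rfl fun q _ => (hF q).1)
    · intro s hs hne
      rw [midGen, Finset.sum_mul]
      refine Finset.sum_eq_zero fun q hq => ?_
      rw [Finset.mul_sum]
      refine Finset.sum_eq_zero fun q' hq' => ?_
      change e k D κ (q.1 ++ (s ++ q.2)) * F q' = 0
      rw [← (hF q').1, ← mul_assoc, e_mul_e_of_ne, zero_mul]
      rw [Finset.mem_product] at hq hq'
      intro h
      obtain ⟨-, h2⟩ := List.append_inj h (length_eq_of_mem_words hq.1 hq'.1)
      exact hne (List.append_inj h2 (length_eq_of_mem_words hs hw)).1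
  · rw [Finset.sum_eq_zero, mul_zero]
    intro q hq
    rw [Finset.mem_product, mem_words, mem_words] at hq
    rw [mem_words] at hw
    rw [← (hF q).1, e_eq_zero, zero_mul]
    rw [← Multiset.coe_add, ← Multiset.coe_add, hq.1, hq.2, ← h, add_assoc]
    simpa using hw

theorem mul_midOne {α ν β κ : Multiset I} (h : α + ν + β = κ) {w' w : List I}
    {F : List I × List I → KLRAlg k D κ} (hF : IsLoc w' w F) :
    (∑ q ∈ words α ×ˢ words β, F q) * midOne k D α ν β κ = ∑ q ∈ words α ×ˢ words β, F q := by
  by_cases hw : w ∈ words ν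
  · rw [midOne, Finset.mul_sum, Finset.sum_eq_single w _ fun h => absurd hw h]
    · refine (sum_mul_sum hF (isLoc_e w)).trans (Finset.sum_congr rfl fun q _ => (hF q).2)
    · intro s hs hne
      rw [midGen, Finset.sum_mul]
      refine Finset.sum_eq_zero fun q hq => ?_
      rw [Finset.mul_sum]
      refine Finset.sum_eq_zero fun q' hq' => ?_
      change F q * e k D κ (q'.1 ++ (s ++ q'.2)) = 0
      rw [← (hF q).2, mul_assoc, e_mul_e_of_ne, mul_zero]
      rw [Finset.mem_product] at hq hq'
      intro h
      obtain ⟨-, h2⟩ := List.append_inj h (length_eq_of_mem_words hq.1 hq'.1)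
      exact hne (List.append_inj h2 (length_eq_of_mem_words hw hs)).1.symm
  · rw [Finset.sum_eq_zero, zero_mul]
    intro q hq
    rw [Finset.mem_product, mem_words, mem_words] at hq
    rw [mem_words] at hw
    rw [← (hF q).2, e_eq_zero, mul_zero]
    rw [← Multiset.coe_add, ← Multiset.coe_add, hq.1, hq.2, ← h, add_assoc]
    simpa using hw

theorem midOne_idem {α ν β κ : Multiset I} (h : α + ν + β = κ) :
    IsIdempotentElem (midOne k D α ν β κ) := by
  unfold IsIdempotentElem
  nth_rw 2 [midOne]
  rw [Finset.mul_sum]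
  exact Finset.sum_congr rfl fun s _ => midOne_mul h (isLoc_e s)

theorem mem_corner {α ν β κ : Multiset I} (h : α + ν + β = κ) {w' w : List I}
    {F : List I × List I → KLRAlg k D κ} (hF : IsLoc w' w F) :
    ∑ q ∈ words α ×ˢ words β, F q ∈ Subsemigroup.corner (midOne k D α ν β κ) :=
  (Subsemigroup.mem_corner_iff (midOne_idem h)).2 ⟨midOne_mul h hF, mul_midOne h hF⟩

theorem exists_isLoc {κ : Multiset I} (g : Gen I) :
    ∃ w' w, IsLoc w' w (fun q => gen k D κ (g.place q.1 q.2)) := by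
  cases g with
  | e s => exact ⟨_, _, isLoc_e s⟩
  | x u i v => exact ⟨_, _, isLoc_x u i v⟩
  | t u i j v => exact ⟨_, _, isLoc_t u i j v⟩

/-- The corner ring of an idempotent of a `k`-algebra is a `k`-algebra. -/
instance cornerAlgebra {A : Type u} [Ring A] [Algebra k A] {e : A} (he : IsIdempotentElem e) :
    Algebra k he.Corner :=
  RingHom.toAlgebra'
    { toFun := fun c =>
        ⟨c • e, (Subsemigroup.mem_corner_iff he).2 ⟨by simp [he.eq], by simp [he.eq]⟩⟩
      map_one' := Subtype.ext (one_smul k e)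
      map_mul' := fun a b => Subtype.ext (by
        change (a * b) • e = (a • e) * (b • e)
        rw [smul_mul_smul_comm, he.eq])
      map_zero' := Subtype.ext (zero_smul k e)
      map_add' := fun a b => Subtype.ext (add_smul a b e) }
    (fun c x => Subtype.ext (by
      obtain ⟨h1, h2⟩ := (Subsemigroup.mem_corner_iff he).1 x.2
      change (c • e) * x.1 = x.1 * (c • e)
      rw [smul_mul_assoc, mul_smul_comm, h1, h2]))

/-- The inclusion of a corner ring. -/
def cornerVal {A : Type u} [Ring A] [Algebra k A] {e : A} (he : IsIdempotentElem e) :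
    he.Corner →ₗ[k] A where
  toFun x := x.1
  map_add' _ _ := rfl
  map_smul' c x := by
    have h1 := ((Subsemigroup.mem_corner_iff he).1 x.2).1
    rw [Algebra.smul_def]
    change (c • e) * x.1 = c • x.1
    rw [smul_mul_assoc, h1]

/-- The image of a generator, as an element of the corner ring. -/
def midCorner {α ν β κ : Multiset I} (h : α + ν + β = κ) (g : Gen I) :
    (midOne_idem (k := k) (D := D) h).Corner :=
  ⟨midGen k D α β κ g, by
    obtain ⟨w', w, hw⟩ := exists_isLoc (k := k) (D := D) (κ := κ) g
    exact mem_corner h hw⟩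

section

variable {α ν β κ : Multiset I} (h : α + ν + β = κ)

/-- The value in `R(κ)` of an element of the free algebra. -/
def midVal (a : FreeAlgebra k (Gen I)) : KLRAlg k D κ :=
  cornerVal (k := k) (midOne_idem (k := k) (D := D) h) (FreeAlgebra.lift k (midCorner h) a)

theorem midVal_mul (a b : FreeAlgebra k (Gen I)) :
    midVal (D := D) h (a * b) = midVal h a * midVal h b := by
  unfold midVal; rw [map_mul]; rfl

theorem midVal_add (a b : FreeAlgebra k (Gen I)) :
    midVal (D := D) h (a + b) = midVal h a + midVal h b := by
  unfold midVal; rw [map_add]; rfl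

theorem midVal_zero : midVal (k := k) (D := D) h 0 = 0 := by
  unfold midVal; rw [map_zero]; rfl

theorem midVal_one : midVal (k := k) (D := D) h 1 = midOne k D α ν β κ := by
  unfold midVal; rw [map_one]; rfl

theorem midVal_sum {ι : Type*} (s : Finset ι) (f : ι → FreeAlgebra k (Gen I)) :
    midVal (D := D) h (∑ i ∈ s, f i) = ∑ i ∈ s, midVal h (f i) := by
  unfold midVal; rw [map_sum, map_sum]

theorem midVal_gen (g : Gen I) :
    midVal (k := k) (D := D) h (FreeAlgebra.ι k g) = midGen k D α β κ g := by
  unfold midVal; rw [FreeAlgebra.lift_ι_apply]; rfl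

/-- `a` is represented by the family `F` of diagrams. -/
def Rep (w' w : List I) (a : FreeAlgebra k (Gen I)) (F : List I × List I → KLRAlg k D κ) : Prop :=
  midVal h a = ∑ q ∈ words α ×ˢ words β, F q ∧ IsLoc w' w F

theorem rep_e (s : List I) :
    Rep (D := D) h s s (fe k s) (fun q => e k D κ (q.1 ++ (s ++ q.2))) :=
  ⟨midVal_gen h _, isLoc_e s⟩

theorem rep_x (u : List I) (i : I) (v : List I) : Rep (D := D) h (u ++ i :: v) (u ++ i :: v)
    (fx k u i v) (fun q => x k D κ (q.1 ++ u) i (v ++ q.2)) :=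
  ⟨midVal_gen h _, isLoc_x u i v⟩

theorem rep_t (u : List I) (i j : I) (v : List I) :
    Rep (D := D) h (u ++ j :: i :: v) (u ++ i :: j :: v)
      (ft k u i j v) (fun q => t k D κ (q.1 ++ u) i j (v ++ q.2)) :=
  ⟨midVal_gen h _, isLoc_t u i j v⟩

variable {h}

theorem Rep.mul {w₃ w₂ w₁ w₀ : List I} {a b : FreeAlgebra k (Gen I)}
    {F G : List I × List I → KLRAlg k D κ} (hF : Rep h w₃ w₂ a F) (hG : Rep h w₁ w₀ b G)
    (hw : w₂ = w₁ := by simp) : Rep h w₃ w₀ (a * b) (fun q => F q * G q) := by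
  subst hw
  refine ⟨by rw [midVal_mul, hF.1, hG.1, sum_mul_sum hF.2 hG.2], fun q => ⟨?_, ?_⟩⟩
  · rw [← mul_assoc, (hF.2 q).1]
  · rw [mul_assoc, (hG.2 q).2]

theorem Rep.add {w' w w₁ w₀ : List I} {a b : FreeAlgebra k (Gen I)}
    {F G : List I × List I → KLRAlg k D κ} (hF : Rep h w' w a F) (hG : Rep h w₁ w₀ b G)
    (hw : w' = w₁ := by simp) (hw' : w = w₀ := by simp) :
    Rep h w' w (a + b) (fun q => F q + G q) := by
  subst hw hw'
  refine ⟨by rw [midVal_add, hF.1, hG.1, Finset.sum_add_distrib], fun q => ⟨?_, ?_⟩⟩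
  · rw [mul_add, (hF.2 q).1, (hG.2 q).1]
  · rw [add_mul, (hF.2 q).2, (hG.2 q).2]

theorem Rep.pow_mul {w₂ w₁ w : List I} {a b : FreeAlgebra k (Gen I)}
    {F G : List I × List I → KLRAlg k D κ} (hF : Rep h w₂ w₂ a F) (hG : Rep h w₁ w b G) (n : ℕ)
    (hw : w₂ = w₁ := by simp) : Rep h w₁ w (a ^ n * b) (fun q => F q ^ n * G q) := by
  subst hw
  induction n with
  | zero => simpa using hG
  | succ n ih => simpa only [pow_succ', mul_assoc] using hF.mul ih

theorem Rep.sum {ι : Type} {w' w : List I} (s : Finset ι) {a : ι → FreeAlgebra k (Gen I)}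
    {F : ι → List I × List I → KLRAlg k D κ} (hF : ∀ c, Rep h w' w (a c) (F c)) :
    Rep h w' w (∑ c ∈ s, a c) (fun q => ∑ c ∈ s, F c q) := by
  refine ⟨by rw [midVal_sum, Finset.sum_comm]; exact Finset.sum_congr rfl fun c _ => (hF c).1,
    fun q => ⟨?_, ?_⟩⟩
  · rw [Finset.mul_sum]; exact Finset.sum_congr rfl fun c _ => ((hF c).2 q).1
  · rw [Finset.sum_mul]; exact Finset.sum_congr rfl fun c _ => ((hF c).2 q).2

theorem Rep.eq {w' w w₁ w₀ : List I} {a b : FreeAlgebra k (Gen I)}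
    {F G : List I × List I → KLRAlg k D κ} (hF : Rep h w' w a F) (hG : Rep h w₁ w₀ b G)
    (hFG : ∀ q, F q = G q) : midVal (D := D) h a = midVal h b := by
  rw [hF.1, hG.1]; exact Finset.sum_congr rfl fun q _ => hFG q

variable (h)

theorem mid_rel (a b : FreeAlgebra k (Gen I)) (hr : Rel k D ν a b) :
    FreeAlgebra.lift k (midCorner (k := k) (D := D) h) a = FreeAlgebra.lift k (midCorner h) b := by
  refine Subtype.ext ?_
  change midVal (D := D) h a = midVal h b
  have hR : ∀ {a b : FreeAlgebra k (Gen I)}, Rel k D κ a b → mk k D κ a = mk k D κ b := mk_rel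
  cases hr with
  | e_content s hs =>
    rw [(rep_e h s).1, midVal_zero]
    refine Finset.sum_eq_zero fun q hq => e_eq_zero ?_
    rw [Finset.mem_product, mem_words, mem_words] at hq
    rw [← Multiset.coe_add, ← Multiset.coe_add, hq.1, hq.2, ← h, add_assoc]
    simpa using hs
  | e_sum =>
    rw [midVal_sum, midVal_one]
    exact Finset.sum_congr rfl fun s _ => midVal_gen h _
  | e_idem s =>
    exact ((rep_e h s).mul (rep_e h s)).eq (rep_e h s) fun q => (isLoc_e s q).1
  | e_orth s s' hs =>
    rw [midVal_mul, midVal_zero, (rep_e h s).1, (rep_e h s').1, Finset.sum_mul]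
    refine Finset.sum_eq_zero fun q hq => ?_
    rw [Finset.mul_sum]
    refine Finset.sum_eq_zero fun q' hq' => ?_
    by_cases hl : q.1 ++ (s ++ q.2) = q'.1 ++ (s' ++ q'.2)
    · rw [Finset.mem_product] at hq hq'
      obtain ⟨-, h2⟩ := List.append_inj hl (length_eq_of_mem_words hq.1 hq'.1)
      exact absurd (List.append_inj' h2 (length_eq_of_mem_words hq.2 hq'.2)).1 hs
    · exact e_mul_e_of_ne hl
  | e_x u i v =>
    exact ((rep_e h (u ++ i :: v)).mul (rep_x h u i v)).eq (rep_x h u i v)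
      fun q => (isLoc_x u i v q).1
  | x_e u i v =>
    exact ((rep_x h u i v).mul (rep_e h (u ++ i :: v))).eq (rep_x h u i v)
      fun q => (isLoc_x u i v q).2
  | e_t u i j v =>
    exact ((rep_e h (u ++ j :: i :: v)).mul (rep_t h u i j v)).eq (rep_t h u i j v)
      fun q => (isLoc_t u i j v q).1
  | t_e u i j v =>
    exact ((rep_t h u i j v).mul (rep_e h (u ++ i :: j :: v))).eq (rep_t h u i j v)
      fun q => (isLoc_t u i j v q).2
  | x_x u i v j w =>
    exact ((rep_x h _ _ _).mul (rep_x h _ _ _)).eq ((rep_x h _ _ _).mul (rep_x h _ _ _))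
      fun q => by simpa using hR (.x_x (q.1 ++ u) i v j (w ++ q.2))
  | x_t u i v a b w =>
    exact ((rep_x h _ _ _).mul (rep_t h _ _ _ _)).eq ((rep_t h _ _ _ _).mul (rep_x h _ _ _))
      fun q => by simpa using hR (.x_t (q.1 ++ u) i v a b (w ++ q.2))
  | t_x u a b v i w =>
    exact ((rep_x h _ _ _).mul (rep_t h _ _ _ _)).eq ((rep_t h _ _ _ _).mul (rep_x h _ _ _))
      fun q => by simpa using hR (.t_x (q.1 ++ u) a b v i (w ++ q.2))
  | t_t u i j v a b w =>
    exact ((rep_t h _ _ _ _).mul (rep_t h _ _ _ _)).eq ((rep_t h _ _ _ _).mul (rep_t h _ _ _ _))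
      fun q => by simpa using hR (.t_t (q.1 ++ u) i j v a b (w ++ q.2))
  | sq_same u i v =>
    rw [((rep_t h _ _ _ _).mul (rep_t h _ _ _ _)).1, midVal_zero]
    exact Finset.sum_eq_zero fun q _ => by
      simpa using hR (.sq_same (q.1 ++ u) i (v ++ q.2))
  | sq_orth u i j v h1 h2 =>
    exact ((rep_t h _ _ _ _).mul (rep_t h _ _ _ _)).eq (rep_e h _)
      fun q => by simpa using hR (.sq_orth (q.1 ++ u) i j (v ++ q.2) h1 h2)
  | sq_ne u i j v h1 h2 =>
    exact ((rep_t h _ _ _ _).mul (rep_t h _ _ _ _)).eq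
      (((rep_x h _ _ _).pow_mul (rep_e h _) _).add ((rep_x h _ _ _).pow_mul (rep_e h _) _))
      fun q => by simpa using hR (.sq_ne (q.1 ++ u) i j (v ++ q.2) h1 h2)
  | real_left u i v h1 =>
    exact ((rep_x h _ _ _).mul (rep_t h _ _ _ _)).eq
      (((rep_t h _ _ _ _).mul (rep_x h _ _ _)).add (rep_e h _))
      fun q => by simpa using hR (.real_left (q.1 ++ u) i (v ++ q.2) h1)
  | real_right u i v h1 =>
    exact ((rep_t h _ _ _ _).mul (rep_x h _ _ _)).eq
      (((rep_x h _ _ _).mul (rep_t h _ _ _ _)).add (rep_e h _))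
      fun q => by simpa using hR (.real_right (q.1 ++ u) i (v ++ q.2) h1)
  | slide_left u i j v h1 =>
    exact ((rep_x h _ _ _).mul (rep_t h _ _ _ _)).eq ((rep_t h _ _ _ _).mul (rep_x h _ _ _))
      fun q => by simpa using hR (.slide_left (q.1 ++ u) i j (v ++ q.2) h1)
  | slide_right u i j v h1 =>
    exact ((rep_t h _ _ _ _).mul (rep_x h _ _ _)).eq ((rep_x h _ _ _).mul (rep_t h _ _ _ _))
      fun q => by simpa using hR (.slide_right (q.1 ++ u) i j (v ++ q.2) h1)
  | braid_real u i j v h1 h2 h3 =>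
    exact (((rep_t h _ _ _ _).mul (rep_t h _ _ _ _)).mul (rep_t h _ _ _ _)).eq
      ((((rep_t h _ _ _ _).mul (rep_t h _ _ _ _)).mul (rep_t h _ _ _ _)).add
        (Rep.sum _ fun c => by
          simpa only [mul_assoc] using
            (rep_x h u i (j :: i :: v)).pow_mul ((rep_x h (u ++ [i, j]) i v).pow_mul
              (rep_e h (u ++ i :: j :: i :: v)) ((-D.a i j).toNat - 1 - c)) c))
      fun q => by simpa [mul_assoc] using hR (.braid_real (q.1 ++ u) i j (v ++ q.2) h1 h2 h3)
  | braid u i j l v h1 =>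
    exact (((rep_t h _ _ _ _).mul (rep_t h _ _ _ _)).mul (rep_t h _ _ _ _)).eq
      (((rep_t h _ _ _ _).mul (rep_t h _ _ _ _)).mul (rep_t h _ _ _ _))
      fun q => by simpa [mul_assoc] using hR (.braid (q.1 ++ u) i j l (v ++ q.2) h1)

variable (k D)

/-- The (non-unital) embedding `a ↦ 1_α ⊗ a ⊗ 1_β` of `R(ν)` in `R(α + ν + β)`. -/
def mid : KLRAlg k D ν →ₗ[k] KLRAlg k D κ :=
  cornerVal (k := k) (midOne_idem h) ∘ₗ (lift (midCorner h) (mid_rel h)).toLinearMap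

theorem mid_gen (g : Gen I) : mid k D h (gen k D ν g) = midGen k D α β κ g := by
  change cornerVal (k := k) (midOne_idem h) (lift (midCorner h) (mid_rel h) (gen k D ν g)) = _
  rw [lift_gen]; rfl

theorem mid_one : mid k D h (1 : KLRAlg k D ν) = midOne k D α ν β κ := by
  change cornerVal (k := k) (midOne_idem h) (lift (midCorner h) (mid_rel h) 1) = _
  rw [map_one]; rfl

theorem mid_mul (a b : KLRAlg k D ν) : mid k D h (a * b) = mid k D h a * mid k D h b := by
  change cornerVal (k := k) (midOne_idem h) (lift (midCorner h) (mid_rel h) (a * b)) = _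
  rw [map_mul]; rfl

theorem midGen_mem_gr (g : Gen I) : midGen k D α β κ g ∈ gr k D κ (g.deg D) :=
  Submodule.sum_mem _ fun q _ => Gen.deg_place D q.1 q.2 g ▸ gen_mem_gr _

theorem midOne_mem_gr : midOne k D α ν β κ ∈ gr k D κ 0 := by
  unfold midOne
  exact Submodule.sum_mem _ fun s _ => midGen_mem_gr k D (.e s)

theorem mid_mem_gr_of_hasDeg {d : ℤ} {a : KLRAlg k D ν} (ha : HasDeg a d) :
    mid k D h a ∈ gr k D κ d := by
  induction ha with
  | one => rw [mid_one]; exact midOne_mem_gr k D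
  | gen_mul g _ ih =>
    rw [mid_mul, mid_gen]
    exact mul_mem_gr (midGen_mem_gr k D g) ih

theorem mid_mem_gr {d : ℤ} {a : KLRAlg k D ν} (ha : a ∈ gr k D ν d) :
    mid k D h a ∈ gr k D κ d := by
  induction ha using Submodule.span_induction with
  | zero => simp
  | add x y _ _ hx hy => rw [map_add]; exact add_mem hx hy
  | smul r x _ hx => rw [map_smul]; exact Submodule.smul_mem _ _ hx
  | mem a ha => exact mid_mem_gr_of_hasDeg k D h ha

end

end Place

end KLR

section Induction

variable (k : Type u) [Field k] {I : Type u} (D : BorcherdsCartan I)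

/-- The embedding `R(ν) ⊗ R(ν') → R(ν + ν')` by horizontal juxtaposition:
`a ⊗ b ↦ (a ⊗ 1_ν')(1_ν ⊗ b)`. -/
def juxt {ν ν' κ : Multiset I} (h : ν + ν' = κ) :
    KLRAlg k D ν ⊗[k] KLRAlg k D ν' →ₗ[k] KLRAlg k D κ :=
  LinearMap.mul' k (KLRAlg k D κ) ∘ₗ TensorProduct.map
    (KLR.mid k D (α := 0) (ν := ν) (β := ν') (by rw [zero_add, h]))
    (KLR.mid k D (α := ν) (ν := ν') (β := 0) (by rw [add_zero, h]))

/-- The graded algebra `R(ν₁) ⊗ ⋯ ⊗ R(νᵣ)`. -/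
def levi : List (Multiset I) → GrAlg k
  | [] => GrAlg.unit k
  | ν :: L => (klr k D ν).tensor (levi L)

/-- The composite `R(ν) ⊗ B → R(ν) ⊗ R(ν') → R(ν + ν')` for a linear map `B → R(ν')`. -/
def juxtEmb {ν ν' κ : Multiset I} (h : ν + ν' = κ) {B : GrAlg k} (f : B →ₗ[k] KLRAlg k D ν') :
    (klr k D ν).tensor B →ₗ[k] KLRAlg k D κ :=
  juxt k D h ∘ₗ (TensorProduct.map LinearMap.id f : KLRAlg k D ν ⊗[k] B →ₗ[k] _)

/-- The embedding `R(ν₁) ⊗ ⋯ ⊗ R(νᵣ) → R(ν₁ + ⋯ + νᵣ)` by horizontal juxtaposition. -/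
def leviEmb : (L : List (Multiset I)) → (κ : Multiset I) → L.sum = κ →
    (levi k D L →ₗ[k] KLRAlg k D κ)
  | [], κ, _ => Algebra.linearMap k (KLRAlg k D κ)
  | _ :: L, _, h => juxtEmb k D (by rw [← h, List.sum_cons]) (leviEmb L L.sum rfl)

end Induction

/-! Induction -/

section Ind

variable {k : Type u} [Field k]

/-- For graded algebras `A`, `B` and a graded `B`-module `M`: the graded `A`-module `A ⊗_k M`. -/
def GrMod.free (A : GrAlg k) {B : GrAlg k} (M : GrMod B) : GrMod A where
  carrier := A ⊗[k] M
  module := TensorProduct.leftModule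
  tower := TensorProduct.isScalarTower_left
  gr := tensorGr A.gr M.gr
  internal := tensorGr_internal A.internal M.internal
  smul_mem := by
    intro c d a t ha ht
    induction ht using Submodule.span_induction with
    | zero => rw [smul_zero]; exact zero_mem _
    | add x y _ _ hx hy => rw [smul_add]; exact add_mem hx hy
    | smul r x _ hx => rw [smul_comm]; exact Submodule.smul_mem _ _ hx
    | mem x hx =>
      obtain ⟨p, q, rfl, b, hb, m, hm, rfl⟩ := hx
      rw [TensorProduct.smul_tmul', smul_eq_mul]
      exact tmul_mem_tensorGr (by ring) (A.mul_mem ha hb) hm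

/-- The pure tensor `a ⊗ m`. -/
def GrMod.freeTmul (A : GrAlg k) {B : GrAlg k} (M : GrMod B) :
    A →ₗ[k] M →ₗ[k] GrMod.free A M := TensorProduct.mk k A M

theorem GrMod.freeTmul_mem (A : GrAlg k) {B : GrAlg k} (M : GrMod B) {c d : ℤ} {a : A} {m : M}
    (ha : a ∈ A.gr c) (hm : m ∈ M.gr d) :
    GrMod.freeTmul A M a m ∈ (GrMod.free A M).gr (c + d) :=
  tmul_mem_tensorGr rfl ha hm

variable {A B : GrAlg k} (φ : B →ₗ[k] A) (M : GrMod B)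

/-- The relations `a φ(b) ⊗ m = a ⊗ b m` defining `A φ(1) ⊗_B M` as a quotient of `A ⊗_k M`;
for `b = 1` they say `a ⊗ m = a φ(1) ⊗ m`. -/
def indRel : Submodule A (GrMod.free A M) :=
  Submodule.span A {t | ∃ (a : A) (b : B) (m : M),
    GrMod.freeTmul A M (a * φ b) m - GrMod.freeTmul A M a (b • m) = t}

theorem indRel_isGradedSub (hφ : ∀ d, ∀ b ∈ B.gr d, φ b ∈ A.gr d) :
    (GrMod.free A M).IsGradedSub (indRel φ M) := by
  intro t ht
  have ht' : t ∈ indRel φ M := ht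
  unfold indRel at ht'
  induction ht' using Submodule.span_induction with
  | zero => exact zero_mem _
  | add x y hx hy ihx ihy => exact add_mem (ihx hx) (ihy hy)
  | mem t h =>
    clear ht
    obtain ⟨a, b, m, rfl⟩ := h
    have ha : a ∈ ⨆ d, A.gr d := A.internal.submodule_iSup_eq_top ▸ Submodule.mem_top
    have hb : b ∈ ⨆ d, B.gr d := B.internal.submodule_iSup_eq_top ▸ Submodule.mem_top
    have hm : m ∈ ⨆ d, M.gr d := M.internal.submodule_iSup_eq_top ▸ Submodule.mem_top
    induction ha using Submodule.iSup_induction' with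
    | zero => simp
    | add x y _ _ hx hy =>
      rw [add_mul, map_add, map_add, LinearMap.add_apply, LinearMap.add_apply, add_sub_add_comm]
      exact add_mem hx hy
    | mem c a ha =>
      induction hb using Submodule.iSup_induction' with
      | zero => simp
      | add x y _ _ hx hy =>
        rw [map_add, mul_add, add_smul, map_add, map_add, LinearMap.add_apply, add_sub_add_comm]
        exact add_mem hx hy
      | mem d b hb =>
        induction hm using Submodule.iSup_induction' with
        | zero => simp
        | add x y _ _ hx hy =>
          rw [smul_add, map_add, map_add, add_sub_add_comm]
          exact add_mem hx hy
        | mem f m hm =>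
          refine Submodule.mem_iSup_of_mem (c + d + f)
            ⟨Submodule.subset_span ⟨a, b, m, rfl⟩, sub_mem ?_ ?_⟩
          · exact GrMod.freeTmul_mem A M (A.mul_mem ha (hφ d b hb)) hm
          · rw [add_assoc]
            exact GrMod.freeTmul_mem A M ha (M.smul_mem hb hm)
  | smul a x hx ih =>
    have hx' := ih hx
    have ha : a ∈ ⨆ d, A.gr d := A.internal.submodule_iSup_eq_top ▸ Submodule.mem_top
    clear ht hx ih
    induction hx' using Submodule.iSup_induction' with
    | zero => rw [smul_zero]; exact zero_mem _
    | add x y _ _ hx hy => rw [smul_add]; exact add_mem hx hy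
    | mem d x hx =>
      induction ha using Submodule.iSup_induction' with
      | zero => rw [zero_smul]; exact zero_mem _
      | add a b _ _ ha hb => rw [add_smul]; exact add_mem ha hb
      | mem c a ha =>
        exact Submodule.mem_iSup_of_mem (c + d)
          ⟨(indRel φ M).smul_mem a hx.1, (GrMod.free A M).smul_mem ha hx.2⟩

/-- Induction `A φ(1) ⊗_B M` along a degree-preserving, not necessarily unital, algebra
homomorphism `φ : B → A`. -/
def indAlong (hφ : ∀ d, ∀ b ∈ B.gr d, φ b ∈ A.gr d) : GrMod A :=
  (GrMod.free A M).quot (indRel φ M) (indRel_isGradedSub φ M hφ)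

end Ind

section Parabolic

variable {k : Type u} [Field k] {I : Type u} (D : BorcherdsCartan I)

theorem juxtEmb_mem {ν ν' κ : Multiset I} (h : ν + ν' = κ) {B : GrAlg k}
    (f : B →ₗ[k] KLRAlg k D ν') (hf : ∀ d, ∀ b ∈ B.gr d, f b ∈ KLR.gr k D ν' d) (d : ℤ)
    (b : (klr k D ν).tensor B) (hb : b ∈ ((klr k D ν).tensor B).gr d) :
    juxtEmb k D h f b ∈ KLR.gr k D κ d := by
  refine Submodule.span_induction (p := fun b _ => juxtEmb k D h f b ∈ KLR.gr k D κ d)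
    ?_ ?_ ?_ ?_ hb
  · rintro _ ⟨p, q, rfl, m, hm, n, hn, rfl⟩
    exact KLR.mul_mem_gr (KLR.mid_mem_gr k D _ hm) (KLR.mid_mem_gr k D _ (hf q n hn))
  · rw [map_zero]; exact zero_mem _
  · intro x y _ _ hx hy
    rw [map_add]; exact add_mem hx hy
  · intro c x _ hx
    rw [map_smul]; exact Submodule.smul_mem _ _ hx

theorem algebraMap_mem_gr (κ : Multiset I) (d : ℤ) (b : k) (hb : b ∈ unitGr k d) :
    algebraMap k (KLRAlg k D κ) b ∈ KLR.gr k D κ d := by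
  by_cases hd : d = 0
  · rw [hd, Algebra.algebraMap_eq_smul_one]
    exact Submodule.smul_mem _ _ KLR.one_mem_gr
  · simp only [unitGr, if_neg hd, Submodule.mem_bot] at hb
    rw [hb, map_zero]
    exact zero_mem _

theorem leviEmb_mem : ∀ (L : List (Multiset I)) (κ : Multiset I) (h : L.sum = κ) (d : ℤ)
    (b : levi k D L) (_ : b ∈ (levi k D L).gr d), leviEmb k D L κ h b ∈ (klr k D κ).gr d
  | [], κ, _, d, b, hb => algebraMap_mem_gr (k := k) D κ d b hb
  | _ :: L, _, h, d, b, hb =>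
    juxtEmb_mem D (by rw [← h, List.sum_cons]) (leviEmb k D L L.sum rfl)
      (leviEmb_mem L L.sum rfl) d b hb

/-- The induction functor `Ind` from graded `R(ν₁) ⊗ ⋯ ⊗ R(νᵣ)`-modules to graded
`R(ν₁ + ⋯ + νᵣ)`-modules, `M ↦ R(κ) 1_{ν₁,…,νᵣ} ⊗ M` (tensor product over
`R(ν₁) ⊗ ⋯ ⊗ R(νᵣ)`), where `κ = ν₁ + ⋯ + νᵣ`. -/
def Ind (L : List (Multiset I)) {κ : Multiset I} (h : L.sum = κ) (M : GrMod (levi k D L)) :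
    GrMod (klr k D κ) :=
  indAlong (A := klr k D κ) (leviEmb k D L κ h) M (leviEmb_mem D L κ h)

end Parabolic

/-! The trivial modules `V(i^n)` for imaginary `i`, and the function `ε_i` -/

section Trivial

variable (k : Type u) [Field k] {I : Type u} {D : BorcherdsCartan I}

/-- The trivial representation of `R(ν)` on generators: identity diagrams of words of content `ν`
act by `1`, dots and crossings by `0`. -/
def trivGen (ν : Multiset I) : Gen I → k
  | .e s => open Classical in if s ∈ words ν then 1 else 0
  | .x _ _ _ => 0
  | .t _ _ _ _ => 0

theorem mem_words_replicate {i : I} {n : ℕ} {s : List I} :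
    s ∈ words (Multiset.replicate n i) ↔ s = List.replicate n i := by
  rw [KLR.mem_words, ← Multiset.coe_replicate, Multiset.coe_eq_coe, List.perm_replicate]

theorem trivGen_rel {i : I} (hi : D.IsImaginary i) (n : ℕ) (a b : FreeAlgebra k (Gen I))
    (h : KLR.Rel k D (Multiset.replicate n i) a b) :
    FreeAlgebra.lift k (trivGen k (Multiset.replicate n i)) a
      = FreeAlgebra.lift k (trivGen k (Multiset.replicate n i)) b := by
  classical
  have hE : ∀ s, FreeAlgebra.lift k (trivGen k (Multiset.replicate n i)) (KLR.fe k s)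
      = if s = List.replicate n i then 1 else 0 := fun s => by
    refine (FreeAlgebra.lift_ι_apply _ _).trans ?_
    simp only [trivGen, mem_words_replicate]
  have hX : ∀ u j v, FreeAlgebra.lift k (trivGen k (Multiset.replicate n i)) (KLR.fx k u j v)
      = 0 := fun u j v => FreeAlgebra.lift_ι_apply _ _
  have hT : ∀ u j l v, FreeAlgebra.lift k (trivGen k (Multiset.replicate n i)) (KLR.ft k u j l v)
      = 0 := fun u j l v => FreeAlgebra.lift_ι_apply _ _
  have hmem : ∀ {s : List I} {j : I}, s = List.replicate n i → j ∈ s → j = i := by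
    rintro s j rfl hj
    exact (List.mem_replicate.1 hj).2
  have hne : ∀ u j l v, j ≠ l → u ++ j :: l :: v ≠ List.replicate n i := by
    intro u j l v hjl h
    exact hjl ((hmem h (by simp)).trans (hmem h (by simp)).symm)
  have hreal : ∀ u j v, D.IsReal j → u ++ j :: j :: v ≠ List.replicate n i := by
    intro u j v hj h
    have := hmem (j := j) h (by simp)
    subst this
    unfold BorcherdsCartan.IsReal at hj
    unfold BorcherdsCartan.IsImaginary at hi
    omega
  cases h with
  | e_content s h =>
    rw [hE, map_zero, if_neg]
    rintro rfl
    exact h (Multiset.coe_replicate n i)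
  | e_sum =>
    rw [map_sum, map_one, Finset.sum_eq_single (List.replicate n i), hE, if_pos rfl]
    · intro s _ h
      rw [hE, if_neg h]
    · intro h
      exact absurd (mem_words_replicate.2 rfl) h
  | e_idem s =>
    rw [map_mul, hE]
    split_ifs <;> simp
  | e_orth s s' h =>
    rw [map_mul, map_zero, hE, hE]
    split_ifs with h1 h2
    · exact absurd (h1.trans h2.symm) h
    all_goals simp
  | sq_orth u j l v h h' => simp only [map_mul, hT, hE, if_neg (hne u j l v h), mul_zero]
  | sq_ne u j l v h h' =>
    simp only [map_mul, map_add, hT, hE, if_neg (hne u j l v h), mul_zero, add_zero]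
  | real_left u j v h | real_right u j v h =>
    simp only [map_mul, map_add, hT, hE, hX, if_neg (hreal u j v h), mul_zero, add_zero]
  | braid_real u j l v h h' h'' =>
    simp only [map_mul, map_add, map_sum, hT, hE, if_neg (hne u j l (j :: v) h'), mul_zero,
      add_zero, Finset.sum_const_zero]
  | _ => simp only [map_mul, map_zero, hX, hT, mul_zero, zero_mul]

/-- The trivial representation of `R(ni)`, `i` imaginary. -/
def trivHom {i : I} (hi : D.IsImaginary i) (n : ℕ) :
    KLRAlg k D (Multiset.replicate n i) →ₐ[k] k :=
  KLR.lift (trivGen k (Multiset.replicate n i)) (trivGen_rel k hi n)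

theorem trivGen_mem (ν : Multiset I) (g : Gen I) : trivGen k ν g ∈ unitGr k (g.deg D) := by
  cases g with
  | e s => simp [unitGr, Gen.deg]
  | x u i v => exact zero_mem _
  | t u i j v => exact zero_mem _

theorem trivHom_mem {i : I} (hi : D.IsImaginary i) (n : ℕ) {d : ℤ}
    {a : KLRAlg k D (Multiset.replicate n i)} (ha : a ∈ KLR.gr k D (Multiset.replicate n i) d) :
    trivHom k hi n a ∈ unitGr k d := by
  induction ha using Submodule.span_induction with
  | zero => rw [map_zero]; exact zero_mem _
  | add x y _ _ hx hy => rw [map_add]; exact add_mem hx hy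
  | smul r x _ hx => rw [map_smul]; exact Submodule.smul_mem _ _ hx
  | mem a ha =>
    induction ha with
    | one => rw [map_one]; simp [unitGr]
    | gen_mul g _ ih =>
      rw [map_mul, trivHom, KLR.lift_gen]
      exact mul_mem_unitGr (trivGen_mem k _ g) ih

/-- The one-dimensional trivial graded `R(ni)`-module `V(i^n)` for an imaginary index `i`,
concentrated in degree zero: all dots and crossings act by zero. -/
def V {i : I} (hi : D.IsImaginary i) (n : ℕ) : GrMod (klr k D (Multiset.replicate n i)) where
  carrier := k
  addCommGroup := inferInstanceAs (AddCommGroup k)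
  kmodule := inferInstanceAs (Module k k)
  module := Module.compHom k (trivHom k hi n).toRingHom
  tower :=
    letI : Module (klr k D (Multiset.replicate n i)) k :=
      Module.compHom k (trivHom k hi n).toRingHom
    ⟨fun r x y => by
      change trivHom k hi n (r • x) * y = r * (trivHom k hi n x * y)
      rw [← mul_assoc, ← smul_eq_mul r]
      exact congrArg (· * y) (map_smul (trivHom k hi n) r x)⟩
  gr := unitGr k
  internal := unitGr_internal
  smul_mem := fun ha hm => mul_mem_unitGr (trivHom_mem k hi n ha) hm

/-- `V(i^μ) = V(i^μ₁) ⊗ ⋯ ⊗ V(i^μᵣ)`, a module over `R(μ₁i) ⊗ ⋯ ⊗ R(μᵣi)`. -/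
def Vmu {i : I} (hi : D.IsImaginary i) :
    (μ : List ℕ) → GrMod (levi k D (μ.map fun m => Multiset.replicate m i))
  | [] => GrMod.unit k
  | m :: μ => (V k hi m).tensor (Vmu hi μ)

theorem sum_map_replicate (i : I) (μ : List ℕ) :
    (μ.map fun m => Multiset.replicate m i).sum = Multiset.replicate μ.sum i := by
  induction μ with
  | nil => simp
  | cons m μ ih => rw [List.map_cons, List.sum_cons, List.sum_cons, ih, Multiset.replicate_add]

end Trivial

section Epsilon

variable {k : Type u} [Field k] {I : Type u} {D : BorcherdsCartan I} {ν : Multiset I}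

/-- The idempotent `1_{ν-mi} ⊗ 1_{mi}`: the sum of `1_s` over the words `s ∈ Seq(ν)` that end
with `m` letters `i`. -/
def tailIdem (k : Type u) [Field k] (D : BorcherdsCartan I) (ν : Multiset I) (i : I) (m : ℕ) :
    klr k D ν :=
  open Classical in ∑ s ∈ (words ν).filter fun s => List.replicate m i <:+ s, KLR.e k D ν s

/-- The subspace `Δ_{i^m} M = (1_{ν-mi} ⊗ 1_{mi}) M`. -/
def Delta (M : GrMod (klr k D ν)) (i : I) (m : ℕ) : Submodule k M :=
  LinearMap.range (Algebra.lsmul k k M (tailIdem k D ν i m))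

/-- `ε_i(M)`, the maximal `m` with `Δ_{i^m} M ≠ 0`.  (The set is bounded by the length of the
words of content `ν`, and contains `0` if `M ≠ 0`.) -/
def epsilon (i : I) (M : GrMod (klr k D ν)) : ℕ := sSup {m | Delta M i m ≠ ⊥}

/-- `Ind K ⊗ V(i^μ)`, where `μ = (μ₁, …, μᵣ)` and `n = μ₁ + ⋯ + μᵣ`: the induction of
`K ⊗ V(i^μ₁) ⊗ ⋯ ⊗ V(i^μᵣ)` from `R(ν) ⊗ R(μ₁i) ⊗ ⋯ ⊗ R(μᵣi)` to `R(ν + ni)`.  The case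
`Ind K ⊗ V(i^n)` is `μ = (n)`. -/
def indV (K : GrMod (klr k D ν)) {i : I} (hi : D.IsImaginary i) (μ : List ℕ) {n : ℕ}
    (h : μ.sum = n) : GrMod (klr k D (ν + Multiset.replicate n i)) :=
  Ind D (ν :: μ.map fun m => Multiset.replicate m i)
    (by rw [List.sum_cons, sum_map_replicate, h]) (K.tensor (Vmu k hi μ))

end Epsilon

end Borcherds

end

noncomputable section

namespace Borcherds

/-! The defining relations of `R(κ)`, as equations between generators -/

namespace KLR

section Relations

variable {k : Type u} [Field k] {I : Type u} {D : BorcherdsCartan I} {κ : Multiset I}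

/-! The module `M = Ind K ⊗ V(i^μ)` is generated by the image of a single map `γ : K → M`, `x ↦ 1 ⊗
x ⊗ v` (`indVTop`). This map is `R(ν)`-linear, and its image is killed by all dots of `R(ni)`, since
each of these dots lies in one of the factors `R(μ_j i)`. The structure of the head follows from
these properties of `γ` together with `M ≠ 0`.

As `i` is imaginary, dots slide freely through crossings of strands of colour `i`, and the crossings
of `R(ni)` satisfy the nil-Coxeter relations. So the dots of `R(ni)` kill every `τ γ(x)` with `τ` a
product of crossings of `R(ni)`, and all sufficiently long products `τ` vanish. Let `tailSpan c` be
the span of the `τ γ(x)` with `τ` of length at least `c`; then `tailSpan 0` is stable under `R(ν)`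
and under `R(ni)`.

Mark the `n` strands that come from `R(ni)`. Moving marked strands to the left past unmarked ones
produces, out of `tailSpan 0`, a spanning set of `M` (`Shuffle`, `mem_closure_shuffle`): a crossing
that undoes a move yields a polynomial in dots, and the braid relations that occur have no
correction term because an outer strand has the imaginary colour `i`. A shuffle whose word ends in
`n` or more letters `i` either has its marks in the last `n` places or has `i` as its last unmarked
letter, and in the second case it is zero because `ε_i(K) = 0`. Hence `1_{ν,ni} M` lies in `tailSpan
0`, and no word with more than `n` final letters `i` occurs in `M`.

For a graded submodule `N` of `M`, the vectors `x` with `γ(x) ∈ N + tailSpan 1` form a graded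
submodule of `K`, which is `0` or `K`. If it is `K`, nilpotency of the crossings gives `γ(K) ⊆ N`, a
Nakayama argument (`apply_mem_of_sup`), so `N = M`. If it is `0`, then `1_{ν,ni} N ⊆ tailSpan 1`.
This last condition passes to sums, so the sum of all proper graded submodules is proper: otherwise
`γ(K) ⊆ tailSpan 1`, and Nakayama gives `γ = 0`. Thus `M` has a largest proper graded submodule
(`exists_isLargestProper`), which makes the head irreducible; `epsilon_hd` computes its `ε_i`.

The module `V(i^μ)` is the restriction of `V(i^n)`, so the universal property of induction gives a
degree-preserving surjection from `M` onto `Ind K ⊗ V(i^n)` (`exists_indV_surjective`). Both sides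
have a largest proper graded submodule, so the heads agree (`hd_iso_of_surjective`).

Nonvanishing of `M` is obtained without a basis theorem for `R(ν + ni)`. There is an explicit module
(`insertion`) of families of vectors of `K` indexed by marked words, in which marked strands carry
no dots and do not cross each other; `M` maps to it, and some `γ(x)` has nonzero image
(`nontrivial_indV`). -/

theorem sum_e : ∑ s ∈ words κ, e k D κ s = 1 := by
  simpa using mk_rel (k := k) (D := D) (Rel.e_sum (ν := κ))

theorem e_mul_e (s : List I) : e k D κ s * e k D κ s = e k D κ s := by
  simpa using mk_rel (k := k) (D := D) (ν := κ) (Rel.e_idem s)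

theorem e_mul_x (u : List I) (i : I) (v : List I) :
    e k D κ (u ++ i :: v) * x k D κ u i v = x k D κ u i v := by
  simpa using mk_rel (k := k) (D := D) (ν := κ) (Rel.e_x u i v)

theorem x_mul_e (u : List I) (i : I) (v : List I) :
    x k D κ u i v * e k D κ (u ++ i :: v) = x k D κ u i v := by
  simpa using mk_rel (k := k) (D := D) (ν := κ) (Rel.x_e u i v)

theorem e_mul_t (u : List I) (i j : I) (v : List I) :
    e k D κ (u ++ j :: i :: v) * t k D κ u i j v = t k D κ u i j v := by
  simpa using mk_rel (k := k) (D := D) (ν := κ) (Rel.e_t u i j v)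

theorem t_mul_e (u : List I) (i j : I) (v : List I) :
    t k D κ u i j v * e k D κ (u ++ i :: j :: v) = t k D κ u i j v := by
  simpa using mk_rel (k := k) (D := D) (ν := κ) (Rel.t_e u i j v)

theorem x_eq_zero {u : List I} {i : I} {v : List I} (h : ((u ++ i :: v : List I) : Multiset I) ≠ κ) :
    x k D κ u i v = 0 := by
  rw [← e_mul_x, e_eq_zero h, zero_mul]

theorem t_eq_zero {u : List I} {i j : I} {v : List I}
    (h : ((u ++ i :: j :: v : List I) : Multiset I) ≠ κ) : t k D κ u i j v = 0 := by
  rw [← t_mul_e, e_eq_zero h, mul_zero]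

theorem x_mul_x (u : List I) (i : I) (v : List I) (j : I) (w : List I) :
    x k D κ u i (v ++ j :: w) * x k D κ (u ++ i :: v) j w
      = x k D κ (u ++ i :: v) j w * x k D κ u i (v ++ j :: w) := by
  simpa using mk_rel (k := k) (D := D) (ν := κ) (Rel.x_x u i v j w)

theorem x_mul_t (u : List I) (i : I) (v : List I) (a b : I) (w : List I) :
    x k D κ u i (v ++ b :: a :: w) * t k D κ (u ++ i :: v) a b w
      = t k D κ (u ++ i :: v) a b w * x k D κ u i (v ++ a :: b :: w) := by
  simpa using mk_rel (k := k) (D := D) (ν := κ) (Rel.x_t u i v a b w)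

theorem x_mul_t' (u : List I) (a b : I) (v : List I) (i : I) (w : List I) :
    x k D κ (u ++ b :: a :: v) i w * t k D κ u a b (v ++ i :: w)
      = t k D κ u a b (v ++ i :: w) * x k D κ (u ++ a :: b :: v) i w := by
  simpa using mk_rel (k := k) (D := D) (ν := κ) (Rel.t_x u a b v i w)

theorem t_mul_t (u : List I) (i j : I) (v : List I) (a b : I) (w : List I) :
    t k D κ u i j (v ++ b :: a :: w) * t k D κ (u ++ i :: j :: v) a b w
      = t k D κ (u ++ j :: i :: v) a b w * t k D κ u i j (v ++ a :: b :: w) := by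
  simpa using mk_rel (k := k) (D := D) (ν := κ) (Rel.t_t u i j v a b w)

theorem t_sq_same (u : List I) (i : I) (v : List I) :
    t k D κ u i i v * t k D κ u i i v = 0 := by
  simpa using mk_rel (k := k) (D := D) (ν := κ) (Rel.sq_same u i v)

theorem t_sq_orth (u : List I) {i j : I} (v : List I) (h : i ≠ j) (h' : D.form i j = 0) :
    t k D κ u j i v * t k D κ u i j v = e k D κ (u ++ i :: j :: v) := by
  simpa using mk_rel (k := k) (D := D) (ν := κ) (Rel.sq_orth u i j v h h')

theorem t_sq_ne (u : List I) {i j : I} (v : List I) (h : i ≠ j) (h' : D.form i j ≠ 0) :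
    t k D κ u j i v * t k D κ u i j v
      = x k D κ u i (j :: v) ^ (-D.a i j).toNat * e k D κ (u ++ i :: j :: v)
        + x k D κ (u ++ [i]) j v ^ (-D.a j i).toNat * e k D κ (u ++ i :: j :: v) := by
  simpa using mk_rel (k := k) (D := D) (ν := κ) (Rel.sq_ne u i j v h h')

theorem x_mul_t_real (u : List I) {i : I} (v : List I) (h : D.IsReal i) :
    x k D κ u i (i :: v) * t k D κ u i i v
      = t k D κ u i i v * x k D κ (u ++ [i]) i v + e k D κ (u ++ i :: i :: v) := by
  simpa using mk_rel (k := k) (D := D) (ν := κ) (Rel.real_left u i v h)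

theorem t_mul_x_real (u : List I) {i : I} (v : List I) (h : D.IsReal i) :
    t k D κ u i i v * x k D κ u i (i :: v)
      = x k D κ (u ++ [i]) i v * t k D κ u i i v + e k D κ (u ++ i :: i :: v) := by
  simpa using mk_rel (k := k) (D := D) (ν := κ) (Rel.real_right u i v h)

theorem x_mul_t_slide (u : List I) {i j : I} (v : List I) (h : i ≠ j ∨ D.IsImaginary i) :
    x k D κ u j (i :: v) * t k D κ u i j v = t k D κ u i j v * x k D κ (u ++ [i]) j v := by
  simpa using mk_rel (k := k) (D := D) (ν := κ) (Rel.slide_left u i j v h)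

theorem t_mul_x_slide (u : List I) {i j : I} (v : List I) (h : i ≠ j ∨ D.IsImaginary i) :
    t k D κ u i j v * x k D κ u i (j :: v) = x k D κ (u ++ [j]) i v * t k D κ u i j v := by
  simpa using mk_rel (k := k) (D := D) (ν := κ) (Rel.slide_right u i j v h)

theorem braid_real (u : List I) {i j : I} (v : List I) (h : D.IsReal i) (h' : i ≠ j)
    (h'' : D.form i j ≠ 0) :
    t k D κ u j i (i :: v) * t k D κ (u ++ [j]) i i v * t k D κ u i j (i :: v)
      = t k D κ (u ++ [i]) i j v * t k D κ u i i (j :: v) * t k D κ (u ++ [i]) j i v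
        + ∑ c ∈ Finset.range (-D.a i j).toNat,
            x k D κ u i (j :: i :: v) ^ c
              * x k D κ (u ++ [i, j]) i v ^ ((-D.a i j).toNat - 1 - c)
              * e k D κ (u ++ i :: j :: i :: v) := by
  simpa using mk_rel (k := k) (D := D) (ν := κ) (Rel.braid_real u i j v h h' h'')

theorem braid (u : List I) {i j l : I} (v : List I)
    (h : ¬ (i = l ∧ D.IsReal i ∧ i ≠ j ∧ D.form i j ≠ 0)) :
    t k D κ u j l (i :: v) * t k D κ (u ++ [j]) i l v * t k D κ u i j (l :: v)
      = t k D κ (u ++ [l]) i j v * t k D κ u i l (j :: v) * t k D κ (u ++ [i]) j l v := by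
  simpa using mk_rel (k := k) (D := D) (ν := κ) (Rel.braid u i j l v h)

theorem gen_induction {p : KLRAlg k D κ → Prop} (hone : ∀ c : k, p (algebraMap k _ c))
    (hgen : ∀ g, p (gen k D κ g)) (hadd : ∀ a b, p a → p b → p (a + b))
    (hmul : ∀ a b, p a → p b → p (a * b)) (a : KLRAlg k D κ) : p a := by
  obtain ⟨a, rfl⟩ := mk_surjective k D κ a
  induction a using FreeAlgebra.induction with
  | grade0 r => rw [AlgHom.commutes]; exact hone r
  | grade1 g => exact hgen g
  | add a b ha hb => rw [map_add]; exact hadd _ _ ha hb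
  | mul a b ha hb => rw [map_mul]; exact hmul _ _ ha hb

end Relations

end KLR

/-! Products of nil-Coxeter generators -/

section NilCoxeter

variable {R : Type*} [Ring R]

/-- The relations of the nil-Coxeter generators of a symmetric group. -/
structure IsNilCoxeter (T : ℕ → R) : Prop where
  sq : ∀ q, T q * T q = 0
  comm : ∀ p q, p + 2 ≤ q → T p * T q = T q * T p
  braid : ∀ q, T q * T (q + 1) * T q = T (q + 1) * T q * T (q + 1)

/-- The product `T_{j+d-1} ⋯ T_{j+1} T_j`. -/
def descProd (T : ℕ → R) (j : ℕ) : ℕ → R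
  | 0 => 1
  | d + 1 => T (j + d) * descProd T j d

namespace IsNilCoxeter

variable {T : ℕ → R} (hT : IsNilCoxeter T)

theorem descProd_succ_mul (T : ℕ → R) (j d : ℕ) :
    descProd T (j + 1) d * T j = descProd T j (d + 1) := by
  induction d with
  | zero => simp [descProd]
  | succ d ih =>
    rw [descProd, mul_assoc, ih, descProd.eq_2 T j (d + 1)]
    congr 2
    omega

include hT

theorem descProd_mul_comm {m j : ℕ} (h : m + 2 ≤ j) (d : ℕ) :
    descProd T j d * T m = T m * descProd T j d := by
  induction d with
  | zero => simp [descProd]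
  | succ d ih =>
    rw [descProd, mul_assoc, ih, ← mul_assoc, ← mul_assoc, hT.comm m (j + d) (by omega)]

theorem descProd_mul_self (j d : ℕ) : descProd T j (d + 1) * T j = 0 := by
  rw [← descProd_succ_mul, mul_assoc, hT.sq, mul_zero]

/-- On its way to the left `T m` commutes with the factors of index below `m - 1`. It then meets `T
m * T (m - 1)`, where the braid relation turns it into `T (m - 1)`, and this commutes with the
remaining factors of index above `m`. -/
theorem descProd_mul_shift (j d m : ℕ) (h1 : j < m) (h2 : m < j + d) :
    descProd T j d * T m = T (m - 1) * descProd T j d := by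
  induction d with
  | zero => omega
  | succ d ih =>
    rcases Nat.lt_or_ge m (j + d) with h | h
    · rw [descProd, mul_assoc, ih h, ← mul_assoc, ← mul_assoc, hT.comm (m - 1) (j + d) (by omega)]
    · obtain ⟨d, rfl⟩ : ∃ d', d = d' + 1 := ⟨d - 1, by omega⟩
      obtain rfl : m = j + d + 1 := by omega
      clear ih h h1 h2
      -- All factors here have index at most `j + d - 1`, two less than `j + d + 1`.
      have hc : descProd T j d * T (j + d + 1) = T (j + d + 1) * descProd T j d := by
        suffices H : ∀ e, e ≤ d → descProd T j e * T (j + d + 1) = T (j + d + 1) * descProd T j e by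
          exact H d le_rfl
        intro e he
        induction e with
        | zero => simp [descProd]
        | succ e ih =>
          rw [descProd, mul_assoc, ih (by omega), ← mul_assoc, ← mul_assoc,
            hT.comm (j + e) (j + d + 1) (by omega)]
      simp only [descProd, Nat.add_sub_cancel]
      have := hT.braid (j + d)
      calc T (j + (d + 1)) * (T (j + d) * descProd T j d) * T (j + d + 1)
          = T (j + d + 1) * T (j + d) * (descProd T j d * T (j + d + 1)) := by
            simp only [mul_assoc, add_assoc]
        _ = T (j + d + 1) * T (j + d) * T (j + d + 1) * descProd T j d := by
            rw [hc]; simp only [mul_assoc]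
        _ = _ := by rw [← this]; simp only [mul_assoc, add_assoc]

/-- This mirrors the coset decomposition of a symmetric group modulo the next smaller one: every
word is a word in the smaller generators times a run `T N ⋯ T j`. A letter `m` appended on the right
commutes with the run if `m + 1 < j`, extends it if `m + 1 = j`, kills it if `m = j`, and passes
through it as `m - 1` if `m > j`. No move changes the total length, which is what makes the
nilpotency bound possible. -/
theorem exists_normal_form (N : ℕ) (l : List ℕ) (hl : ∀ q ∈ l, q < N + 1) :
    (l.map T).prod = 0 ∨ ∃ l' : List ℕ, ∃ j d, j + d = N + 1 ∧ (∀ q ∈ l', q < N) ∧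
      l.length = l'.length + d ∧ (l.map T).prod = (l'.map T).prod * descProd T j d := by
  induction l using List.reverseRecOn with
  | nil => exact .inr ⟨[], N + 1, 0, by simp, by simp, by simp, by simp [descProd]⟩
  | append_singleton l m ih =>
    have hm : m < N + 1 := hl m (by simp)
    rcases ih fun q hq => hl q (by simp [hq]) with h | ⟨l', j, d, hjd, hl', hlen, h⟩
    · exact .inl (by rw [List.map_append, List.prod_append, h, zero_mul])
    · have h' : ((l ++ [m]).map T).prod = (l'.map T).prod * (descProd T j d * T m) := by
        rw [List.map_append, List.prod_append, h]; simp [mul_assoc]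
      rcases lt_trichotomy m j with hmj | rfl | hmj
      · rcases Nat.lt_or_ge (m + 1) j with h1 | h1
        · refine .inr ⟨l' ++ [m], j, d, hjd, ?_, ?_, ?_⟩
          · intro q hq
            rcases List.mem_append.1 hq with hq | hq
            · exact hl' q hq
            · rw [List.mem_singleton.1 hq]; omega
          · simp only [List.length_append, List.length_singleton]; omega
          · rw [h', hT.descProd_mul_comm h1]; simp [mul_assoc]
        · obtain rfl : j = m + 1 := by omega
          refine .inr ⟨l', m, d + 1, by omega, hl', ?_, ?_⟩
          · simp only [List.length_append, List.length_singleton]; omega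
          · rw [h', descProd_succ_mul]
      · refine .inl ?_
        obtain ⟨d, rfl⟩ : ∃ d', d = d' + 1 := ⟨d - 1, by omega⟩
        rw [h', hT.descProd_mul_self, mul_zero]
      · refine .inr ⟨l' ++ [m - 1], j, d, hjd, ?_, ?_, ?_⟩
        · intro q hq
          rcases List.mem_append.1 hq with hq | hq
          · exact hl' q hq
          · rw [List.mem_singleton.1 hq]; omega
        · simp only [List.length_append, List.length_singleton]; omega
        · rw [h', hT.descProd_mul_shift j d m hmj (by omega)]; simp [mul_assoc]

theorem exists_prod_eq_zero (N : ℕ) : ∃ L : ℕ, ∀ l : List ℕ, (∀ q ∈ l, q < N) → L ≤ l.length →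
    (l.map T).prod = 0 := by
  induction N with
  | zero =>
    -- No letters are available, so only the empty word exists; its product is `1`, whence the bound
    -- `1` rather than `0`.
    refine ⟨1, fun l hl hlen => ?_⟩
    obtain ⟨q, hq⟩ := List.exists_mem_of_length_pos (l := l) (by omega)
    exact absurd (hl q hq) (by omega)
  | succ N ih =>
    obtain ⟨L, hL⟩ := ih
    -- The run in the normal form has length `d ≤ N + 1`, so at least `L` letters are left for the
    -- smaller word.
    refine ⟨L + (N + 1), fun l hl hlen => ?_⟩
    rcases hT.exists_normal_form N l hl with h | ⟨l', j, d, hjd, hl', hlen', h⟩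
    · exact h
    · rw [h, hL l' hl' (by omega), zero_mul]

/-- A word using a letter `q ≥ N` is zero outright. This allows generators indexed by all natural
numbers that vanish beyond their range, such as `tailT`. -/
theorem exists_prod_eq_zero_of_bounded (N : ℕ) (hN : ∀ q, N ≤ q → T q = 0) : ∃ L : ℕ,
    ∀ l : List ℕ, L ≤ l.length → (l.map T).prod = 0 := by
  obtain ⟨L, hL⟩ := hT.exists_prod_eq_zero N
  refine ⟨L, fun l hl => ?_⟩
  by_cases h : ∀ q ∈ l, q < N
  · exact hL l h hl
  · push Not at h
    obtain ⟨q, hq, hqN⟩ := h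
    obtain ⟨l₁, l₂, rfl⟩ := List.append_of_mem hq
    simp [hN q hqN]

end IsNilCoxeter

end NilCoxeter

/-! Diagrams with strands of colour `i` to the right -/

theorem words_zero {I : Type u} : words (0 : Multiset I) = {[]} := by
  ext s; simp [KLR.mem_words]

theorem words_replicate {I : Type u} (n : ℕ) (i : I) :
    words (Multiset.replicate n i) = {List.replicate n i} := by
  ext s; rw [KLR.mem_words, ← Multiset.coe_replicate, Multiset.coe_eq_coe, List.perm_replicate,
    Finset.mem_singleton]

namespace KLR

section Sides

variable {k : Type u} [Field k] {I : Type u} {D : BorcherdsCartan I} {ν : Multiset I} {i : I}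
  {n : ℕ}

variable (k D ν i n) in
/-- The embedding `a ↦ a ⊗ 1` of `R(ν)` in `R(ν + ni)`. -/
def midL : KLRAlg k D ν →ₗ[k] KLRAlg k D (ν + Multiset.replicate n i) :=
  mid k D (α := 0) (ν := ν) (β := Multiset.replicate n i) (by rw [zero_add])

variable (k D ν i n) in
/-- The embedding `b ↦ 1 ⊗ b` of `R(ni)` in `R(ν + ni)`. -/
def midR : KLRAlg k D (Multiset.replicate n i) →ₗ[k] KLRAlg k D (ν + Multiset.replicate n i) :=
  mid k D (α := ν) (ν := Multiset.replicate n i) (β := 0) (by rw [add_zero])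

theorem midL_mul (a b : KLRAlg k D ν) :
    midL k D ν i n (a * b) = midL k D ν i n a * midL k D ν i n b := mid_mul k D _ a b

theorem midR_mul (a b : KLRAlg k D (Multiset.replicate n i)) :
    midR k D ν i n (a * b) = midR k D ν i n a * midR k D ν i n b := mid_mul k D _ a b

theorem midL_gen (g : Gen I) :
    midL k D ν i n (gen k D ν g) = gen k D _ (g.place [] (List.replicate n i)) := by
  rw [midL, mid_gen, midGen, words_zero, words_replicate]
  simp

theorem midR_gen (g : Gen I) :
    midR k D ν i n (gen k D _ g) = ∑ l ∈ words ν, gen k D _ (g.place l []) := by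
  rw [midR, mid_gen, midGen, words_zero, Finset.sum_product]
  simp

variable (k D ν i n) in
/-- The idempotent `1_ν ⊗ 1_{ni}`. -/
def sideOne : KLRAlg k D (ν + Multiset.replicate n i) :=
  ∑ l ∈ words ν, e k D _ (l ++ List.replicate n i)

theorem midL_one : midL k D ν i n 1 = sideOne k D ν i n := by
  rw [← sum_e, map_sum]
  refine Finset.sum_congr rfl fun l _ => ?_
  rw [e, midL_gen]; rfl

theorem midR_one : midR k D ν i n 1 = sideOne k D ν i n := by
  rw [← sum_e, words_replicate, Finset.sum_singleton, e, midR_gen]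
  refine Finset.sum_congr rfl fun l _ => ?_
  simp [Gen.place, e]

/-- The word at the bottom of a generating diagram. -/
def _root_.Borcherds.Gen.bot : Gen I → List I
  | .e s => s
  | .x u i v => u ++ i :: v
  | .t u i j v => u ++ i :: j :: v

/-- The word at the top of a generating diagram. -/
def _root_.Borcherds.Gen.top : Gen I → List I
  | .e s => s
  | .x u i v => u ++ i :: v
  | .t u i j v => u ++ j :: i :: v

theorem _root_.Borcherds.Gen.coe_top (g : Gen I) : (g.top : Multiset I) = g.bot := by
  cases g with
  | e s => rfl
  | x u i v => rfl
  | t u i j v => exact Multiset.coe_eq_coe.2 ((List.Perm.swap i j v).append_left u)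

theorem e_mul_gen {κ : Multiset I} (g : Gen I) (l r : List I) :
    e k D κ (l ++ (g.top ++ r)) * gen k D κ (g.place l r) = gen k D κ (g.place l r) := by
  cases g with
  | e s => exact (isLoc_e s (l, r)).1
  | x u i v => exact (isLoc_x u i v (l, r)).1
  | t u i j v => exact (isLoc_t u i j v (l, r)).1

theorem gen_mul_e {κ : Multiset I} (g : Gen I) (l r : List I) :
    gen k D κ (g.place l r) * e k D κ (l ++ (g.bot ++ r)) = gen k D κ (g.place l r) := by
  cases g with
  | e s => exact (isLoc_e s (l, r)).2
  | x u i v => exact (isLoc_x u i v (l, r)).2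
  | t u i j v => exact (isLoc_t u i j v (l, r)).2

theorem gen_comm {κ : Multiset I} (g h : Gen I) :
    gen k D κ (g.place [] h.top) * gen k D κ (h.place g.bot [])
      = gen k D κ (h.place g.top []) * gen k D κ (g.place [] h.bot) := by
  cases g with
  | e s =>
    have h1 := e_mul_gen (k := k) (D := D) (κ := κ) h s []
    have h2 := gen_mul_e (k := k) (D := D) (κ := κ) h s []
    simp only [List.append_nil] at h1 h2
    exact h1.trans h2.symm
  | x u i v =>
    cases h with
    | e s =>
      have h1 := gen_mul_e (k := k) (D := D) (κ := κ) (.x u i v) [] s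
      have h2 := e_mul_gen (k := k) (D := D) (κ := κ) (.x u i v) [] s
      simp only [List.nil_append] at h1 h2
      simpa [Gen.place, Gen.top, Gen.bot, e] using h1.trans h2.symm
    | x u' j v' =>
      simpa [Gen.place, Gen.top, Gen.bot, x, t] using
        x_mul_x (k := k) (D := D) (κ := κ) u i (v ++ u') j v'
    | t u' a b v' =>
      simpa [Gen.place, Gen.top, Gen.bot, x, t] using
        x_mul_t (k := k) (D := D) (κ := κ) u i (v ++ u') a b v'
  | t u i j v =>
    cases h with
    | e s =>
      have h1 := gen_mul_e (k := k) (D := D) (κ := κ) (.t u i j v) [] s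
      have h2 := e_mul_gen (k := k) (D := D) (κ := κ) (.t u i j v) [] s
      simp only [List.nil_append] at h1 h2
      simpa [Gen.place, Gen.top, Gen.bot, e] using h1.trans h2.symm
    | x u' a v' =>
      simpa [Gen.place, Gen.top, Gen.bot, x, t] using
        (x_mul_t' (k := k) (D := D) (κ := κ) u i j (v ++ u') a v').symm
    | t u' a b v' =>
      simpa [Gen.place, Gen.top, Gen.bot, x, t] using
        t_mul_t (k := k) (D := D) (κ := κ) u i j (v ++ u') a b v'

theorem gen_mul_gen_of_ne {κ : Multiset I} {g h : Gen I} {l r l' r' : List I}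
    (hne : l ++ (g.bot ++ r) ≠ l' ++ (h.top ++ r')) :
    gen k D κ (g.place l r) * gen k D κ (h.place l' r') = 0 := by
  rw [← gen_mul_e, ← e_mul_gen h, mul_assoc, ← mul_assoc (e k D κ _), e_mul_e_of_ne hne, zero_mul,
    mul_zero]

theorem gen_place_eq_zero {κ : Multiset I} {g : Gen I} {l r : List I}
    (h : (l : Multiset I) + g.bot + r ≠ κ) : gen k D κ (g.place l r) = 0 := by
  rw [← gen_mul_e, e_eq_zero, mul_zero]
  rwa [← Multiset.coe_add, ← Multiset.coe_add, ← add_assoc]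

theorem gen_eq_zero {κ : Multiset I} {g : Gen I} (h : (g.bot : Multiset I) ≠ κ) :
    gen k D κ g = 0 := by
  have h1 : gen k D κ (g.place [] []) = 0 := gen_place_eq_zero (by simpa using h)
  cases g <;> simpa [Gen.place] using h1

/-- The image of `h` is a sum over the words `l` on its left, and only one summand matches the
diagram `g`: the one with `l = g.bot` when `h` is below, and with `l = g.top` when `h` is above.
These two summands are related by `gen_comm`. -/
theorem midL_gen_mul_midR_gen (g h : Gen I) :
    midL k D ν i n (gen k D ν g) * midR k D ν i n (gen k D _ h)
      = midR k D ν i n (gen k D _ h) * midL k D ν i n (gen k D ν g) := by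
  by_cases hg : (g.bot : Multiset I) = ν
  swap
  · rw [gen_eq_zero hg, map_zero, zero_mul, mul_zero]
  by_cases hh : (h.bot : Multiset I) = Multiset.replicate n i
  swap
  · rw [gen_eq_zero hh, map_zero, zero_mul, mul_zero]
  have hb : h.bot = List.replicate n i := by
    rwa [← Multiset.coe_replicate, Multiset.coe_eq_coe, List.perm_replicate] at hh
  have ht : h.top = List.replicate n i := by
    rwa [← h.coe_top, ← Multiset.coe_replicate, Multiset.coe_eq_coe, List.perm_replicate] at hh
  rw [midL_gen, midR_gen, Finset.mul_sum, Finset.sum_mul,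
    Finset.sum_eq_single_of_mem g.bot (mem_words.2 hg),
    Finset.sum_eq_single_of_mem g.top (mem_words.2 (g.coe_top.trans hg))]
  · nth_rw 1 [← ht]
    rw [gen_comm, hb]
  · intro l _ hl
    refine gen_mul_gen_of_ne fun heq => hl ?_
    rw [hb, List.append_nil, List.nil_append] at heq
    exact List.append_cancel_right heq
  · intro l _ hl
    refine gen_mul_gen_of_ne fun heq => hl ?_
    rw [ht, List.append_nil, List.nil_append] at heq
    exact (List.append_cancel_right heq).symm

theorem midL_mul_midR (a : KLRAlg k D ν) (b : KLRAlg k D (Multiset.replicate n i)) :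
    midL k D ν i n a * midR k D ν i n b = midR k D ν i n b * midL k D ν i n a := by
  induction a using gen_induction with
  | hone c =>
    rw [Algebra.algebraMap_eq_smul_one, map_smul, midL_one, ← midR_one, smul_mul_assoc,
      mul_smul_comm, ← midR_mul, ← midR_mul, one_mul, mul_one]
  | hadd a a' ha ha' => rw [map_add, add_mul, mul_add, ha, ha']
  | hmul a a' ha ha' => rw [midL_mul, mul_assoc, ha', ← mul_assoc, ha, mul_assoc]
  | hgen g =>
    induction b using gen_induction with
    | hone c =>
      rw [Algebra.algebraMap_eq_smul_one, map_smul, midR_one, ← midL_one, smul_mul_assoc,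
        mul_smul_comm, ← midL_mul, ← midL_mul, one_mul, mul_one]
    | hadd a a' ha ha' => rw [map_add, add_mul, mul_add, ha, ha']
    | hmul a a' ha ha' => rw [midR_mul, ← mul_assoc, ha, mul_assoc, ha', mul_assoc]
    | hgen h => exact midL_gen_mul_midR_gen g h

variable (k D i n) in
/-- The dots of `R(ni)`. -/
def tailX (q : ℕ) : KLRAlg k D (Multiset.replicate n i) :=
  x k D _ (List.replicate q i) i (List.replicate (n - 1 - q) i)

variable (k D i n) in
/-- The crossings of `R(ni)`. -/
def tailT (q : ℕ) : KLRAlg k D (Multiset.replicate n i) :=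
  t k D _ (List.replicate q i) i i (List.replicate (n - 2 - q) i)

theorem replicate_append_cons (a b : ℕ) (i : I) :
    List.replicate a i ++ i :: List.replicate b i = List.replicate (a + b + 1) i := by
  rw [← List.replicate_succ, List.replicate_append_replicate, add_assoc]

/-- Here the truncated subtraction `n - 1 - q` is `0`, so the word has `q + 1 > n` letters and the
wrong content. The same happens for crossings in `tailT_eq_zero`. -/
theorem tailX_eq_zero {q : ℕ} (h : n ≤ q) : tailX k D i n q = 0 := by
  refine x_eq_zero fun he => ?_
  have := congrArg Multiset.card he
  simp at this
  omega

theorem tailT_eq_zero {q : ℕ} (h : n ≤ q + 1) : tailT k D i n q = 0 := by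
  refine t_eq_zero fun he => ?_
  have := congrArg Multiset.card he
  simp at this
  omega

/-- With a single colour a double crossing is zero, and the braid relation has no correction term,
since that would require a middle strand of another colour. Indices out of range give zero and
satisfy the relations trivially. -/
theorem isNilCoxeter_tailT : IsNilCoxeter (tailT k D i n) where
  sq q := t_sq_same _ _ _
  comm p q h := by
    by_cases hq : n ≤ q + 1
    · rw [tailT_eq_zero hq, mul_zero, zero_mul]
    obtain ⟨c, rfl⟩ : ∃ c, q = p + c + 2 := ⟨q - p - 2, by omega⟩
    have := t_mul_t (k := k) (D := D) (κ := Multiset.replicate n i) (List.replicate p i) i i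
      (List.replicate c i) i i (List.replicate (n - 2 - (p + c + 2)) i)
    simp only [← List.replicate_succ, List.replicate_append_replicate] at this
    unfold tailT
    convert this using 3 <;> congr 1 <;> omega
  braid q := by
    by_cases hq : n ≤ q + 1 + 1
    · rw [tailT_eq_zero hq, mul_zero, zero_mul, mul_zero]
    have := braid (k := k) (D := D) (κ := Multiset.replicate n i) (List.replicate q i)
      (i := i) (j := i) (l := i) (List.replicate (n - 3 - q) i) (by simp)
    have h1 : [i] = List.replicate 1 i := rfl
    simp only [← List.replicate_succ, h1, List.replicate_append_replicate] at this
    unfold tailT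
    have e1 : n - 2 - q = n - 3 - q + 1 := by omega
    have e2 : n - 2 - (q + 1) = n - 3 - q := by omega
    rw [e1, e2]
    exact this

/-- For an imaginary colour a dot slides through a crossing without a correction term; only its
position may change. Consequently vectors killed by all dots stay so after applying crossings. -/
theorem exists_tailX_mul_tailT (hi : D.IsImaginary i) (p q : ℕ) :
    ∃ p', tailX k D i n p * tailT k D i n q = tailT k D i n q * tailX k D i n p' := by
  by_cases hq : n ≤ q + 1
  · exact ⟨p, by rw [tailT_eq_zero hq, mul_zero, zero_mul]⟩
  by_cases hp : n ≤ p
  · exact ⟨p, by rw [tailX_eq_zero hp, mul_zero, zero_mul]⟩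
  unfold tailT tailX
  rcases lt_trichotomy p q with h | rfl | h
  · refine ⟨p, ?_⟩
    obtain ⟨c, rfl⟩ : ∃ c, q = p + c + 1 := ⟨q - p - 1, by omega⟩
    have := x_mul_t (k := k) (D := D) (κ := Multiset.replicate n i) (List.replicate p i) i
      (List.replicate c i) i i (List.replicate (n - 2 - (p + c + 1)) i)
    simp only [← List.replicate_succ, List.replicate_append_replicate] at this
    convert this using 3 <;> congr 1 <;> omega
  · refine ⟨p + 1, ?_⟩
    have := x_mul_t_slide (k := k) (D := D) (κ := Multiset.replicate n i) (List.replicate p i)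
      (i := i) (j := i) (List.replicate (n - 2 - p) i) (.inr hi)
    have h1 : [i] = List.replicate 1 i := rfl
    simp only [← List.replicate_succ, h1, List.replicate_append_replicate] at this
    convert this using 3 <;> congr 1 <;> omega
  · rcases Nat.lt_or_ge p (q + 2) with h' | h'
    · obtain rfl : p = q + 1 := by omega
      refine ⟨q, ?_⟩
      have := t_mul_x_slide (k := k) (D := D) (κ := Multiset.replicate n i) (List.replicate q i)
        (i := i) (j := i) (List.replicate (n - 2 - q) i) (.inr hi)
      have h1 : [i] = List.replicate 1 i := rfl
      simp only [← List.replicate_succ, h1, List.replicate_append_replicate] at this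
      convert this.symm using 3 <;> congr 1 <;> omega
    · refine ⟨p, ?_⟩
      obtain ⟨c, rfl⟩ : ∃ c, p = q + c + 2 := ⟨p - q - 2, by omega⟩
      have := x_mul_t' (k := k) (D := D) (κ := Multiset.replicate n i) (List.replicate q i) i i
        (List.replicate c i) i (List.replicate (n - 1 - (q + c + 2)) i)
      simp only [← List.replicate_succ, List.replicate_append_replicate] at this
      convert this using 3 <;> congr 1 <;> omega

end Sides

end KLR

/-! Words with marked letters -/

section MarkedWords

variable {I : Type u}

/-- The word underlying a word with marked letters `none`, which all have the colour `i`. -/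
def und (i : I) (w : List (Option I)) : List I := w.map fun a => a.getD i

@[simp] theorem und_nil (i : I) : und i [] = [] := rfl

@[simp] theorem und_some_cons (i j : I) (w : List (Option I)) :
    und i (some j :: w) = j :: und i w := rfl

@[simp] theorem und_none_cons (i : I) (w : List (Option I)) :
    und i (none :: w) = i :: und i w := rfl

theorem und_cons (i : I) (a : Option I) (w : List (Option I)) :
    und i (a :: w) = a.getD i :: und i w := rfl

@[simp] theorem und_append (i : I) (w w' : List (Option I)) :
    und i (w ++ w') = und i w ++ und i w' := List.map_append

@[simp] theorem und_replicate (i : I) (n : ℕ) :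
    und i (List.replicate n none) = List.replicate n i := by simp [und]

@[simp] theorem und_map_some (i : I) (s : List I) : und i (s.map some) = s := by
  simp [und, Function.comp_def]

/-- The number of pairs of a marked letter and an unmarked letter to the right of it. -/
def inversions : List (Option I) → ℕ
  | [] => 0
  | none :: w => w.reduceOption.length + inversions w
  | some _ :: w => inversions w

theorem inversions_lt (u : List (Option I)) (j : I) (v : List (Option I)) :
    inversions (u ++ some j :: none :: v) < inversions (u ++ none :: some j :: v) := by
  induction u with
  | nil => simp [inversions]
  | cons a u ih =>
    cases a with
    | none => simpa [inversions, List.reduceOption_append] using ih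
    | some a => simpa [inversions] using ih

theorem sorted_or_exists (w : List (Option I)) :
    (∃ (s : List I) (m : ℕ), w = s.map some ++ List.replicate m none) ∨
      ∃ u j v, w = u ++ none :: some j :: v := by
  induction w with
  | nil => exact .inl ⟨[], 0, rfl⟩
  | cons a w ih =>
    rcases ih with ⟨s, m, rfl⟩ | ⟨u, j, v, rfl⟩
    · cases a with
      | some a => exact .inl ⟨a :: s, m, rfl⟩
      | none =>
        cases s with
        | nil => exact .inl ⟨[], m + 1, rfl⟩
        | cons j s => exact .inr ⟨[], j, s.map some ++ List.replicate m none, rfl⟩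
    · exact .inr ⟨a :: u, j, v, rfl⟩

/-- In a sorted word every letter to the right of a mark is a mark, a pairwise condition violated by
the pair `none`, `some j`. -/
theorem sorted_ne {s : List I} {m : ℕ} {u : List (Option I)} {j : I} {v : List (Option I)} :
    s.map some ++ List.replicate m none ≠ u ++ none :: some j :: v := by
  intro h
  have h1 : (s.map some ++ List.replicate m none).Pairwise
      fun a b : Option I => a = none → b = none := by
    rw [List.pairwise_append, List.pairwise_map]
    exact ⟨List.pairwise_of_forall fun _ _ h => (Option.some_ne_none _ h).elim,
      by simp [List.pairwise_replicate], by simp⟩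
  rw [h] at h1
  simp [List.pairwise_append] at h1

@[simp] theorem reduceOption_map_some (s : List I) : (s.map some).reduceOption = s := by
  simp [List.reduceOption]

theorem sorted_split {s : List I} {m : ℕ} {u : List (Option I)} {a : Option I}
    {v : List (Option I)} (h : s.map some ++ List.replicate m none = u ++ a :: v) :
    (∃ s₁ j s₂, s = s₁ ++ j :: s₂ ∧ u = s₁.map some ∧ a = some j ∧
      v = s₂.map some ++ List.replicate m none) ∨
    ∃ q r, m = q + r + 1 ∧ u = s.map some ++ List.replicate q none ∧ a = none ∧
      v = List.replicate r none := by
  rcases List.append_eq_append_iff.1 h with ⟨z, rfl, hz⟩ | ⟨z, hz, hz'⟩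
  · right
    have h1 : (List.replicate m (none : Option I)).length = z.length + v.length + 1 := by
      rw [hz]; simp; omega
    rw [List.length_replicate] at h1
    have h2 := hz.symm
    rw [List.append_eq_replicate_iff] at h2
    obtain ⟨h3, h4, h5⟩ := h2
    rw [List.length_cons, List.replicate_succ, List.cons.injEq] at h5
    exact ⟨z.length, v.length, h1, by rw [← h4], h5.1, h5.2⟩
  · cases z with
    | nil =>
      rw [List.append_nil] at hz
      rw [List.nil_append] at hz'
      obtain ⟨m, rfl⟩ : ∃ m', m = m' + 1 := by
        cases m with
        | zero => simp at hz'
        | succ m => exact ⟨m, rfl⟩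
      rw [List.replicate_succ, List.cons.injEq] at hz'
      exact .inr ⟨0, m, by omega, by simp [hz], hz'.1, hz'.2⟩
    | cons b z =>
      rw [List.cons_append, List.cons.injEq] at hz'
      obtain ⟨rfl, rfl⟩ := hz'
      obtain ⟨s₁, s', rfl, rfl, hs'⟩ := List.map_eq_append_iff.1 hz
      obtain ⟨j, s₂, rfl, rfl, rfl⟩ := List.map_eq_cons_iff.1 hs'
      exact .inl ⟨s₁, j, s₂, rfl, rfl, rfl, rfl⟩

/-- Relative position of two adjacent pairs in one word: equal, disjoint in either order, or sharing
one letter in either order. For crossings, disjoint pairs commute and pairs sharing a letter call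
for a braid relation. -/
theorem split_pair {u u' v v' : List (Option I)} {a b : Option I} {j : I}
    (h : u ++ a :: b :: v = u' ++ none :: some j :: v') :
    (u = u' ∧ a = none ∧ b = some j ∧ v = v') ∨
    (∃ z, u' = u ++ a :: b :: z ∧ v = z ++ none :: some j :: v') ∨
    (∃ z, u = u' ++ none :: some j :: z ∧ v' = z ++ a :: b :: v) ∨
    (b = none ∧ u' = u ++ [a] ∧ v = some j :: v') ∨
    (a = some j ∧ u = u' ++ [none] ∧ v' = b :: v) := by
  rcases List.append_eq_append_iff.1 h with ⟨z, rfl, hz⟩ | ⟨z, rfl, hz⟩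
  · match z, hz with
    | [], hz => simp_all
    | [c], hz =>
      simp only [List.cons_append, List.nil_append, List.cons.injEq] at hz
      simp [hz]
    | c :: d :: z, hz =>
      simp only [List.cons_append, List.cons.injEq] at hz
      obtain ⟨rfl, rfl, rfl⟩ := hz
      exact .inr (.inl ⟨z, rfl, rfl⟩)
  · match z, hz with
    | [], hz => simp_all
    | [c], hz =>
      simp only [List.cons_append, List.nil_append, List.cons.injEq] at hz
      simp [hz]
    | c :: d :: z, hz =>
      simp only [List.cons_append, List.cons.injEq] at hz
      obtain ⟨rfl, rfl, rfl⟩ := hz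
      exact .inr (.inr (.inl ⟨z, rfl, rfl⟩))

theorem split_one {u u' v v' : List (Option I)} {a b c : Option I}
    (h : u ++ a :: v = u' ++ b :: c :: v') :
    (∃ z, u' = u ++ a :: z ∧ v = z ++ b :: c :: v') ∨
    (u = u' ∧ a = b ∧ v = c :: v') ∨ (u = u' ++ [b] ∧ a = c ∧ v = v') ∨
    ∃ z, u = u' ++ b :: c :: z ∧ v' = z ++ a :: v := by
  rcases List.append_eq_append_iff.1 h with ⟨z, rfl, hz⟩ | ⟨z, rfl, hz⟩
  · match z, hz with
    | [], hz => simp_all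
    | d :: z, hz =>
      simp only [List.cons_append, List.cons.injEq] at hz
      obtain ⟨rfl, rfl⟩ := hz
      exact .inl ⟨z, rfl, rfl⟩
  · match z, hz with
    | [], hz => simp_all
    | [d], hz =>
      simp only [List.cons_append, List.nil_append, List.cons.injEq] at hz
      simp [hz]
    | d :: d' :: z, hz =>
      simp only [List.cons_append, List.cons.injEq] at hz
      obtain ⟨rfl, rfl, rfl⟩ := hz
      exact .inr (.inr (.inr ⟨z, rfl, rfl⟩))

theorem eq_append_cons_of_und {i : I} {w : List (Option I)} {u : List I} {j : I} {v : List I}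
    (h : und i w = u ++ j :: v) : ∃ u' a v', w = u' ++ a :: v' ∧ und i u' = u ∧ a.getD i = j ∧
      und i v' = v := by
  obtain ⟨u', w', rfl, h1, h2⟩ := List.map_eq_append_iff.1 h
  obtain ⟨a, v', rfl, h3, h4⟩ := List.map_eq_cons_iff.1 h2
  exact ⟨u', a, v', rfl, h1, h3, h4⟩

theorem eq_append_cons_cons_of_und {i : I} {w : List (Option I)} {u : List I} {j l : I}
    {v : List I} (h : und i w = u ++ j :: l :: v) : ∃ u' a b v', w = u' ++ a :: b :: v' ∧
      und i u' = u ∧ a.getD i = j ∧ b.getD i = l ∧ und i v' = v := by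
  obtain ⟨u', a, v', rfl, h1, h2, h3⟩ := eq_append_cons_of_und h
  obtain ⟨b, v', rfl, h4, h5⟩ := List.map_eq_cons_iff.1 h3
  exact ⟨u', a, b, v', rfl, h1, h2, h4, h5⟩

end MarkedWords

/-! ### Shuffles of marked strands and their stability under the generators -/

namespace KLR

section Shuffle

variable {k : Type u} [Field k] {I : Type u} {D : BorcherdsCartan I} {κ : Multiset I}
  {M : Type u} [AddCommGroup M] [Module k M] [Module (KLRAlg k D κ) M]

/-- `Shuffle i n M₀ w m`: the vector `m` is obtained from a vector of `M₀`, on which the rightmost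
`n` strands have colour `i` and are marked, by moving the marked strands to their positions in the
marked word `w`. -/
inductive Shuffle (i : I) (n : ℕ) (M₀ : Submodule k M) : List (Option I) → M → Prop
  | base (s : List I) {m : M} (hm : m ∈ M₀) (he : e k D κ (s ++ List.replicate n i) • m = m) :
      Shuffle i n M₀ (s.map some ++ List.replicate n none) m
  | step (u : List (Option I)) (j : I) (v : List (Option I)) {m : M}
      (h : Shuffle i n M₀ (u ++ some j :: none :: v) m) :
      Shuffle i n M₀ (u ++ none :: some j :: v) (t k D κ (und i u) j i (und i v) • m)
  | add {w : List (Option I)} {m m' : M} (h : Shuffle i n M₀ w m) (h' : Shuffle i n M₀ w m') :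
      Shuffle i n M₀ w (m + m')

/-- `M₀` is closed under the dots and crossings that do not mix the rightmost `n` strands with the
others. -/
structure IsSideClosed (D : BorcherdsCartan I) (κ : Multiset I)
    [Module (KLRAlg k D κ) M] (i : I) (n : ℕ) (M₀ : Submodule k M) : Prop where
  xL : ∀ u j v, ∀ m ∈ M₀, x k D κ u j (v ++ List.replicate n i) • m ∈ M₀
  tL : ∀ u j l v, ∀ m ∈ M₀, t k D κ u j l (v ++ List.replicate n i) • m ∈ M₀
  xR : ∀ l q r, n = q + r + 1 → ∀ m ∈ M₀,
    x k D κ (l ++ List.replicate q i) i (List.replicate r i) • m ∈ M₀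
  tR : ∀ l q r, n = q + r + 2 → ∀ m ∈ M₀,
    t k D κ (l ++ List.replicate q i) i i (List.replicate r i) • m ∈ M₀

variable {i : I} {n : ℕ} {M₀ : Submodule k M}

theorem Shuffle.e_smul {w : List (Option I)} {m : M} (h : Shuffle (D := D) (κ := κ) i n M₀ w m) :
    e k D κ (und i w) • m = m := by
  induction h with
  | base s hm he => simpa using he
  | step u j v h ih => rw [← mul_smul]; simp only [und_append, und_none_cons, und_some_cons, e_mul_t]
  | add h h' ih ih' => rw [smul_add, ih, ih']

theorem Shuffle.smul [IsScalarTower k (KLRAlg k D κ) M] {w : List (Option I)} {m : M} (h : Shuffle (D := D) (κ := κ) i n M₀ w m)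
    (c : k) : Shuffle (D := D) (κ := κ) i n M₀ w (c • m) := by
  induction h with
  | base s hm he =>
    refine .base s (M₀.smul_mem c hm) ?_
    rw [smul_algebra_smul_comm, he]
  | step u j v h ih => rw [← smul_algebra_smul_comm]; exact .step u j v ih
  | add h h' ih ih' => rw [smul_add]; exact .add ih ih'

theorem Shuffle.reduceOption {w : List (Option I)} {m : M}
    (h : Shuffle (D := D) (κ := κ) i n M₀ w m) :
    w.length = w.reduceOption.length + n := by
  induction h with
  | base s hm he => simp [List.reduceOption_append]
  | step u j v h ih => simpa [List.reduceOption_append] using ih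
  | add h h' ih ih' => exact ih

/-- Any mark standing directly before an unmarked letter may be taken as the last one moved. Two
such pairs in a word cannot share exactly one letter, which would have to be both marked and
unmarked, so different last moves are distant crossings and commute. -/
theorem Shuffle.exists_eq {w : List (Option I)} {m : M}
    (h : Shuffle (D := D) (κ := κ) i n M₀ w m) {u : List (Option I)} {j : I}
    {v : List (Option I)} (hw : w = u ++ none :: some j :: v) :
    ∃ m', Shuffle (D := D) (κ := κ) i n M₀ (u ++ some j :: none :: v) m' ∧
      m = t k D κ (und i u) j i (und i v) • m' := by
  induction h generalizing u j v with
  | base s hm he => exact absurd hw sorted_ne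
  | @step u' j' v' m h ih =>
    rcases split_pair hw with ⟨rfl, -, hj, rfl⟩ | ⟨z, rfl, rfl⟩ | ⟨z, rfl, rfl⟩ | ⟨h1, -, -⟩ |
      ⟨h1, -, -⟩
    · cases hj
      exact ⟨m, h, rfl⟩
    · obtain ⟨m', h', rfl⟩ := ih (u := u' ++ some j' :: none :: z) (j := j) (v := v) (by simp)
      have h2 := Shuffle.step (D := D) u' j' (z ++ some j :: none :: v) (by simpa using h')
      refine ⟨_, by simpa using h2, ?_⟩
      have := t_mul_t (k := k) (D := D) (κ := κ) (und i u') j' i (und i z) j i (und i v)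
      rw [← mul_smul, ← mul_smul]
      simp only [und_append, und_none_cons, und_some_cons] at this ⊢
      rw [this]
    · obtain ⟨m', h', rfl⟩ := ih (u := u) (j := j) (v := z ++ some j' :: none :: v') (by simp)
      have h2 := Shuffle.step (D := D) (u ++ some j :: none :: z) j' v' (by simpa using h')
      refine ⟨_, by simpa using h2, ?_⟩
      have := t_mul_t (k := k) (D := D) (κ := κ) (und i u) j i (und i z) j' i (und i v')
      rw [← mul_smul, ← mul_smul]
      simp only [und_append, und_none_cons, und_some_cons] at this ⊢
      rw [this]
    · cases h1
    · cases h1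
  | add h h' ih ih' =>
    obtain ⟨m₁, h₁, rfl⟩ := ih hw
    obtain ⟨m₂, h₂, rfl⟩ := ih' hw
    exact ⟨m₁ + m₂, h₁.add h₂, by rw [smul_add]⟩

theorem Shuffle.mem {w : List (Option I)} {m : M} (h : Shuffle (D := D) (κ := κ) i n M₀ w m)
    {s : List I} (hw : w = s.map some ++ List.replicate n none) : m ∈ M₀ := by
  induction h with
  | base s hm he => exact hm
  | step u j v h ih => exact absurd hw.symm sorted_ne
  | add h h' ih ih' => exact add_mem (ih hw) (ih' hw)

/-- All crossings used in a shuffle involve a strand of the imaginary colour `i`, so the dot slides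
down through them without correction terms until it acts on `M₀`. -/
theorem Shuffle.x_smul (hi : D.IsImaginary i) (h₀ : IsSideClosed D κ i n M₀)
    {w : List (Option I)} {m : M} (h : Shuffle (D := D) (κ := κ) i n M₀ w m)
    {u : List (Option I)} {a : Option I} {v : List (Option I)} (hw : w = u ++ a :: v) :
    Shuffle (D := D) (κ := κ) i n M₀ w (x k D κ (und i u) (a.getD i) (und i v) • m) := by
  induction h generalizing u a v with
  | @base s m hm he =>
    have h1 : e k D κ (s ++ List.replicate n i) • x k D κ (und i u) (a.getD i) (und i v) • m
        = x k D κ (und i u) (a.getD i) (und i v) • m := by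
      have h2 := congrArg (und i) hw
      simp only [und_append, und_map_some, und_replicate, und_cons] at h2
      rw [h2, ← mul_smul, e_mul_x]
    refine .base s ?_ h1
    rcases sorted_split hw with ⟨s₁, j, s₂, rfl, rfl, rfl, rfl⟩ | ⟨q, r, hn, rfl, rfl, rfl⟩
    · simpa using h₀.xL s₁ j s₂ m hm
    · simpa using h₀.xR s q r hn m hm
  | @step u' j' v' m h ih =>
    -- Even an unmarked strand of colour `i` is harmless, as `i` is imaginary.
    have hji : j' ≠ i ∨ D.IsImaginary j' := by
      by_cases hj : j' = i
      · exact .inr (hj ▸ hi)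
      · exact .inl hj
    rcases split_one hw.symm with ⟨z, rfl, rfl⟩ | ⟨rfl, rfl, rfl⟩ | ⟨rfl, rfl, rfl⟩ |
      ⟨z, rfl, rfl⟩
    · have h1 := Shuffle.step (u ++ a :: z) j' v'
        (ih (u := u) (a := a) (v := z ++ some j' :: none :: v') (by simp))
      convert h1 using 1
      have := x_mul_t (k := k) (D := D) (κ := κ) (und i u) (a.getD i) (und i z) j' i (und i v')
      rw [← mul_smul, ← mul_smul]
      simpa only [und_append, und_none_cons, und_some_cons, und_cons, Option.getD] using
        congrArg (· • m) this
    · have h1 := Shuffle.step u j' v'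
        (ih (u := u ++ [some j']) (a := none) (v := v') (by simp))
      convert h1 using 1
      have := x_mul_t_slide (k := k) (D := D) (κ := κ) (und i u) (j := i) (und i v') hji
      rw [← mul_smul, ← mul_smul]
      simpa only [und_append, und_none_cons, und_some_cons, und_nil, Option.getD] using
        congrArg (· • m) this
    · have h1 := Shuffle.step u' j' v (ih (u := u') (a := some j') (v := none :: v) rfl)
      convert h1 using 1
      have := t_mul_x_slide (k := k) (D := D) (κ := κ) (und i u') (j := i) (und i v) hji
      rw [← mul_smul, ← mul_smul]
      simpa only [und_append, und_none_cons, und_some_cons, und_nil, Option.getD] using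
        (congrArg (· • m) this).symm
    · have h1 := Shuffle.step u' j' (z ++ a :: v)
        (ih (u := u' ++ some j' :: none :: z) (a := a) (v := v) (by simp))
      convert h1 using 1
      have := x_mul_t' (k := k) (D := D) (κ := κ) (und i u') j' i (und i z) (a.getD i) (und i v)
      rw [← mul_smul, ← mul_smul]
      simpa only [und_append, und_none_cons, und_some_cons, und_cons, Option.getD] using
        congrArg (· • m) this
  | add h h' ih ih' => rw [smul_add]; exact .add (ih hw) (ih' hw)

theorem Shuffle.x_pow_smul (hi : D.IsImaginary i) (h₀ : IsSideClosed D κ i n M₀)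
    {u : List (Option I)} {a : Option I} {v : List (Option I)} {m : M}
    (h : Shuffle (D := D) (κ := κ) i n M₀ (u ++ a :: v) m) (c : ℕ) :
    Shuffle (D := D) (κ := κ) i n M₀ (u ++ a :: v)
      (x k D κ (und i u) (a.getD i) (und i v) ^ c • m) := by
  induction c with
  | zero => rwa [pow_zero, one_smul]
  | succ c ih => rw [pow_succ', mul_smul]; exact ih.x_smul hi h₀ rfl

/-- Induction on the number of inversions. A mark passing to the left over an unmarked strand is a
step of the definition. A mark passing back to the right undoes a step, which can be taken last by
`Shuffle.exists_eq`, and the double crossing is zero, an idempotent, or a sum of dot powers. A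
crossing of two strands of the same kind is pushed below the steps, by distant commutation or a
braid relation, until it acts on `M₀`. -/
theorem Shuffle.t_smul [IsScalarTower k (KLRAlg k D κ) M] (hi : D.IsImaginary i)
    (h₀ : IsSideClosed D κ i n M₀)
    {u : List (Option I)} {a b : Option I} {v : List (Option I)} {m : M}
    (h : Shuffle (D := D) (κ := κ) i n M₀ (u ++ a :: b :: v) m) :
    Shuffle (D := D) (κ := κ) i n M₀ (u ++ b :: a :: v)
      (t k D κ (und i u) (a.getD i) (b.getD i) (und i v) • m) := by
  generalize hN : inversions (u ++ a :: b :: v) = N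
  induction N using Nat.strong_induction_on generalizing u a b v m with
  | _ N IH =>
  subst hN
  -- In each braid move below, the rightmost strand at the bottom has colour `i`. A correction term
  -- would need the leftmost one to have the same colour and to be real.
  have hreal : ∀ {j l : I}, ¬ (j = i ∧ D.IsReal j ∧ j ≠ l ∧ D.form j l ≠ 0) := by
    rintro j l ⟨rfl, hr, -⟩
    unfold BorcherdsCartan.IsReal at hr
    unfold BorcherdsCartan.IsImaginary at hi
    omega
  -- The case of two marked or two unmarked strands.
  have hsame : (a = none ↔ b = none) →
      Shuffle (D := D) (κ := κ) i n M₀ (u ++ b :: a :: v)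
        (t k D κ (und i u) (a.getD i) (b.getD i) (und i v) • m) := by
    intro hab
    rcases sorted_or_exists (u ++ a :: b :: v) with ⟨s, n', hs⟩ | ⟨u', j, v', hw⟩
    · have hn := h.reduceOption
      rw [hs] at hn
      simp only [List.length_append, List.length_map, List.length_replicate,
        List.reduceOption_append, reduceOption_map_some, List.reduceOption_replicate_none,
        List.append_nil, Nat.add_left_cancel_iff] at hn
      subst hn
      have hm := h.mem hs
      rcases sorted_split hs.symm with ⟨s₁, j, s', rfl, rfl, rfl, hv⟩ | ⟨q, r, hn, rfl, rfl, hv⟩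
      · obtain ⟨l, rfl⟩ : ∃ l, b = some l := by
          cases b with
          | none => simp at hab
          | some l => exact ⟨l, rfl⟩
        cases s' with
        | nil =>
          have : some l ∈ List.replicate n' (none : Option I) := by
            simp only [List.map_nil, List.nil_append] at hv
            rw [← hv]; simp
          simp at this
        | cons l' s₂ =>
          simp only [List.map_cons, List.cons_append, List.cons.injEq, Option.some.injEq] at hv
          obtain ⟨rfl, rfl⟩ := hv
          have h1 := Shuffle.base (D := D) (κ := κ) (i := i) (n := n') (s₁ ++ l :: j :: s₂)
            (h₀.tL s₁ j l s₂ m hm) (by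
              rw [← mul_smul]
              simp only [List.append_assoc, List.cons_append, e_mul_t])
          simpa using h1
      · obtain rfl : b = none := by simpa using hab
        cases r with
        | zero => simp at hv
        | succ r =>
          simp only [List.replicate_succ, List.cons.injEq, true_and] at hv
          subst hv
          have hrep : ∀ {α : Type u} (c : α) (s : List α), s ++ List.replicate n' c
              = s ++ List.replicate q c ++ c :: c :: List.replicate r c := by
            intro α c s
            rw [hn, List.append_assoc, ← List.replicate_succ, ← List.replicate_succ,
              List.replicate_append_replicate]
            rfl
          have h1 := Shuffle.base (D := D) (κ := κ) (i := i) (n := n') s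
            (h₀.tR s q r (by omega) m hm) (by rw [← mul_smul, hrep, e_mul_t])
          rw [hrep] at h1
          simpa [Option.getD] using h1
    · rcases split_pair hw with ⟨-, rfl, rfl, -⟩ | ⟨z, rfl, rfl⟩ | ⟨z, rfl, rfl⟩ |
        ⟨rfl, rfl, rfl⟩ | ⟨rfl, rfl, rfl⟩
      · simp at hab
      · obtain ⟨m₁, h₁, rfl⟩ := h.exists_eq hw
        have hlt := inversions_lt (u ++ a :: b :: z) j v'
        have h₂ := IH (inversions (u ++ a :: b :: (z ++ some j :: none :: v')))
          (by simpa using hlt) (by simpa using h₁) rfl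
        have h₃ := Shuffle.step (D := D) (u ++ b :: a :: z) j v' (by simpa using h₂)
        convert h₃ using 1
        · simp
        · have := t_mul_t (k := k) (D := D) (κ := κ) (und i u) (a.getD i) (b.getD i) (und i z) j i
            (und i v')
          rw [← mul_smul, ← mul_smul]
          simpa only [und_append, und_cons, Option.getD] using congrArg (· • m₁) this
      · obtain ⟨m₁, h₁, rfl⟩ := h.exists_eq hw
        have hlt := inversions_lt u' j (z ++ a :: b :: v)
        have h₂ := IH (inversions ((u' ++ some j :: none :: z) ++ a :: b :: v))
          (by simpa using hlt) (by simpa using h₁) rfl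
        have h₃ := Shuffle.step (D := D) u' j (z ++ b :: a :: v) (by simpa using h₂)
        convert h₃ using 1
        · simp
        · have := t_mul_t (k := k) (D := D) (κ := κ) (und i u') j i (und i z) (a.getD i)
            (b.getD i) (und i v)
          rw [← mul_smul, ← mul_smul]
          simpa only [und_append, und_cons, Option.getD] using congrArg (· • m₁) this.symm
      -- Both marks have been moved over the same unmarked strand `j`. The braid relation carries
      -- their crossing below the two moves, where there are two inversions fewer.
      · obtain rfl : a = none := by simpa using hab
        obtain ⟨m₁, h₁, rfl⟩ := h.exists_eq hw
        obtain ⟨m₂, h₂, rfl⟩ := h₁.exists_eq (u := u) (j := j) (v := none :: v') (by simp)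
        have hlt₁ := inversions_lt (u ++ [none]) j v'
        have hlt₂ := inversions_lt u j (none :: v')
        have h₃ := IH (inversions ((u ++ [some j]) ++ none :: none :: v'))
          (by simp at hlt₁ hlt₂ ⊢; omega) (by simpa using h₂) rfl
        have h₄ := Shuffle.step (D := D) u j (none :: v') (by simpa using h₃)
        have h₅ := Shuffle.step (D := D) (u ++ [none]) j v' (by simpa using h₄)
        convert h₅ using 1
        · have := braid (k := k) (D := D) (κ := κ) (und i u) (i := j) (j := i) (l := i)
            (und i v') hreal
          simp only [← mul_smul]
          simpa only [und_append, und_cons, und_nil, Option.getD, mul_assoc] using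
            congrArg (· • m₂) this
      -- One mark has been moved over both unmarked strands, and the braid relation again carries
      -- the crossing below these two moves.
      · obtain ⟨l, rfl⟩ : ∃ l, b = some l := by
          cases b with
          | none => simp at hab
          | some l => exact ⟨l, rfl⟩
        obtain ⟨m₁, h₁, rfl⟩ := h.exists_eq hw
        obtain ⟨m₂, h₂, rfl⟩ := h₁.exists_eq (u := u' ++ [some j]) (j := l) (v := v) (by simp)
        have hlt₁ := inversions_lt u' j (some l :: v)
        have hlt₂ := inversions_lt (u' ++ [some j]) l v
        have h₃ := IH (inversions (u' ++ some j :: some l :: (none :: v)))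
          (by simp at hlt₁ hlt₂ ⊢; omega) (by simpa using h₂) rfl
        have h₄ := Shuffle.step (D := D) (u' ++ [some l]) j v (by simpa using h₃)
        have h₅ := Shuffle.step (D := D) u' l (some j :: v) (by simpa using h₄)
        convert h₅ using 1
        · simp
        · have := braid (k := k) (D := D) (κ := κ) (und i u') (i := j) (j := l) (l := i)
            (und i v) hreal
          simp only [← mul_smul]
          simpa only [und_append, und_cons, und_nil, Option.getD, mul_assoc] using
            congrArg (· • m₂) this.symm
  cases a with
  | some j =>
    cases b with
    | some l => exact hsame (by simp)
    | none => exact Shuffle.step (D := D) u j v h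
  | none =>
    cases b with
    | none => exact hsame (by simp)
    | some j =>
      obtain ⟨m', h', rfl⟩ := h.exists_eq rfl
      rw [← mul_smul]
      change Shuffle i n M₀ (u ++ some j :: none :: v)
        ((t k D κ (und i u) i j (und i v) * t k D κ (und i u) j i (und i v)) • m')
      have he : e k D κ (und i u ++ j :: i :: und i v) • m' = m' := by simpa using h'.e_smul
      by_cases hji : j = i
      · subst hji
        rw [t_sq_same, zero_smul]
        simpa using h'.smul (0 : k)
      by_cases hf : D.form j i = 0
      · rwa [t_sq_orth _ _ hji hf, he]
      · rw [t_sq_ne _ _ hji hf, add_smul, mul_smul, mul_smul, he]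
        have h₁ := h'.x_pow_smul hi h₀ (u := u) (a := some j) (v := none :: v)
          (-D.a j i).toNat
        have h₂ : Shuffle (D := D) (κ := κ) i n M₀ ((u ++ [some j]) ++ none :: v) m' := by
          simpa using h'
        have h₃ := h₂.x_pow_smul hi h₀ (-D.a i j).toNat
        exact h₁.add (by simpa using h₃)

end Shuffle

end KLR

/-! ### Marked words that end in a run of letters `i` -/

theorem map_some_reduceOption {I : Type u} {w : List (Option I)}
    (h : w.length ≤ w.reduceOption.length) : w.reduceOption.map some = w := by
  induction w with
  | nil => rfl
  | cons a w ih =>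
    cases a with
    | none =>
      have := List.reduceOption_length_le w
      simp only [List.reduceOption_cons_of_none, List.length_cons] at h
      omega
    | some a => simpa using ih (by simpa using h)

theorem replicate_or_reduceOption {I : Type u} {i : I} {c : ℕ} {w : List (Option I)}
    (h : und i w = List.replicate c i) :
    w = List.replicate c none ∨ ∃ s, w.reduceOption = s ++ [i] := by
  induction w generalizing c with
  | nil =>
    cases c with
    | zero => exact .inl rfl
    | succ c => simp [List.replicate_succ] at h
  | cons a w ih =>
    cases c with
    | zero => simp [und_cons] at h
    | succ c =>
      rw [und_cons, List.replicate_succ, List.cons.injEq] at h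
      rcases ih h.2 with rfl | ⟨s, hs⟩
      · cases a with
        | none => exact .inl rfl
        | some a =>
          obtain rfl : a = i := h.1
          exact .inr ⟨[], by simp⟩
      · cases a with
        | none => exact .inr ⟨s, by simpa using hs⟩
        | some a => exact .inr ⟨a :: s, by simp [hs]⟩

/-- A marked word whose underlying word ends with as many letters `i` as there are marks. -/
theorem sorted_or_reduceOption {I : Type u} {i : I} {n c : ℕ} {w : List (Option I)}
    (hn : w.length = w.reduceOption.length + n) (hc : n ≤ c)
    (h : List.replicate c i <:+ und i w) :
    (c = n ∧ ∃ s : List I, w = s.map some ++ List.replicate n none) ∨ ∃ s, w.reduceOption = s ++ [i] := by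
  obtain ⟨s, hs⟩ := h
  obtain ⟨w₁, w₂, rfl, -, h₂⟩ := List.map_eq_append_iff.1 hs.symm
  rcases replicate_or_reduceOption h₂ with rfl | ⟨s', hs'⟩
  · have h1 := List.reduceOption_length_le w₁
    simp only [List.length_append, List.length_replicate, List.reduceOption_append,
      List.reduceOption_replicate_none, List.append_nil] at hn
    obtain rfl : c = n := by omega
    exact .inl ⟨rfl, w₁.reduceOption, by rw [map_some_reduceOption (by omega)]⟩
  · exact .inr ⟨w₁.reduceOption ++ s', by rw [List.reduceOption_append, hs', List.append_assoc]⟩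

/-! ### Modules generated by a highest image of `K` -/

namespace KLR

section Highest

set_option linter.unusedSectionVars false

variable {k : Type u} [Field k] {I : Type u} {D : BorcherdsCartan I} {ν : Multiset I} {i : I}
  {n : ℕ}

variable (k D) in
/-- The idempotent `1_{κ-ci} ⊗ 1_{ci}`, as an element of the algebra underlying `R(κ)`. -/
def tailProj (κ : Multiset I) (i : I) (c : ℕ) : KLRAlg k D κ := tailIdem k D κ i c

theorem tailProj_smul {κ : Multiset I} {M : Type u} [AddCommGroup M] [Module (KLRAlg k D κ) M]
    {w : List I} {m : M} (he : e k D κ w • m = m) (c : ℕ) [Decidable (List.replicate c i <:+ w)] :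
    tailProj k D κ i c • m = if List.replicate c i <:+ w then m else 0 := by
  classical
  rw [tailProj, tailIdem]
  change (∑ s ∈ (words κ).filter fun s => List.replicate c i <:+ s, e k D κ s) • m = _
  by_cases hw : w ∈ words κ
  · have h0 : ∀ s, s ≠ w → e k D κ s • m = 0 := fun s hs => by
      rw [← he, ← mul_smul, e_mul_e_of_ne hs, zero_smul]
    rw [Finset.sum_smul]
    split_ifs with h
    · rw [Finset.sum_eq_single_of_mem w (Finset.mem_filter.2 ⟨hw, h⟩) fun s _ hs => h0 s hs, he]
    · refine Finset.sum_eq_zero fun s hs => h0 s ?_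
      rintro rfl
      exact h (Finset.mem_filter.1 hs).2
  · rw [mem_words] at hw
    rw [e_eq_zero hw, zero_smul] at he
    simp [← he]

/-- The image under `midR` is a sum over all words of content `ν` on the left; multiplying by the
idempotent of `l` selects one summand. This turns statements about the action of `R(ν)` and `R(ni)`
into the statements about single diagrams required by `IsSideClosed`. -/
theorem gen_place_eq (g : Gen I) (hg : g.bot = List.replicate n i)
    (l : List I) :
    gen k D (ν + Multiset.replicate n i) (g.place l [])
      = midR k D ν i n (gen k D _ g) * midL k D ν i n (e k D ν l) := by
  have hL : midL k D ν i n (e k D ν l)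
      = gen k D (ν + Multiset.replicate n i) (Gen.place [] [] (.e (l ++ List.replicate n i))) := by
    rw [e, midL_gen]; simp [Gen.place]
  rw [hL]
  by_cases hl : l ∈ words ν
  · rw [midR_gen, Finset.sum_mul, Finset.sum_eq_single_of_mem l hl]
    · have := gen_mul_e (k := k) (D := D) (κ := ν + Multiset.replicate n i) g l []
      rw [hg, List.append_nil] at this
      simpa [Gen.place, e] using this.symm
    · intro l' _ hne
      refine gen_mul_gen_of_ne fun heq => hne ?_
      rw [hg, List.append_nil, List.nil_append, Gen.top, List.append_nil] at heq
      exact List.append_cancel_right heq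
  · have h1 : (l : Multiset I) + (List.replicate n i : List I) ≠ ν + Multiset.replicate n i := by
      rw [Multiset.coe_replicate]
      intro h
      exact hl (mem_words.2 (add_right_cancel h))
    rw [gen_place_eq_zero (by simpa [hg] using h1), gen_place_eq_zero (by simpa [Gen.bot] using h1),
      mul_zero]

variable (k D i n) in
/-- Products of crossings in `R(ni)`. -/
def tailWord (l : List ℕ) : KLRAlg k D (Multiset.replicate n i) := (l.map (tailT k D i n)).prod

variable {K : Type u} [AddCommGroup K] [Module k K] [Module (KLRAlg k D ν) K]
  {M : Type u} [AddCommGroup M] [Module k M]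
  [Module (KLRAlg k D (ν + Multiset.replicate n i)) M]
  [IsScalarTower k (KLRAlg k D (ν + Multiset.replicate n i)) M]

/-- `γ : K → M` is a homomorphism of `R(ν)`-modules whose image is annihilated by the
dots of `R(ni)`. -/
structure IsHighest (D : BorcherdsCartan I) (ν : Multiset I) (i : I) (n : ℕ)
    [Module (KLRAlg k D ν) K] [Module (KLRAlg k D (ν + Multiset.replicate n i)) M]
    (γ : K →ₗ[k] M) : Prop where
  midL_smul : ∀ (a : KLRAlg k D ν) (x : K), midL k D ν i n a • γ x = γ (a • x)
  tailX_smul : ∀ (q : ℕ) (x : K), midR k D ν i n (tailX k D i n q) • γ x = 0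

variable (D ν i n) in
/-- The span of the `1 ⊗ τ` for products `τ` of at least `c` crossings, applied to the image of
`γ`. -/
def tailSpan (γ : K →ₗ[k] M) (c : ℕ) : Submodule k M :=
  Submodule.span k
    {m | ∃ (l : List ℕ) (x : K), c ≤ l.length ∧ midR k D ν i n (tailWord k D i n l) • γ x = m}

variable {γ : K →ₗ[k] M}

theorem tailWord_smul_mem {c : ℕ} {l : List ℕ} (hl : c ≤ l.length) (x : K) :
    midR k D ν i n (tailWord k D i n l) • γ x ∈ tailSpan D ν i n γ c :=
  Submodule.subset_span ⟨l, x, hl, rfl⟩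

theorem midR_tailWord_smul_mem {c : ℕ} {m : M} (l : List ℕ) (hm : m ∈ tailSpan D ν i n γ c) :
    midR k D ν i n (tailWord k D i n l) • m ∈ tailSpan D ν i n γ (l.length + c) := by
  induction hm using Submodule.span_induction with
  | zero => rw [smul_zero]; exact zero_mem _
  | add a b _ _ ha hb => rw [smul_add]; exact add_mem ha hb
  | smul r a _ ha => rw [smul_algebra_smul_comm]; exact Submodule.smul_mem _ _ ha
  | mem a ha =>
    obtain ⟨l', x, hl', rfl⟩ := ha
    rw [← mul_smul, ← midR_mul, tailWord, tailWord, ← List.prod_append, ← List.map_append]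
    exact tailWord_smul_mem (by simpa using hl') x

theorem tailSpan_anti {c d : ℕ} (h : c ≤ d) : tailSpan D ν i n γ d ≤ tailSpan D ν i n γ c :=
  Submodule.span_mono fun _ ⟨l, x, hl, hm⟩ => ⟨l, x, h.trans hl, hm⟩

namespace IsHighest

variable (hγ : IsHighest D ν i n γ)
include hγ

theorem midL_smul_mem (a : KLRAlg k D ν) {c : ℕ} {m : M} (hm : m ∈ tailSpan D ν i n γ c) :
    midL k D ν i n a • m ∈ tailSpan D ν i n γ c := by
  induction hm using Submodule.span_induction with
  | zero => rw [smul_zero]; exact zero_mem _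
  | add a b _ _ ha hb => rw [smul_add]; exact add_mem ha hb
  | smul r a _ ha => rw [smul_algebra_smul_comm]; exact Submodule.smul_mem _ _ ha
  | mem m hm =>
    obtain ⟨l, x, hl, rfl⟩ := hm
    rw [← mul_smul, midL_mul_midR, mul_smul, hγ.midL_smul]
    exact tailWord_smul_mem hl _

theorem sideOne_smul (x : K) : sideOne k D ν i n • γ x = γ x := by
  rw [← midL_one, hγ.midL_smul, one_smul]

theorem apply_mem (x : K) : γ x ∈ tailSpan D ν i n γ 0 := by
  refine Submodule.subset_span ⟨[], x, le_rfl, ?_⟩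
  rw [tailWord, List.map_nil, List.prod_nil, midR_one, hγ.sideOne_smul]

/-- The dot passes through the crossings one by one, possibly changing position, until it acts on
the image of `γ`, where every dot of `R(ni)` is zero. -/
theorem tailX_smul_eq_zero (hi : D.IsImaginary i) (q : ℕ) {c : ℕ} {m : M}
    (hm : m ∈ tailSpan D ν i n γ c) : midR k D ν i n (tailX k D i n q) • m = 0 := by
  induction hm using Submodule.span_induction with
  | zero => rw [smul_zero]
  | add a b _ _ ha hb => rw [smul_add, ha, hb, add_zero]
  | smul r a _ ha => rw [smul_algebra_smul_comm, ha, smul_zero]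
  | mem m hm =>
    obtain ⟨l, x, -, rfl⟩ := hm
    rw [← mul_smul, ← midR_mul]
    induction l generalizing q with
    | nil => rw [tailWord, List.map_nil, List.prod_nil, mul_one, hγ.tailX_smul]
    | cons p l ih =>
      obtain ⟨q', hq'⟩ := exists_tailX_mul_tailT (k := k) (D := D) (n := n) hi q p
      rw [tailWord, List.map_cons, List.prod_cons, ← mul_assoc, hq', mul_assoc, midR_mul, mul_smul]
      exact (congrArg _ (ih q')).trans (smul_zero _)

theorem isSideClosed (hi : D.IsImaginary i) :
    IsSideClosed D (ν + Multiset.replicate n i) i n (tailSpan D ν i n γ 0) where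
  xL u j v m hm := by
    have := midL_gen (k := k) (D := D) (ν := ν) (i := i) (n := n) (.x u j v)
    have h1 := hγ.midL_smul_mem (x k D ν u j v) hm
    rw [x, this] at h1
    exact h1
  tL u j l v m hm := by
    have := midL_gen (k := k) (D := D) (ν := ν) (i := i) (n := n) (.t u j l v)
    have h1 := hγ.midL_smul_mem (t k D ν u j l v) hm
    rw [t, this] at h1
    exact h1
  xR l q r hn m hm := by
    have h1 : List.replicate q i ++ i :: List.replicate r i = List.replicate n i := by
      rw [hn, replicate_append_cons]
    have h2 := gen_place_eq (k := k) (D := D) (ν := ν) (n := n)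
      (.x (List.replicate q i) i (List.replicate r i)) h1 l
    simp only [Gen.place, List.append_nil] at h2
    rw [x, h2, mul_smul]
    obtain rfl : r = n - 1 - q := by omega
    have h3 := hγ.tailX_smul_eq_zero hi q (hγ.midL_smul_mem (e k D ν l) hm)
    rw [tailX, x] at h3
    rw [h3]
    exact zero_mem _
  tR l q r hn m hm := by
    have h1 : List.replicate q i ++ i :: i :: List.replicate r i = List.replicate n i := by
      rw [← List.replicate_succ, replicate_append_cons, hn]
      rfl
    have h2 := gen_place_eq (k := k) (D := D) (ν := ν) (n := n)
      (.t (List.replicate q i) i i (List.replicate r i)) h1 l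
    simp only [Gen.place, List.append_nil] at h2
    rw [t, h2, mul_smul]
    obtain rfl : r = n - 2 - q := by omega
    have h3 := midR_tailWord_smul_mem [q] (hγ.midL_smul_mem (e k D ν l) hm)
    rw [tailWord, List.map_singleton, List.prod_singleton, tailT, t] at h3
    exact tailSpan_anti (Nat.zero_le _) h3

/-- `M` is spanned by shuffles, if it is generated by the image of `γ`. -/
theorem mem_closure_shuffle (hi : D.IsImaginary i)
    (hgen : Submodule.span (KLRAlg k D (ν + Multiset.replicate n i)) (Set.range γ) = ⊤) (m : M) :
    m ∈ AddSubmonoid.closure {m | ∃ w, Shuffle (D := D) (κ := ν + Multiset.replicate n i) i n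
      (tailSpan D ν i n γ 0) w m} := by
  set S := {m | ∃ w, Shuffle (D := D) (κ := ν + Multiset.replicate n i) i n
      (tailSpan D ν i n γ 0) w m} with hS
  have h₀ := hγ.isSideClosed hi
  have hstab : ∀ (a : KLRAlg k D (ν + Multiset.replicate n i)), ∀ m ∈ AddSubmonoid.closure S,
      a • m ∈ AddSubmonoid.closure S := by
    intro a
    induction a using gen_induction with
    | hadd a b ha hb => intro m hm; rw [add_smul]; exact add_mem (ha m hm) (hb m hm)
    | hmul a b ha hb => intro m hm; rw [mul_smul]; exact ha _ (hb m hm)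
    | hone c =>
      intro m hm
      rw [algebraMap_smul]
      induction hm using AddSubmonoid.closure_induction with
      | zero => rw [smul_zero]; exact zero_mem _
      | add x y _ _ hx hy => rw [smul_add]; exact add_mem hx hy
      | mem x hx =>
        obtain ⟨w, hw⟩ := hx
        exact AddSubmonoid.subset_closure ⟨w, hw.smul c⟩
    | hgen g =>
      intro m hm
      induction hm using AddSubmonoid.closure_induction with
      | zero => rw [smul_zero]; exact zero_mem _
      | add x y _ _ hx hy => rw [smul_add]; exact add_mem hx hy
      | mem m hm =>
        obtain ⟨w, hw⟩ := hm
        by_cases hb : und i w = g.bot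
        · cases g with
          | e s =>
            rw [show gen k D _ (.e s) • m = m by
              have := hw.e_smul; rw [hb] at this; exact this]
            exact AddSubmonoid.subset_closure ⟨w, hw⟩
          | x u j v =>
            obtain ⟨u, a, v, rfl, rfl, rfl, rfl⟩ := eq_append_cons_of_und hb
            exact AddSubmonoid.subset_closure ⟨_, hw.x_smul hi h₀ rfl⟩
          | t u j l v =>
            obtain ⟨u, a, b, v, rfl, rfl, rfl, rfl, rfl⟩ := eq_append_cons_cons_of_und hb
            exact AddSubmonoid.subset_closure ⟨_, hw.t_smul hi h₀⟩
        · have h1 := gen_mul_e (k := k) (D := D) (κ := ν + Multiset.replicate n i) g [] []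
          have h2 : g.place [] [] = g := by cases g <;> simp [Gen.place]
          rw [h2, List.nil_append, List.append_nil] at h1
          rw [← hw.e_smul, ← mul_smul, ← h1, mul_assoc, e_mul_e_of_ne (Ne.symm hb), mul_zero,
            zero_smul]
          exact zero_mem _
  have hm : m ∈ Submodule.span (KLRAlg k D (ν + Multiset.replicate n i)) (Set.range γ) :=
    hgen ▸ Submodule.mem_top
  induction hm using Submodule.span_induction with
  | zero => exact zero_mem _
  | add x y _ _ hx hy => exact add_mem hx hy
  | smul a x _ hx => exact hstab a x hx
  | mem m hm =>
    obtain ⟨x, rfl⟩ := hm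
    have h1 : γ x = ∑ s ∈ words ν, γ (e k D ν s • x) := by
      rw [← map_sum, ← Finset.sum_smul, sum_e, one_smul]
    rw [h1]
    refine sum_mem fun s _ => AddSubmonoid.subset_closure ⟨_, .base s (hγ.apply_mem _) ?_⟩
    have h2 := midL_gen (k := k) (D := D) (ν := ν) (i := i) (n := n) (.e s)
    have h3 := hγ.midL_smul (e k D ν s) (e k D ν s • x)
    rw [← mul_smul, e_mul_e] at h3
    nth_rw 1 [e] at h3
    rw [h2] at h3
    exact h3

/-- Moving marks does not change the sequence of unmarked letters. So the vector comes from one on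
which the idempotent of `s ++ [i]` in `R(ν)` acts as the identity; this idempotent commutes with the
crossings of `R(ni)` and is zero on `K`. -/
theorem shuffle_eq_zero (hK : ∀ (s : List I) (x : K), e k D ν (s ++ [i]) • x = 0)
    {w : List (Option I)} {m : M} (h : Shuffle (D := D) (κ := ν + Multiset.replicate n i) i n
      (tailSpan D ν i n γ 0) w m) {s : List I} (hs : w.reduceOption = s ++ [i]) : m = 0 := by
  induction h with
  | @base s' m hm he =>
    simp only [List.reduceOption_append, reduceOption_map_some, List.reduceOption_replicate_none,
      List.append_nil] at hs
    subst hs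
    have h2 := midL_gen (k := k) (D := D) (ν := ν) (i := i) (n := n) (.e (s ++ [i]))
    have h3 : midL k D ν i n (e k D ν (s ++ [i])) • m = m := by
      rw [e, h2]; exact he
    rw [← h3]
    clear h3 h2 he
    induction hm using Submodule.span_induction with
    | zero => rw [smul_zero]
    | add a b _ _ ha hb => rw [smul_add, ha, hb, add_zero]
    | smul r a _ ha => rw [smul_algebra_smul_comm, ha, smul_zero]
    | mem m hm =>
      obtain ⟨l, x, -, rfl⟩ := hm
      rw [← mul_smul, midL_mul_midR, mul_smul, hγ.midL_smul, hK, map_zero, smul_zero]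
  | step u j v h ih => rw [ih (by simpa [List.reduceOption_append] using hs), smul_zero]
  | add h h' ih ih' => rw [ih hs, ih' hs, add_zero]

/-- Among more than `n` final letters `i` some are unmarked, so the last unmarked letter is `i` and
the shuffle vanishes. -/
theorem tailProj_smul_eq_zero (hi : D.IsImaginary i)
    (hgen : Submodule.span (KLRAlg k D (ν + Multiset.replicate n i)) (Set.range γ) = ⊤)
    (hK : ∀ (s : List I) (x : K), e k D ν (s ++ [i]) • x = 0) {c : ℕ} (hc : n < c) (m : M) :
    tailProj k D (ν + Multiset.replicate n i) i c • m = 0 := by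
  classical
  have hm := hγ.mem_closure_shuffle hi hgen m
  induction hm using AddSubmonoid.closure_induction with
  | zero => rw [smul_zero]
  | add x y _ _ hx hy => rw [smul_add, hx, hy, add_zero]
  | mem m hm =>
    obtain ⟨w, hw⟩ := hm
    rw [tailProj_smul hw.e_smul]
    split_ifs with h
    · rcases sorted_or_reduceOption hw.reduceOption hc.le h with ⟨rfl, -⟩ | ⟨s, hs⟩
      · exact absurd hc (lt_irrefl _)
      · exact hγ.shuffle_eq_zero hK hw hs
    · rfl

/-- A word ending in `n` letters `i` may have several markings, but shuffles at a marking other than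
the sorted one vanish, again because their last unmarked letter is `i`. -/
theorem tailProj_smul_mem (hi : D.IsImaginary i)
    (hgen : Submodule.span (KLRAlg k D (ν + Multiset.replicate n i)) (Set.range γ) = ⊤)
    (hK : ∀ (s : List I) (x : K), e k D ν (s ++ [i]) • x = 0) (m : M) :
    tailProj k D (ν + Multiset.replicate n i) i n • m
      ∈ tailSpan D ν i n γ 0 := by
  classical
  have hm := hγ.mem_closure_shuffle hi hgen m
  induction hm using AddSubmonoid.closure_induction with
  | zero => rw [smul_zero]; exact zero_mem _
  | add x y _ _ hx hy => rw [smul_add]; exact add_mem hx hy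
  | mem m hm =>
    obtain ⟨w, hw⟩ := hm
    rw [tailProj_smul hw.e_smul]
    split_ifs with h
    · rcases sorted_or_reduceOption hw.reduceOption le_rfl h with ⟨-, s, hs⟩ | ⟨s, hs⟩
      · exact hw.mem hs
      · rw [hγ.shuffle_eq_zero hK hw hs]; exact zero_mem _
    · exact zero_mem _

theorem tailProj_smul_apply (x : K) :
    tailProj k D (ν + Multiset.replicate n i) i n • γ x = γ x := by
  classical
  have h1 : γ x = ∑ s ∈ words ν, γ (e k D ν s • x) := by
    rw [← map_sum, ← Finset.sum_smul, sum_e, one_smul]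
  rw [h1, Finset.smul_sum]
  refine Finset.sum_congr rfl fun s _ => ?_
  have h2 := midL_gen (k := k) (D := D) (ν := ν) (i := i) (n := n) (.e s)
  have h3 := hγ.midL_smul (e k D ν s) (e k D ν s • x)
  rw [← mul_smul, e_mul_e] at h3
  nth_rw 1 [e] at h3
  rw [h2] at h3
  rw [tailProj_smul (w := s ++ List.replicate n i) h3, if_pos (List.suffix_append _ _)]

/-- Nakayama's lemma for the action of the crossings of `R(ni)`. -/
theorem apply_mem_of_sup
    (N : Submodule (KLRAlg k D (ν + Multiset.replicate n i)) M)
    (h : ∀ x, γ x ∈ N.restrictScalars k ⊔ tailSpan D ν i n γ 1) (x : K) : γ x ∈ N := by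
  obtain ⟨L, hL⟩ := (isNilCoxeter_tailT (k := k) (D := D) (i := i)
    (n := n)).exists_prod_eq_zero_of_bounded n fun q hq => tailT_eq_zero (by omega)
  -- Descending induction on the length of the word, where `d` bounds what is missing to the
  -- nilpotency bound `L`. By hypothesis a word applied to `γ x` agrees modulo `N` with a
  -- combination of longer words.
  have key : ∀ d : ℕ, ∀ l : List ℕ, L ≤ l.length + d → ∀ x,
      midR k D ν i n (tailWord k D i n l) • γ x ∈ N := by
    intro d
    induction d with
    | zero =>
      intro l hl x
      rw [tailWord, hL l hl, map_zero, zero_smul]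
      exact zero_mem _
    | succ d ih =>
      intro l hl x
      obtain ⟨m, hm, j, hj, hx⟩ := Submodule.mem_sup.1 (h x)
      rw [← hx, smul_add]
      refine add_mem (N.smul_mem _ hm) ?_
      have h1 : tailSpan D ν i n γ (l.length + 1) ≤ N.restrictScalars k := by
        refine Submodule.span_le.2 ?_
        rintro _ ⟨l', x', hl', rfl⟩
        exact ih l' (by omega) x'
      exact h1 (midR_tailWord_smul_mem l hj)
  have := key L [] (by simp) x
  rwa [tailWord, List.map_nil, List.prod_nil, midR_one, hγ.sideOne_smul] at this

end IsHighest

end Highest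

end KLR

/-! Graded modules with a largest proper graded submodule -/

section Local

variable {k : Type u} [Field k] {B : GrAlg k}

namespace GrMod

theorem mem_iSup_gr (M : GrMod B) (m : M) : m ∈ ⨆ d, M.gr d :=
  M.internal.submodule_iSup_eq_top ▸ Submodule.mem_top

/-- The projection to the homogeneous component of degree `d`. -/
def proj (M : GrMod B) (d : ℤ) : M →ₗ[k] M :=
  (Finsupp.lapply d).comp (exists_coaction M.internal).choose

theorem proj_of_mem (M : GrMod B) {d : ℤ} {m : M} (hm : m ∈ M.gr d) (c : ℤ) :
    M.proj c m = if c = d then m else 0 := by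
  rw [proj, LinearMap.comp_apply, (exists_coaction M.internal).choose_spec d m hm,
    Finsupp.lapply_apply, Finsupp.single_apply]
  simp only [eq_comm]

theorem proj_mem (M : GrMod B) (d : ℤ) (m : M) : M.proj d m ∈ M.gr d := by
  induction M.mem_iSup_gr m using Submodule.iSup_induction' with
  | zero => rw [map_zero]; exact zero_mem _
  | add x y _ _ hx hy => rw [map_add]; exact add_mem hx hy
  | mem c x hx =>
    rw [M.proj_of_mem hx]
    split_ifs with h
    · exact h ▸ hx
    · exact zero_mem _

theorem isGradedSub_iff_proj (M : GrMod B) (N : Submodule B M) :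
    M.IsGradedSub N ↔ ∀ m ∈ N, ∀ d, M.proj d m ∈ N :=
  M.isGradedSub_iff (exists_coaction M.internal).choose_spec N

theorem apply_proj {B' : GrAlg k} {M : GrMod B} {M' : GrMod B'} (f : M →ₗ[k] M')
    (hf : ∀ d, ∀ m ∈ M.gr d, f m ∈ M'.gr d) (d : ℤ) (m : M) :
    f (M.proj d m) = M'.proj d (f m) := by
  induction M.mem_iSup_gr m using Submodule.iSup_induction' with
  | zero => simp
  | add x y _ _ hx hy => simp only [map_add, hx, hy]
  | mem c x hx =>
    rw [M.proj_of_mem hx, M'.proj_of_mem (hf c x hx)]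
    split_ifs <;> simp

/-- `J` is the largest proper graded submodule. -/
def IsLargestProper (M : GrMod B) (J : Submodule B M) : Prop :=
  M.IsGradedSub J ∧ J ≠ ⊤ ∧ ∀ N : Submodule B M, M.IsGradedSub N → N ≠ ⊤ → N ≤ J

variable {M M' : GrMod B}

theorem IsLargestProper.grRad_eq {J : Submodule B M} (hJ : M.IsLargestProper J) :
    M.grRad = J := by
  refine le_antisymm (sInf_le ⟨hJ.1, hJ.2.1, fun N hN h => ?_⟩) (le_sInf fun N hN => ?_)
  · by_cases hN' : N = ⊤
    · exact .inr hN'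
    · exact .inl (le_antisymm (hJ.2.2 N hN hN') h)
  · rcases hN.2.2 J hJ.1 (hJ.2.2 N hN.1 hN.2.1) with h | h
    · exact h.le
    · exact absurd h hJ.2.1

theorem IsGradedSub.comap (f : M →ₗ[B] M') (hf : ∀ d, ∀ m ∈ M.gr d, f m ∈ M'.gr d)
    {N : Submodule B M'} (hN : M'.IsGradedSub N) : M.IsGradedSub (N.comap f) := by
  rw [isGradedSub_iff_proj] at hN ⊢
  intro m hm d
  have := apply_proj (f.restrictScalars k) hf d m
  rw [Submodule.mem_comap]
  exact this ▸ hN (f m) hm d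

theorem IsGradedSub.map (f : M →ₗ[B] M') (hf : ∀ d, ∀ m ∈ M.gr d, f m ∈ M'.gr d)
    {N : Submodule B M} (hN : M.IsGradedSub N) : M'.IsGradedSub (N.map f) := by
  rw [isGradedSub_iff_proj] at hN ⊢
  rintro _ ⟨m, hm, rfl⟩ d
  exact ⟨M.proj d m, hN m hm d, apply_proj (f.restrictScalars k) hf d m⟩

theorem isGradedSub_bot (M : GrMod B) : M.IsGradedSub ⊥ := by
  rw [isGradedSub_iff_proj]
  intro m hm d
  rw [Submodule.mem_bot] at hm
  rw [hm, map_zero]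
  exact zero_mem _

theorem IsLargestProper.hd_isGrIrreducible {J : Submodule B M} (hJ : M.IsLargestProper J) :
    M.hd.IsGrIrreducible := by
  have hr := hJ.grRad_eq
  constructor
  · change Nontrivial (M ⧸ M.grRad)
    exact Submodule.Quotient.nontrivial_iff.2 (hr ▸ hJ.2.1)
  · intro N hN
    let q : M →ₗ[B] M.hd := M.grRad.mkQ
    have hq : Function.Surjective q := M.grRad.mkQ_surjective
    have h1 : M.IsGradedSub (N.comap q) := hN.comap q fun d m hm => ⟨m, hm, rfl⟩
    by_cases h : N.comap q = ⊤
    · right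
      rw [eq_top_iff]
      rintro y -
      obtain ⟨x, rfl⟩ := hq y
      have : x ∈ N.comap q := h ▸ Submodule.mem_top
      exact this
    · left
      rw [eq_bot_iff]
      intro y hy
      obtain ⟨x, rfl⟩ := hq y
      have : x ∈ M.grRad := hr ▸ hJ.2.2 _ h1 h hy
      exact (Submodule.Quotient.mk_eq_zero _).2 this

/-- The kernel of `f` is a proper graded submodule, since the target is nonzero, and hence lies in
`J`. Therefore the image of `J` is still proper, and `J` is exactly the preimage of `J'`. -/
theorem hd_iso_of_surjective {J : Submodule B M} (hJ : M.IsLargestProper J)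
    {J' : Submodule B M'} (hJ' : M'.IsLargestProper J') (f : M →ₗ[B] M')
    (hf : ∀ d, ∀ m ∈ M.gr d, f m ∈ M'.gr d) (hsurj : Function.Surjective f) :
    M.hd.Iso M'.hd := by
  have hcomap : M.grRad = M'.grRad.comap f := by
    rw [hJ.grRad_eq, hJ'.grRad_eq]
    refine le_antisymm (Submodule.map_le_iff_le_comap.1
      (hJ'.2.2 _ (hJ.1.map f hf) fun h => hJ.2.1 ?_)) (hJ.2.2 _ (hJ'.1.comap f hf) fun h => hJ'.2.1 ?_)
    · have hker : LinearMap.ker f ≤ J := by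
        refine hJ.2.2 _ (M'.isGradedSub_bot.comap f hf) fun h0 => hJ'.2.1 ?_
        rw [eq_top_iff]
        rintro y -
        obtain ⟨x, rfl⟩ := hsurj y
        have hx : x ∈ LinearMap.ker f := h0 ▸ Submodule.mem_top
        rw [LinearMap.mem_ker.1 hx]
        exact zero_mem _
      rw [eq_top_iff]
      rintro x -
      have hx : f x ∈ J.map f := h ▸ Submodule.mem_top
      obtain ⟨y, hy, hxy⟩ := hx
      have h2 : x - y ∈ J := hker (by rw [LinearMap.mem_ker, map_sub, hxy, sub_self])
      simpa using add_mem h2 hy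
    · rw [eq_top_iff]
      rintro y -
      obtain ⟨x, rfl⟩ := hsurj y
      have hx : x ∈ J'.comap f := h ▸ Submodule.mem_top
      exact hx
  let g : (M ⧸ M.grRad) →ₗ[B] (M' ⧸ M'.grRad) := M.grRad.mapQ M'.grRad f hcomap.le
  have hg : Function.Bijective g := by
    constructor
    · rw [← LinearMap.ker_eq_bot, eq_bot_iff]
      intro y hy
      obtain ⟨x, rfl⟩ := M.grRad.mkQ_surjective y
      have h1 : M'.grRad.mkQ (f x) = 0 := hy
      rw [Submodule.mkQ_apply, Submodule.Quotient.mk_eq_zero] at h1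
      have h2 : x ∈ M.grRad := hcomap ▸ h1
      exact (Submodule.Quotient.mk_eq_zero _).2 h2
    · intro y
      obtain ⟨y, rfl⟩ := M'.grRad.mkQ_surjective y
      obtain ⟨x, rfl⟩ := hsurj y
      exact ⟨M.grRad.mkQ x, rfl⟩
  let G : M.hd →ₗ[B] M'.hd := g
  have hG : ∀ d, ∀ m ∈ M.hd.gr d, G m ∈ M'.hd.gr d := by
    rintro d _ ⟨x, hx, rfl⟩
    exact ⟨f x, hf d x hx, rfl⟩
  refine ⟨LinearEquiv.ofBijective G hg, fun d m => ⟨hG d m, fun hm => ?_⟩⟩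
  -- The inverse also preserves degrees: `G` commutes with the projections to degree `d`, so if `G
  -- m` has degree `d`, then `m` and its component of degree `d` have the same image and coincide.
  have h1 := apply_proj (G.restrictScalars k) hG d m
  have h2 : M'.hd.proj d (G m) = G m :=
    (M'.hd.proj_of_mem (d := d) (m := G m) hm d).trans (if_pos rfl)
  have h3 : M.hd.proj d m = m := hg.1 (h1.trans h2)
  rw [← h3]
  exact M.hd.proj_mem d m

end GrMod

end Local

/-! ### The largest proper graded submodule and `ε_i` of the head -/

section Cyclic

variable {k : Type u} [Field k] {I : Type u} {D : BorcherdsCartan I} {ν : Multiset I} {i : I}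
  {n : ℕ}

instance (M : GrMod (klr k D ν)) : Module (KLRAlg k D ν) M := M.module

instance (M : GrMod (klr k D ν)) : IsScalarTower k (KLRAlg k D ν) M := M.tower

theorem Delta_ne_bot_iff (M : GrMod (klr k D ν)) (c : ℕ) :
    Delta M i c ≠ ⊥ ↔ ∃ m : M, KLR.tailProj k D ν i c • m ≠ 0 := by
  rw [Ne, Delta, LinearMap.range_eq_bot, LinearMap.ext_iff, not_forall]
  rfl

theorem e_smul_eq_zero_of_epsilon (K : GrMod (klr k D ν)) (h : epsilon i K = 0) (s : List I)
    (x : K) : KLR.e k D ν (s ++ [i]) • x = 0 := by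
  classical
  by_contra hx
  have h1 : KLR.e k D ν (s ++ [i]) • KLR.e k D ν (s ++ [i]) • x = KLR.e k D ν (s ++ [i]) • x := by
    rw [← mul_smul, KLR.e_mul_e]
  have h2 := KLR.tailProj_smul (i := i) h1 1
  rw [if_pos (show List.replicate 1 i <:+ s ++ [i] from List.suffix_append _ _)] at h2
  have h3 : 1 ∈ {m | Delta K i m ≠ ⊥} := (Delta_ne_bot_iff K 1).2 ⟨_, by rw [h2]; exact hx⟩
  -- The supremum of an unbounded set of natural numbers is `0` by convention, so `ε_i(K) = 0` gives
  -- information only once the set is bounded. A word of content `ν` has no suffix longer than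
  -- itself.
  have h4 : BddAbove {m | Delta K i m ≠ ⊥} := by
    refine ⟨Multiset.card ν, fun c hc => ?_⟩
    obtain ⟨m, hm⟩ := (Delta_ne_bot_iff K c).1 hc
    by_contra hlt
    refine hm ?_
    have h0 : KLR.tailProj k D ν i c = 0 := by
      refine Finset.sum_eq_zero fun w hw => absurd ?_ hlt
      rw [Finset.mem_filter, KLR.mem_words] at hw
      have := hw.2.length_le
      rwa [List.length_replicate, ← Multiset.coe_card, hw.1] at this
    rw [h0, zero_smul]
  have h5 := le_csSup h4 h3
  unfold epsilon at h
  omega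

theorem tailT_mem_gr (q : ℕ) : KLR.tailT k D i n q ∈ KLR.gr k D _ (-D.form i i) :=
  KLR.gen_mem_gr (.t (List.replicate q i) i i (List.replicate (n - 2 - q) i))

theorem tailWord_mem_gr (l : List ℕ) : ∃ d, KLR.tailWord k D i n l ∈ KLR.gr k D _ d := by
  induction l with
  | nil => exact ⟨0, KLR.one_mem_gr⟩
  | cons q l ih =>
    obtain ⟨d, hd⟩ := ih
    exact ⟨_, KLR.mul_mem_gr (tailT_mem_gr q) hd⟩

variable {K : GrMod (klr k D ν)} {M : GrMod (klr k D (ν + Multiset.replicate n i))}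
  {γ : K →ₗ[k] M}

theorem proj_mem_tailSpan (hdeg : ∀ d, ∀ x ∈ K.gr d, γ x ∈ M.gr d) (c : ℕ) {m : M}
    (hm : m ∈ KLR.tailSpan D ν i n γ c) (d : ℤ) : M.proj d m ∈ KLR.tailSpan D ν i n γ c := by
  induction hm using Submodule.span_induction with
  | zero => rw [map_zero]; exact zero_mem _
  | add a b _ _ ha hb => rw [map_add]; exact add_mem ha hb
  | smul r a _ ha => rw [map_smul]; exact Submodule.smul_mem _ _ ha
  | mem m hm =>
    obtain ⟨l, x, hl, rfl⟩ := hm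
    induction K.mem_iSup_gr x using Submodule.iSup_induction' with
    | zero => simp
    | add x y _ _ hx hy => rw [map_add, smul_add, map_add]; exact add_mem hx hy
    | mem f x hx =>
      obtain ⟨d', hd'⟩ := tailWord_mem_gr (k := k) (D := D) (i := i) (n := n) l
      have h1 : KLR.midR k D ν i n (KLR.tailWord k D i n l) • γ x ∈ M.gr (d' + f) :=
        M.smul_mem (KLR.mid_mem_gr k D _ hd') (hdeg f x hx)
      rw [M.proj_of_mem h1]
      split_ifs
      · exact KLR.tailWord_smul_mem hl x
      · exact zero_mem _

/-- A proper graded submodule `N` satisfies `1_{ν,ni} N ⊆ tailSpan 1`. Unlike properness itself,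
this condition is visibly inherited by sums, and it cannot hold for `M`. -/
theorem exists_isLargestProper (hi : D.IsImaginary i) (hK : K.IsGrIrreducible)
    (hε : epsilon i K = 0) (hγ : KLR.IsHighest D ν i n γ)
    (hdeg : ∀ d, ∀ x ∈ K.gr d, γ x ∈ M.gr d)
    (hgen : Submodule.span (KLRAlg k D (ν + Multiset.replicate n i)) (Set.range γ) = ⊤)
    (hM : Nontrivial M) :
    ∃ J : Submodule (klr k D (ν + Multiset.replicate n i)) M, M.IsLargestProper J := by
  have hK' := e_smul_eq_zero_of_epsilon K hε
  have htop : ∀ N : Submodule (klr k D (ν + Multiset.replicate n i)) M,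
      (∀ x, γ x ∈ N) → N = ⊤ := fun N hN => by
    rw [eq_top_iff]
    exact hgen.symm.le.trans (Submodule.span_le.2 (by rintro _ ⟨x, rfl⟩; exact hN x))
  -- The empty word contributes to `γ x`, and all other words to `j`.
  have hsplit : ∀ m ∈ KLR.tailSpan D ν i n γ 0, ∃ x, ∃ j ∈ KLR.tailSpan D ν i n γ 1,
      m = γ x + j := by
    intro m hm
    induction hm using Submodule.span_induction with
    | zero => exact ⟨0, 0, zero_mem _, by simp⟩
    | add a b _ _ ha hb =>
      obtain ⟨x, j, hj, rfl⟩ := ha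
      obtain ⟨y, l, hl, rfl⟩ := hb
      exact ⟨x + y, j + l, add_mem hj hl, by rw [map_add]; abel⟩
    | smul r a _ ha =>
      obtain ⟨x, j, hj, rfl⟩ := ha
      exact ⟨r • x, r • j, Submodule.smul_mem _ _ hj, by rw [map_smul, smul_add]⟩
    | mem m hm =>
      obtain ⟨l, x, -, rfl⟩ := hm
      cases l with
      | nil =>
        refine ⟨x, 0, zero_mem _, ?_⟩
        rw [KLR.tailWord, List.map_nil, List.prod_nil, KLR.midR_one, hγ.sideOne_smul, add_zero]
      | cons q l =>
        exact ⟨0, _, KLR.tailWord_smul_mem (l := q :: l) (by simp) x, by rw [map_zero, zero_add]⟩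
  -- the largest proper graded submodule meets the image of `1_ν ⊗ 1_{ni}` in the span of the
  -- nontrivial products of crossings
  have hproper : ∀ N : Submodule (klr k D (ν + Multiset.replicate n i)) M, M.IsGradedSub N →
      N ≠ ⊤ → ∀ m ∈ N, KLR.tailProj k D (ν + Multiset.replicate n i) i n • m
        ∈ KLR.tailSpan D ν i n γ 1 := by
    intro N hN hne m hm
    let S : Submodule k M := N.restrictScalars k ⊔ KLR.tailSpan D ν i n γ 1
    -- The preimage of `N + tailSpan 1` under `γ`. It is an `R(ν)`-submodule because both summands
    -- are stable under `midL`, although `tailSpan 1` need not be stable under `R(ν + ni)`.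
    let KN : Submodule (klr k D ν) K :=
      { carrier := {x | γ x ∈ S}
        add_mem' := fun {a b} ha hb => by
          change γ (a + b) ∈ S
          rw [map_add]; exact add_mem ha hb
        zero_mem' := by
          change γ 0 ∈ S
          rw [map_zero]; exact zero_mem _
        smul_mem' := fun a x hx => by
          obtain ⟨y, hy, j, hj, hyj⟩ := Submodule.mem_sup.1 (show γ x ∈ S from hx)
          have h1 := hγ.midL_smul a x
          rw [← hyj, smul_add] at h1
          change γ (a • x) ∈ S
          exact h1 ▸ Submodule.add_mem_sup (N.smul_mem _ hy) (hγ.midL_smul_mem a hj) }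
    have hKN : K.IsGradedSub KN := by
      rw [GrMod.isGradedSub_iff_proj] at hN ⊢
      intro x hx d
      change γ (K.proj d x) ∈ S
      obtain ⟨y, hy, j, hj, hyj⟩ := Submodule.mem_sup.1 (show γ x ∈ S from hx)
      rw [GrMod.apply_proj γ hdeg, ← hyj, map_add]
      exact Submodule.add_mem_sup (hN y hy d) (proj_mem_tailSpan hdeg 1 hj d)
    -- If `KN` is zero, then `1_{ν,ni} m`, which is in `N`, has no part in `γ(K)` modulo `tailSpan
    -- 1`. If `KN` is all of `K`, Nakayama's lemma puts the generators `γ(K)` into `N`.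
    rcases hK.2 KN hKN with h | h
    · obtain ⟨x, j, hj, hxj⟩ := hsplit _ (hγ.tailProj_smul_mem hi hgen hK' m)
      have hx : x ∈ KN := by
        change γ x ∈ S
        have h2 : γ x = KLR.tailProj k D (ν + Multiset.replicate n i) i n • m + -j := by
          rw [hxj]; abel
        rw [h2]
        exact Submodule.add_mem_sup (N.smul_mem _ hm) (neg_mem hj)
      rw [h, Submodule.mem_bot] at hx
      rw [hxj, hx, map_zero, zero_add]
      exact hj
    · refine absurd (htop N fun x => hγ.apply_mem_of_sup N (fun y => ?_) x) hne
      have : y ∈ KN := h ▸ Submodule.mem_top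
      exact this
  refine ⟨⨆ N : {N : Submodule (klr k D (ν + Multiset.replicate n i)) M //
    M.IsGradedSub N ∧ N ≠ ⊤}, N.1, ?_, fun h => ?_, fun N hN hne =>
    le_iSup (fun N : {N : Submodule (klr k D (ν + Multiset.replicate n i)) M //
      M.IsGradedSub N ∧ N ≠ ⊤} => N.1) ⟨N, hN, hne⟩⟩
  · rw [GrMod.isGradedSub_iff_proj]
    intro m hm d
    induction hm using Submodule.iSup_induction' with
    | zero => rw [map_zero]; exact zero_mem _
    | add x y _ _ hx hy => rw [map_add]; exact add_mem hx hy
    | mem N x hx =>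
      exact Submodule.mem_iSup_of_mem N ((M.isGradedSub_iff_proj N.1).1 N.2.1 x hx d)
  -- If the sum were all of `M`, then `γ(K)`, which is fixed by `tailProj`, would lie in `tailSpan
  -- 1`. Nakayama's lemma for `N = ⊥` then gives `γ = 0`, and `M` would be zero.
  · have hall : ∀ m : M, KLR.tailProj k D (ν + Multiset.replicate n i) i n • m
        ∈ KLR.tailSpan D ν i n γ 1 := by
      intro m
      have hm : m ∈ ⨆ N : {N : Submodule (klr k D (ν + Multiset.replicate n i)) M //
        M.IsGradedSub N ∧ N ≠ ⊤}, N.1 := by rw [h]; exact Submodule.mem_top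
      induction hm using Submodule.iSup_induction' with
      | zero => rw [smul_zero]; exact zero_mem _
      | add x y _ _ hx hy => rw [smul_add]; exact add_mem hx hy
      | mem N x hx => exact hproper N.1 N.2.1 N.2.2 x hx
    have hzero : ∀ x, γ x ∈ (⊥ : Submodule (klr k D (ν + Multiset.replicate n i)) M) :=
      hγ.apply_mem_of_sup ⊥ fun x => by
        refine Submodule.mem_sup_right ?_
        have := hall (γ x)
        rwa [hγ.tailProj_smul_apply] at this
    have hbt := htop ⊥ hzero
    obtain ⟨m, hm⟩ := exists_ne (0 : M)
    have hm' : m ∈ (⊥ : Submodule (klr k D (ν + Multiset.replicate n i)) M) :=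
      hbt ▸ Submodule.mem_top
    exact hm ((Submodule.mem_bot _).1 hm')

/-- The idempotent for `n` final letters `i` fixes `γ(K)`; if it acted by zero on the head, the
generators of `M` would lie in the proper submodule `J`. For more than `n` letters the idempotent is
already zero on `M`. -/
theorem epsilon_hd (hi : D.IsImaginary i)
    (hε : epsilon i K = 0) (hγ : KLR.IsHighest D ν i n γ)
    (hgen : Submodule.span (KLRAlg k D (ν + Multiset.replicate n i)) (Set.range γ) = ⊤)
    {J : Submodule (klr k D (ν + Multiset.replicate n i)) M} (hJ : M.IsLargestProper J) :
    epsilon i M.hd = n := by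
  have hK' := e_smul_eq_zero_of_epsilon K hε
  refine IsGreatest.csSup_eq ⟨(Delta_ne_bot_iff _ _).2 ?_, fun c hc => ?_⟩
  · by_contra! h
    refine hJ.2.1 (eq_top_iff.2 ?_)
    refine hgen.symm.le.trans (Submodule.span_le.2 ?_)
    rintro _ ⟨x, rfl⟩
    have h1 : M.grRad.mkQ (KLR.tailProj k D (ν + Multiset.replicate n i) i n • γ x) = 0 :=
      h (M.grRad.mkQ (γ x))
    rw [hγ.tailProj_smul_apply, Submodule.mkQ_apply, Submodule.Quotient.mk_eq_zero,
      hJ.grRad_eq] at h1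
    exact h1
  · obtain ⟨y, hy⟩ := (Delta_ne_bot_iff _ _).1 hc
    by_contra hlt
    refine hy ?_
    obtain ⟨m, rfl⟩ := M.grRad.mkQ_surjective y
    have h1 := hγ.tailProj_smul_eq_zero hi hgen hK' (not_le.1 hlt) m
    change M.grRad.mkQ (KLR.tailProj k D (ν + Multiset.replicate n i) i c • m) = 0
    rw [h1, map_zero]

end Cyclic

/-! A module over `R(ν + ni)` obtained from an `R(ν)`-module by inserting `n` strands of colour
`i` that carry no dots and do not cross each other -/

section RingIdentities

variable {R : Type*} [Ring R]

/-- With `x`, `y` the dots and `t` the crossing of two strands of the same real colour, the sum is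
the divided difference of a power. It reproduces the correction term of the real braid relation when
the middle strand is a marked one. -/
theorem pow_mul_eq_of_mul_eq_add {x y t e : R} (h : x * t = t * y + e) (hy : Commute e y) (m : ℕ) :
    x ^ m * t = t * y ^ m + ∑ c ∈ Finset.range m, x ^ c * y ^ (m - 1 - c) * e := by
  induction m with
  | zero => simp
  | succ m ih =>
    rw [pow_succ', mul_assoc, ih, mul_add, ← mul_assoc, h, add_mul, mul_assoc, ← pow_succ',
      add_assoc, Finset.sum_range_succ', Finset.mul_sum, add_comm (e * y ^ m)]
    congr 2
    · refine Finset.sum_congr rfl fun c hc => ?_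
      rw [Finset.mem_range] at hc
      rw [pow_succ', show m + 1 - 1 - (c + 1) = m - 1 - c by omega]
      simp only [mul_assoc]
    · rw [(hy.pow_right m).eq]
      simp

/-- A symmetric expression in the two dots commutes with a real crossing, although the single dots
do not. -/
theorem commute_mul_of_mul_eq_add {x y t e : R} (h : x * t = t * y + e) (h' : t * x = y * t + e)
    (hxy : Commute x y) (he : Commute e x) : Commute (x * y) t := by
  have h1 : y * t = t * x - e := by rw [h']; abel
  have h2 : x * y * t = t * y * x + (e * x - x * e) := by
    rw [mul_assoc, h1, mul_sub, ← mul_assoc, h, add_mul]; abel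
  rw [Commute, SemiconjBy, h2, he.eq, sub_self, add_zero, mul_assoc, hxy.eq]

end RingIdentities

/-! ### Coefficients of dots and crossings on marked words -/

namespace KLR

section Insertion

variable {k : Type u} [Field k] {I : Type u} {D : BorcherdsCartan I} {ν : Multiset I} {i : I}

variable (k D ν) in
/-- The action of a dot, on a word with marked letters. -/
def dotElt (u : List (Option I)) (a : Option I) (v : List (Option I)) : KLRAlg k D ν :=
  match a with
  | none => 0
  | some j => x k D ν u.reduceOption j v.reduceOption

open Classical in
variable (k D ν i) in
/-- The action of the double crossing of a marked strand of colour `i` and a strand of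
colour `j`. -/
def doubleElt (u : List I) (j : I) (v : List I) : KLRAlg k D ν :=
  if j = i then 0 else if D.form j i = 0 then 1 else x k D ν u j v ^ (-D.a j i).toNat

variable (k D ν i) in
/-- The action of a crossing, on a word with marked letters. -/
def crossElt (u : List (Option I)) (a b : Option I) (v : List (Option I)) : KLRAlg k D ν :=
  match a, b with
  | none, none => 0
  | some j, some l => t k D ν u.reduceOption j l v.reduceOption
  -- Moving a mark to the left is normalised to act by `1`; the return move must then account for
  -- the whole double crossing, with the dot of the marked strand set to zero.
  | some _, none => 1
  | none, some j => doubleElt k D ν i u.reduceOption j v.reduceOption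

/-- The case distinction depends on the colour `j` only, so both sides are `0`, `1` or the same
power of a dot. Whatever intertwines the dots intertwines these elements. -/
theorem doubleElt_semiconj {u v u' v' : List I} {j : I} {a : KLRAlg k D ν}
    (h : SemiconjBy a (x k D ν u j v) (x k D ν u' j v')) :
    SemiconjBy a (doubleElt k D ν i u j v) (doubleElt k D ν i u' j v') := by
  unfold doubleElt
  split_ifs
  · exact SemiconjBy.zero_right _
  · exact SemiconjBy.one_right _
  · exact h.pow_right _

theorem doubleElt_commute {u v u' v' : List I} {j l : I}
    (h : Commute (x k D ν u j v) (x k D ν u' l v')) :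
    Commute (doubleElt k D ν i u j v) (doubleElt k D ν i u' l v') :=
  doubleElt_semiconj (Commute.symm (doubleElt_semiconj h.symm))

theorem commute_x_x (u : List I) (j : I) (v : List I) (l : I) (w : List I) :
    Commute (x k D ν u j (v ++ l :: w)) (x k D ν (u ++ j :: v) l w) := x_mul_x u j v l w

/-- The coefficients are now shown to satisfy the defining relations. If all strands involved are
unmarked, this is the relation in `R(ν)`; otherwise factors become `0`, `1` or a `doubleElt`. -/
theorem dotElt_mul_dotElt (u : List (Option I)) (a : Option I) (v : List (Option I))
    (b : Option I) (w : List (Option I)) :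
    dotElt k D ν u a (v ++ b :: w) * dotElt k D ν (u ++ a :: v) b w
      = dotElt k D ν (u ++ a :: v) b w * dotElt k D ν u a (v ++ b :: w) := by
  cases a <;> cases b <;> simp [dotElt, List.reduceOption_append, x_mul_x]

theorem dotElt_mul_crossElt (u : List (Option I)) (a : Option I) (v : List (Option I))
    (b c : Option I) (w : List (Option I)) :
    dotElt k D ν u a (v ++ c :: b :: w) * crossElt k D ν i (u ++ a :: v) b c w
      = crossElt k D ν i (u ++ a :: v) b c w * dotElt k D ν u a (v ++ b :: c :: w) := by
  cases a with
  | none => simp [dotElt]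
  | some a =>
    cases b with
    | none =>
      cases c with
      | none => simp [crossElt]
      | some c =>
        have h := doubleElt_semiconj (i := i) (commute_x_x (k := k) (D := D) (ν := ν)
          u.reduceOption a v.reduceOption c w.reduceOption)
        simpa [crossElt, dotElt, List.reduceOption_append] using h.eq
    | some b => cases c <;> simp [dotElt, crossElt, List.reduceOption_append, x_mul_t]

theorem dotElt_mul_crossElt' (u : List (Option I)) (b c : Option I) (v : List (Option I))
    (a : Option I) (w : List (Option I)) :
    dotElt k D ν (u ++ c :: b :: v) a w * crossElt k D ν i u b c (v ++ a :: w)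
      = crossElt k D ν i u b c (v ++ a :: w) * dotElt k D ν (u ++ b :: c :: v) a w := by
  cases a with
  | none => simp [dotElt]
  | some a =>
    cases b with
    | none =>
      cases c with
      | none => simp [crossElt]
      | some c =>
        have h := doubleElt_semiconj (i := i) (commute_x_x (k := k) (D := D) (ν := ν)
          u.reduceOption c v.reduceOption a w.reduceOption).symm
        simpa [crossElt, dotElt, List.reduceOption_append] using h.eq
    | some b => cases c <;> simp [dotElt, crossElt, List.reduceOption_append, x_mul_t']

theorem crossElt_mul_crossElt (u : List (Option I)) (a b : Option I) (v : List (Option I))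
    (c d : Option I) (w : List (Option I)) :
    crossElt k D ν i u a b (v ++ d :: c :: w) * crossElt k D ν i (u ++ a :: b :: v) c d w
      = crossElt k D ν i (u ++ b :: a :: v) c d w * crossElt k D ν i u a b (v ++ c :: d :: w) := by
  match a, b, c, d with
  | none, none, _, _ => simp [crossElt]
  | _, _, none, none => simp [crossElt]
  | some a, none, none, some d => simp [crossElt, List.reduceOption_append]
  | some a, none, some c, none => simp [crossElt]
  | some a, none, some c, some d => simp [crossElt, List.reduceOption_append]
  | none, some b, some c, none => simp [crossElt, List.reduceOption_append]
  | some a, some b, some c, none => simp [crossElt, List.reduceOption_append]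
  | some a, some b, some c, some d =>
    simpa [crossElt, List.reduceOption_append] using t_mul_t (k := k) (D := D) (κ := ν)
      u.reduceOption a b v.reduceOption c d w.reduceOption
  | some a, some b, none, some d =>
    have h := doubleElt_semiconj (i := i) (a := t k D ν u.reduceOption a b
      (v.reduceOption ++ d :: w.reduceOption))
      (x_mul_t' (k := k) (D := D) (κ := ν) u.reduceOption a b v.reduceOption d w.reduceOption).symm
    simpa [crossElt, List.reduceOption_append] using h.eq
  | none, some b, some c, some d =>
    have h := doubleElt_semiconj (i := i) (a := t k D ν (u.reduceOption ++ b :: v.reduceOption) c d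
      w.reduceOption)
      (x_mul_t (k := k) (D := D) (κ := ν) u.reduceOption b v.reduceOption c d w.reduceOption).symm
    simpa [crossElt, List.reduceOption_append] using h.eq.symm
  | none, some b, none, some d =>
    have h := doubleElt_commute (i := i) (commute_x_x (k := k) (D := D) (ν := ν) u.reduceOption b
      v.reduceOption d w.reduceOption)
    simpa [crossElt, List.reduceOption_append] using h.eq

theorem dotElt_mul_crossElt_slide (u : List (Option I)) (a b : Option I) (v : List (Option I))
    (h : a.getD i ≠ b.getD i ∨ D.IsImaginary (a.getD i)) :
    dotElt k D ν u b (a :: v) * crossElt k D ν i u a b v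
      = crossElt k D ν i u a b v * dotElt k D ν (u ++ [a]) b v := by
  match a, b with
  | none, none => simp [crossElt]
  | some a, none => simp [dotElt]
  | some a, some b =>
    simpa [crossElt, dotElt, List.reduceOption_append] using x_mul_t_slide _ _ (by simpa using h)
  | none, some b =>
    have h := doubleElt_semiconj (i := i)
      (Commute.refl (x k D ν u.reduceOption b v.reduceOption))
    simpa [crossElt, dotElt, List.reduceOption_append] using h.eq

theorem crossElt_mul_dotElt_slide (u : List (Option I)) (a b : Option I) (v : List (Option I))
    (h : a.getD i ≠ b.getD i ∨ D.IsImaginary (a.getD i)) :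
    crossElt k D ν i u a b v * dotElt k D ν u a (b :: v)
      = dotElt k D ν (u ++ [b]) a v * crossElt k D ν i u a b v := by
  match a, b with
  | none, _ => simp [dotElt]
  | some a, none => simp [dotElt, crossElt, List.reduceOption_append]
  | some a, some b =>
    simpa [crossElt, dotElt, List.reduceOption_append] using t_mul_x_slide _ _ (by simpa using h)

theorem crossElt_sq_same (u : List (Option I)) (a b : Option I) (v : List (Option I))
    (h : a.getD i = b.getD i) : crossElt k D ν i u b a v * crossElt k D ν i u a b v = 0 := by
  match a, b with
  | none, none => simp [crossElt]
  | some a, none => simp_all [crossElt, doubleElt]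
  | none, some b => simp_all [crossElt, doubleElt]
  | some a, some b =>
    obtain rfl : a = b := h
    exact t_sq_same _ _ _

theorem form_comm (D : BorcherdsCartan I) (j l : I) : D.form j l = D.form l j := D.symm j l

/-- Relations with an idempotent on one side are stated on vectors fixed by the idempotent of the
unmarked word, because a crossing with a marked strand may act by the plain unit `1` rather than by
that idempotent. -/
theorem crossElt_sq_orth (u : List (Option I)) (a b : Option I) (v : List (Option I))
    (h : a.getD i ≠ b.getD i) (h' : D.form (a.getD i) (b.getD i) = 0) {K : Type*} [AddCommGroup K]
    [Module (KLRAlg k D ν) K] {m : K}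
    (hm : e k D ν (u ++ a :: b :: v).reduceOption • m = m) :
    (crossElt k D ν i u b a v * crossElt k D ν i u a b v) • m = m := by
  match a, b with
  | none, none => simp at h
  | some a, none =>
    simp only [Option.getD] at h h'
    simp [crossElt, doubleElt, h, h']
  | none, some b =>
    simp only [Option.getD] at h h'
    simp [crossElt, doubleElt, Ne.symm h, form_comm D b i, h']
  | some a, some b =>
    refine Eq.trans ?_ hm
    simpa [crossElt, List.reduceOption_append] using congrArg (· • m)
      (t_sq_orth (k := k) (D := D) (κ := ν) u.reduceOption v.reduceOption h h')

theorem toNat_ne_zero {D : BorcherdsCartan I} {j l : I} (h : j ≠ l) (h' : D.form j l ≠ 0) :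
    (-D.a j l).toNat ≠ 0 := by
  have h1 := D.off_diag j l h
  have h2 : D.a j l ≠ 0 := fun h0 => h' (by simp [BorcherdsCartan.form, h0])
  omega

/-- The dot on a marked strand is zero and its exponent is positive by `toNat_ne_zero`, so only the
dot power on the unmarked strand survives. This is the value chosen in `doubleElt`. -/
theorem crossElt_sq_ne (u : List (Option I)) (a b : Option I) (v : List (Option I))
    (h : a.getD i ≠ b.getD i) (h' : D.form (a.getD i) (b.getD i) ≠ 0) {K : Type*} [AddCommGroup K]
    [Module (KLRAlg k D ν) K] {m : K}
    (hm : e k D ν (u ++ a :: b :: v).reduceOption • m = m) :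
    (crossElt k D ν i u b a v * crossElt k D ν i u a b v) • m
      = dotElt k D ν u a (b :: v) ^ (-D.a (a.getD i) (b.getD i)).toNat • m
        + dotElt k D ν (u ++ [a]) b v ^ (-D.a (b.getD i) (a.getD i)).toNat • m := by
  have h'' : D.form (b.getD i) (a.getD i) ≠ 0 := by rwa [form_comm]
  have h1 := toNat_ne_zero h h'
  have h2 := toNat_ne_zero h.symm h''
  match a, b with
  | none, none => simp at h
  | some a, none =>
    simp only [Option.getD] at h h' h1 h2
    simp [crossElt, doubleElt, dotElt, h, h', h2, zero_pow]
  | none, some b =>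
    simp only [Option.getD] at h h'' h1 h2
    simp [crossElt, doubleElt, dotElt, Ne.symm h, h'', h1, zero_pow, List.reduceOption_append]
  | some a, some b =>
    have := congrArg (· • m)
      (t_sq_ne (k := k) (D := D) (κ := ν) u.reduceOption v.reduceOption h h')
    simp only [List.reduceOption_append, List.reduceOption_cons_of_some] at hm
    simpa [crossElt, dotElt, List.reduceOption_append, add_smul, mul_smul, hm] using this

/-- The crossing of strands of the same real colour. -/
theorem commute_dots_crossing (u : List I) {j : I} (v : List I) (h : D.IsReal j) :
    Commute (x k D ν u j (j :: v) * x k D ν (u ++ [j]) j v) (t k D ν u j j v) := by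
  refine commute_mul_of_mul_eq_add (x_mul_t_real u v h) (t_mul_x_real u v h) ?_ ?_
  · simpa [Commute, SemiconjBy] using x_mul_x (k := k) (D := D) (κ := ν) u j [] j v
  · simpa [Commute, SemiconjBy] using
      (e_mul_x (k := k) (D := D) (κ := ν) u j (j :: v)).trans (x_mul_e u j (j :: v)).symm

/-- A mark passing to the right over two unmarked strands gives the product of their double
crossings. For a common real colour the two dot powers do not slide through the crossing separately,
but their product is a power of the product of the two dots and commutes with it. -/
theorem doubleElt_mul_crossing (u : List I) (j l : I) (v : List I) :
    t k D ν u j l v * doubleElt k D ν i (u ++ [j]) l v * doubleElt k D ν i u j (l :: v)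
      = doubleElt k D ν i (u ++ [l]) j v * doubleElt k D ν i u l (j :: v) * t k D ν u j l v := by
  by_cases h : j ≠ l ∨ D.IsImaginary j
  · have h1 := doubleElt_semiconj (i := i) (a := t k D ν u j l v)
      (x_mul_t_slide (k := k) (D := D) (κ := ν) u v h).symm
    have h2 := doubleElt_semiconj (i := i) (a := t k D ν u j l v)
      (t_mul_x_slide (k := k) (D := D) (κ := ν) u v h)
    have h3 := doubleElt_commute (i := i) (commute_x_x (k := k) (D := D) (ν := ν) u l [] j v)
    simp only [List.nil_append] at h3
    rw [h1.eq, mul_assoc, h2.eq, ← mul_assoc, h3.eq]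
  · push Not at h
    obtain ⟨rfl, hj⟩ := h
    have hr : D.IsReal j := (D.diag j).resolve_right fun h => hj h.1
    have h1 := commute_dots_crossing (k := k) (ν := ν) u v hr
    have h2 : Commute (x k D ν u j (j :: v)) (x k D ν (u ++ [j]) j v) := commute_x_x u j [] j v
    have h3 : Commute (doubleElt k D ν i u j (j :: v) * doubleElt k D ν i (u ++ [j]) j v)
        (t k D ν u j j v) := by
      unfold doubleElt
      split_ifs
      · rw [mul_zero]; exact Commute.zero_left _
      · rw [mul_one]; exact Commute.one_left _
      · rw [← h2.mul_pow]; exact h1.pow_left _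
    rw [(doubleElt_commute h2).eq] at h3
    rw [mul_assoc, h3.eq]

/-- Two marks produce a factor `0` on both sides, or leave only matching double crossings and units.
The delicate case is a mark between two strands of the same real colour `a`: there the hypothesis
forces `(α_a, α_i) = 0`, so `doubleElt` is `1`. -/
theorem crossElt_braid (u : List (Option I)) (a b c : Option I) (v : List (Option I))
    (hi : D.IsImaginary i)
    (h : ¬ (a.getD i = c.getD i ∧ D.IsReal (a.getD i) ∧ a.getD i ≠ b.getD i ∧
      D.form (a.getD i) (b.getD i) ≠ 0)) :
    crossElt k D ν i u b c (a :: v) * crossElt k D ν i (u ++ [b]) a c v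
        * crossElt k D ν i u a b (c :: v)
      = crossElt k D ν i (u ++ [c]) a b v * crossElt k D ν i u a c (b :: v)
        * crossElt k D ν i (u ++ [a]) b c v := by
  match a, b, c with
  | none, none, _ => simp [crossElt]
  | none, some b, none => simp [crossElt]
  | some a, none, none => simp [crossElt]
  | some a, some b, none => simp [crossElt, List.reduceOption_append]
  | some a, some b, some c =>
    simpa [crossElt, List.reduceOption_append] using
      braid (k := k) (D := D) (κ := ν) u.reduceOption v.reduceOption h
  | none, some b, some c =>
    simpa [crossElt, List.reduceOption_append] using
      doubleElt_mul_crossing (k := k) (D := D) (ν := ν) u.reduceOption b c v.reduceOption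
  | some a, none, some c =>
    simp only [Option.getD] at h
    suffices H : doubleElt k D ν i u.reduceOption c (a :: v.reduceOption)
          * t k D ν u.reduceOption a c v.reduceOption
        = t k D ν u.reduceOption a c v.reduceOption
          * doubleElt k D ν i (u.reduceOption ++ [a]) c v.reduceOption by
      simpa [crossElt, List.reduceOption_append] using H
    by_cases hac : a ≠ c ∨ D.IsImaginary a
    · exact (doubleElt_semiconj (i := i)
        (x_mul_t_slide (k := k) (D := D) (κ := ν) u.reduceOption v.reduceOption hac).symm).eq.symm
    · push Not at hac
      obtain ⟨rfl, ha⟩ := hac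
      have hr : D.IsReal a := (D.diag a).resolve_right fun h => ha h.1
      have hai : a ≠ i := fun h => ha (h ▸ hi)
      have hf : D.form a i = 0 := by
        by_contra hf
        exact h ⟨rfl, hr, hai, hf⟩
      simp [doubleElt, hai, hf]

theorem crossElt_braid_real (u : List (Option I)) (a b c : Option I) (v : List (Option I))
    (hi : D.IsImaginary i) (hac : a.getD i = c.getD i) (h : D.IsReal (a.getD i))
    (h' : a.getD i ≠ b.getD i) (h'' : D.form (a.getD i) (b.getD i) ≠ 0) {K : Type*}
    [AddCommGroup K] [Module (KLRAlg k D ν) K] {m : K}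
    (hm : e k D ν (u ++ a :: b :: c :: v).reduceOption • m = m) :
    (crossElt k D ν i u b c (a :: v) * crossElt k D ν i (u ++ [b]) a c v
        * crossElt k D ν i u a b (c :: v)) • m
      = (crossElt k D ν i (u ++ [c]) a b v * crossElt k D ν i u a c (b :: v)
        * crossElt k D ν i (u ++ [a]) b c v) • m
        + ∑ d ∈ Finset.range (-D.a (a.getD i) (b.getD i)).toNat,
          (dotElt k D ν u a (b :: c :: v) ^ d * dotElt k D ν (u ++ [a, b]) c v
            ^ ((-D.a (a.getD i) (b.getD i)).toNat - 1 - d)) • m := by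
  have hni : ¬ D.IsReal i := fun h => by
    unfold BorcherdsCartan.IsReal at h
    unfold BorcherdsCartan.IsImaginary at hi
    omega
  obtain ⟨j, rfl⟩ : ∃ j, a = some j := by
    cases a with
    | none => exact absurd h hni
    | some j => exact ⟨j, rfl⟩
  obtain rfl : c = some j := by
    cases c with
    | none => exact absurd (show D.IsReal i from Eq.subst (motive := D.IsReal) hac h) hni
    | some l => exact congrArg some (Eq.symm hac)
  simp only [Option.getD] at h h' h''
  match b with
  | some l =>
    have := congrArg (· • m)
      (braid_real (k := k) (D := D) (κ := ν) u.reduceOption v.reduceOption h h' h'')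
    simp only [List.reduceOption_append, List.reduceOption_cons_of_some] at hm
    simpa [crossElt, dotElt, List.reduceOption_append, add_smul, Finset.sum_smul, mul_smul, hm]
      using this
  -- With the middle strand marked, the relation says how a power of a dot passes a real crossing;
  -- the resulting sum is the required one.
  | none =>
    have h1 : Commute (e k D ν (u.reduceOption ++ j :: j :: v.reduceOption))
        (x k D ν (u.reduceOption ++ [j]) j v.reduceOption) := by
      simpa [Commute, SemiconjBy] using
        (e_mul_x (k := k) (D := D) (κ := ν) (u.reduceOption ++ [j]) j v.reduceOption).trans
          (x_mul_e (u.reduceOption ++ [j]) j v.reduceOption).symm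
    have := congrArg (· • m) (pow_mul_eq_of_mul_eq_add
      (x_mul_t_real (k := k) (D := D) (κ := ν) u.reduceOption v.reduceOption h) h1
      (-D.a j i).toNat)
    simp only [List.reduceOption_append, List.reduceOption_cons_of_some,
      List.reduceOption_cons_of_none] at hm
    simpa [crossElt, dotElt, doubleElt, h', h'', List.reduceOption_append, add_smul,
      Finset.sum_smul, mul_smul, hm] using this

end Insertion

end KLR

/-! ### The action of `R(ν + ni)` on families indexed by marked words -/

namespace KLR

section InsertionModule

variable {k : Type u} [Field k] {I : Type u} {D : BorcherdsCartan I} {ν : Multiset I} {i : I}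
  {n : ℕ}

theorem eq_cons_of_und {i : I} {w : List (Option I)} {j : I} {v : List I}
    (h : und i w = j :: v) : ∃ a v', w = a :: v' ∧ a.getD i = j ∧ und i v' = v :=
  List.map_eq_cons_iff.1 h

theorem eq_some_of_isReal (hi : D.IsImaginary i) {a : Option I} (h : D.IsReal (a.getD i)) :
    a = some (a.getD i) := by
  cases a with
  | none =>
    unfold BorcherdsCartan.IsReal at h
    unfold BorcherdsCartan.IsImaginary at hi
    simp only [Option.getD] at h
    omega
  | some j => rfl

section Real

variable {K : Type*} [AddCommGroup K] [Module (KLRAlg k D ν) K] {m : K}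

theorem dotElt_mul_crossElt_real (u : List (Option I)) (a b : Option I) (v : List (Option I))
    (hi : D.IsImaginary i) (hab : a.getD i = b.getD i) (h : D.IsReal (a.getD i))
    (hm : e k D ν (u ++ a :: b :: v).reduceOption • m = m) :
    (dotElt k D ν u b (a :: v) * crossElt k D ν i u a b v) • m
      = (crossElt k D ν i u a b v * dotElt k D ν (u ++ [a]) b v) • m + m := by
  have ha := eq_some_of_isReal hi h
  have hb := eq_some_of_isReal hi (hab ▸ h)
  rw [← hab] at hb
  generalize a.getD i = j at *
  subst ha hb
  have := congrArg (· • m) (x_mul_t_real (k := k) (κ := ν) u.reduceOption v.reduceOption h)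
  simp only [List.reduceOption_append, List.reduceOption_cons_of_some] at hm
  simpa [crossElt, dotElt, List.reduceOption_append, add_smul, mul_smul, hm] using this

theorem crossElt_mul_dotElt_real (u : List (Option I)) (a b : Option I) (v : List (Option I))
    (hi : D.IsImaginary i) (hab : a.getD i = b.getD i) (h : D.IsReal (a.getD i))
    (hm : e k D ν (u ++ a :: b :: v).reduceOption • m = m) :
    (crossElt k D ν i u a b v * dotElt k D ν u a (b :: v)) • m
      = (dotElt k D ν (u ++ [b]) a v * crossElt k D ν i u a b v) • m + m := by
  have ha := eq_some_of_isReal hi h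
  have hb := eq_some_of_isReal hi (hab ▸ h)
  rw [← hab] at hb
  generalize a.getD i = j at *
  subst ha hb
  have := congrArg (· • m) (t_mul_x_real (k := k) (κ := ν) u.reduceOption v.reduceOption h)
  simp only [List.reduceOption_append, List.reduceOption_cons_of_some] at hm
  simpa [crossElt, dotElt, List.reduceOption_append, add_smul, mul_smul, hm] using this

end Real

/-- The number of marks is the difference of the two lengths; the identity is written additively to
avoid a truncated subtraction. -/
theorem coe_und (i : I) (w : List (Option I)) :
    (und i w : Multiset I) + Multiset.replicate w.reduceOption.length i
      = w.reduceOption + Multiset.replicate w.length i := by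
  induction w with
  | nil => rfl
  | cons a w ih =>
    cases a with
    | none =>
      simp only [und_none_cons, List.reduceOption_cons_of_none, List.length_cons,
        Multiset.replicate_succ, ← Multiset.cons_coe, Multiset.cons_add, Multiset.add_cons, ih]
    | some a =>
      simp only [und_some_cons, List.reduceOption_cons_of_some, List.length_cons,
        Multiset.replicate_succ, ← Multiset.cons_coe, Multiset.cons_add, Multiset.add_cons, ih]

open Classical in
variable (k D ν i) in
/-- The coefficient with which a generator acts on vectors with values at marked words. -/
def coef (g : Gen I) (w : List (Option I)) : KLRAlg k D ν :=
  if und i w = g.top then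
    match g with
    | .e _ => 1
    | .x u _ _ =>
      match w.drop u.length with
      | a :: v => dotElt k D ν (w.take u.length) a v
      | [] => 0
    | .t u _ _ _ =>
      match w.drop u.length with
      | b :: a :: v => crossElt k D ν i (w.take u.length) a b v
      | _ => 0
  else 0

/-- The marked word at the bottom of a generating diagram with a marked word at its top. -/
def source (g : Gen I) (w : List (Option I)) : List (Option I) :=
  match g with
  | .t u _ _ _ =>
    match w.drop u.length with
    | b :: a :: v => w.take u.length ++ a :: b :: v
    | _ => w
  | _ => w

theorem coef_x (u : List (Option I)) (a : Option I) (v : List (Option I)) :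
    coef k D ν i (.x (und i u) (a.getD i) (und i v)) (u ++ a :: v) = dotElt k D ν u a v := by
  have h : (und i u).length = u.length := List.length_map _
  simp [coef, Gen.top, und_cons, h]

theorem coef_t (u : List (Option I)) (a b : Option I) (v : List (Option I)) :
    coef k D ν i (.t (und i u) (a.getD i) (b.getD i) (und i v)) (u ++ b :: a :: v)
      = crossElt k D ν i u a b v := by
  have h : (und i u).length = u.length := List.length_map _
  simp [coef, Gen.top, und_cons, h]

theorem source_t (u : List (Option I)) (a b : Option I) (v : List (Option I)) :
    source (.t (und i u) (a.getD i) (b.getD i) (und i v)) (u ++ b :: a :: v)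
      = u ++ a :: b :: v := by
  have h : (und i u).length = u.length := List.length_map _
  simp [source, h]

variable (k D ν i n) (K : Type u) [AddCommGroup K] [Module k K] [Module (KLRAlg k D ν) K]
  [IsScalarTower k (KLRAlg k D ν) K]

/-- The space underlying the module `Ind K ⊗ V(i^n)`: families of vectors of `K`, indexed by the
words with `n` marked letters. -/
def insertion : Submodule k (List (Option I) → K) where
  -- The first condition puts `f w` into the weight space of the unmarked letters of `w`, and the
  -- second kills it unless `w` has exactly `n` marks.
  carrier := {f | ∀ w, e k D ν w.reduceOption • f w = f w ∧
    (w.length ≠ w.reduceOption.length + n → f w = 0)}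
  add_mem' := fun {f g} hf hg w => by
    refine ⟨?_, fun h => ?_⟩
    · rw [Pi.add_apply, smul_add, (hf w).1, (hg w).1]
    · rw [Pi.add_apply, (hf w).2 h, (hg w).2 h, add_zero]
  zero_mem' := fun w => ⟨smul_zero _, fun _ => rfl⟩
  smul_mem' := fun c f hf w => by
    refine ⟨?_, fun h => ?_⟩
    · rw [Pi.smul_apply, smul_algebra_smul_comm, (hf w).1]
    · rw [Pi.smul_apply, (hf w).2 h, smul_zero]

variable {k D ν i n K}

theorem coef_eq_zero {g : Gen I} {w : List (Option I)} (h : und i w ≠ g.top) :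
    coef k D ν i g w = 0 := if_neg h

theorem coef_smul_mem {f : List (Option I) → K} (hf : f ∈ insertion k D ν n K) (g : Gen I) :
    (fun w => coef k D ν i g w • f (source g w)) ∈ insertion k D ν n K := by
  intro w
  by_cases h : und i w = g.top
  swap
  · simp [coef_eq_zero h]
  cases g with
  | e s =>
    have h1 : coef k D ν i (.e s) w = 1 := if_pos h
    simpa only [h1, one_smul, source] using hf w
  | x u j v =>
    obtain ⟨u, a, v, rfl, rfl, rfl, rfl⟩ := eq_append_cons_of_und h
    obtain ⟨h1, h2⟩ := hf (u ++ a :: v)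
    simp only [coef_x, source]
    refine ⟨?_, fun h => by rw [h2 h, smul_zero]⟩
    cases a with
    | none => simp [dotElt]
    | some a =>
      rw [← mul_smul, dotElt, List.reduceOption_append, List.reduceOption_cons_of_some, e_mul_x]
  | t u j l v =>
    obtain ⟨u, b, a, v, rfl, rfl, rfl, rfl, rfl⟩ := eq_append_cons_cons_of_und h
    obtain ⟨h1, h2⟩ := hf (u ++ a :: b :: v)
    simp only [coef_t, source_t]
    refine ⟨?_, fun h => ?_⟩
    · match a, b with
      | none, none => simp [crossElt]
      | some a, none => simpa [crossElt, List.reduceOption_append] using h1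
      | some a, some b =>
        rw [← mul_smul, crossElt, List.reduceOption_append, List.reduceOption_cons_of_some,
          List.reduceOption_cons_of_some, e_mul_t]
      | none, some b =>
        have h3 : Commute (e k D ν (u.reduceOption ++ b :: v.reduceOption))
            (x k D ν u.reduceOption b v.reduceOption) :=
          (e_mul_x _ _ _).trans (x_mul_e _ _ _).symm
        have h4 := (doubleElt_semiconj (i := i) h3).eq
        simp only [crossElt, List.reduceOption_append, List.reduceOption_cons_of_some,
          List.reduceOption_cons_of_none] at h1 ⊢
        rw [← mul_smul, h4, mul_smul, h1]
    · rw [h2, smul_zero]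
      match a, b with
      | none, none => simpa [List.reduceOption_append] using h
      | some a, none => simpa [List.reduceOption_append] using h
      | some a, some b => simpa [List.reduceOption_append] using h
      | none, some b => simpa [List.reduceOption_append] using h

variable (k D ν i n K) in
/-- The action of the generators on the module `insertion`. -/
def insertionGen (g : Gen I) : Module.End k (insertion k D ν n K) where
  toFun f := ⟨fun w => coef k D ν i g w • f.1 (source g w), coef_smul_mem f.2 g⟩
  map_add' _ _ := Subtype.ext (funext fun _ => smul_add _ _ _)
  map_smul' _ _ := Subtype.ext (funext fun _ => smul_algebra_smul_comm _ _ _)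

/-- `A` maps families of vectors to families whose value at `w` is the image under `c` of the value
at `w'`. -/
def ActsBy (A : Module.End k (insertion k D ν n K)) (w : List (Option I)) (c : KLRAlg k D ν)
    (w' : List (Option I)) : Prop := ∀ f, (A f).1 w = c • f.1 w'

/-- The image of `A` consists of families supported at the markings of `s`. -/
def SupportedAt (i : I) (A : Module.End k (insertion k D ν n K)) (s : List I) : Prop :=
  ∀ w, und i w ≠ s → ∀ f, (A f).1 w = 0

/-- Both sides of a defining relation take values at the markings of one and the same top word, so
only these markings have to be compared. -/
theorem SupportedAt.ext {A B : Module.End k (insertion k D ν n K)} {s s' : List I}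
    (hA : SupportedAt i A s) (hB : SupportedAt i B s')
    (h : ∀ w, und i w = s → ∀ f, (A f).1 w = (B f).1 w) (hs : s' = s := by first | rfl | assumption | (symm; assumption) | simp [Gen.top]) : A = B := by
  subst hs
  refine LinearMap.ext fun f => Subtype.ext (funext fun w => ?_)
  by_cases hw : und i w = s'
  · exact h w hw f
  · rw [hA w hw, hB w hw]

theorem supportedAt_gen (g : Gen I) :
    SupportedAt i (insertionGen k D ν i n K g) g.top := fun w hw f => by
  change coef k D ν i g w • f.1 _ = 0
  rw [coef_eq_zero hw, zero_smul]

theorem SupportedAt.mul {A : Module.End k (insertion k D ν n K)} {s : List I}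
    (hA : SupportedAt i A s) (B : Module.End k (insertion k D ν n K)) :
    SupportedAt i (A * B) s := fun w hw f => hA w hw (B f)

theorem SupportedAt.add {A B : Module.End k (insertion k D ν n K)} {s s' : List I}
    (hA : SupportedAt i A s) (hB : SupportedAt i B s') (hs : s' = s := by first | rfl | assumption | (symm; assumption) | simp [Gen.top]) :
    SupportedAt i (A + B) s := fun w hw f => by
  subst hs
  change (A f).1 w + (B f).1 w = 0
  rw [hA w hw, hB w hw, add_zero]

theorem SupportedAt.sum {ι : Type*} {t : Finset ι}
    {A : ι → Module.End k (insertion k D ν n K)} {s : List I}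
    (hA : ∀ c, SupportedAt i (A c) s) : SupportedAt i (∑ c ∈ t, A c) s := fun w hw f => by
  rw [LinearMap.sum_apply, Submodule.coe_sum, Finset.sum_apply]
  exact Finset.sum_eq_zero fun c _ => hA c w hw f

theorem SupportedAt.pow_mul {A B : Module.End k (insertion k D ν n K)} {s s' : List I}
    (hA : SupportedAt i A s) (hB : SupportedAt i B s') (c : ℕ) (hs : s' = s := by first | rfl | assumption | (symm; assumption) | simp [Gen.top]) :
    SupportedAt i (A ^ c * B) s := by
  subst hs
  cases c with
  | zero => simpa using hB
  | succ c => rw [pow_succ', mul_assoc]; exact hA.mul _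

theorem ActsBy.mul {A B : Module.End k (insertion k D ν n K)} {w w₁ w₂ w₃ : List (Option I)}
    {c d : KLRAlg k D ν} (hA : ActsBy A w c w₁) (hB : ActsBy B w₂ d w₃)
    (hw : w₂ = w₁ := by first | rfl | assumption | (symm; assumption) | simp [Gen.top]) : ActsBy (A * B) w (c * d) w₃ := fun f => by
  subst hw
  rw [mul_smul, ← hB, ← hA]; rfl

theorem ActsBy.pow {A : Module.End k (insertion k D ν n K)} {w : List (Option I)}
    {c : KLRAlg k D ν} (hA : ActsBy A w c w) (m : ℕ) : ActsBy (A ^ m) w (c ^ m) w := by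
  induction m with
  | zero => intro f; rw [pow_zero, pow_zero, one_smul]; rfl
  | succ m ih => rw [pow_succ, pow_succ]; exact ih.mul hA

theorem ActsBy.apply_eq {A B : Module.End k (insertion k D ν n K)}
    {w w₁ w₂ w₃ : List (Option I)} {c d : KLRAlg k D ν} (hA : ActsBy A w c w₁)
    (hB : ActsBy B w₂ d w₃) (hcd : c = d) (hw : w₂ = w := by first | rfl | assumption | (symm; assumption) | simp [Gen.top])
    (hw' : w₃ = w₁ := by first | rfl | assumption | (symm; assumption) | simp [Gen.top]) (f : insertion k D ν n K) : (A f).1 w = (B f).1 w := by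
  subst hw hw' hcd
  rw [hA, hB]

theorem ActsBy.apply {A : Module.End k (insertion k D ν n K)} {w w' w₀ w₁ : List (Option I)}
    {c : KLRAlg k D ν} (hA : ActsBy A w c w') (f : insertion k D ν n K)
    (hw : w₀ = w := by first | rfl | simp) (hw' : w₁ = w' := by first | rfl | simp) :
    (A f).1 w₀ = c • f.1 w₁ := by
  subst hw hw'
  exact hA f

theorem actsBy_e (w : List (Option I)) {s : List I} (hs : s = und i w := by first | rfl | assumption | (symm; assumption) | simp [und_cons]) :
    ActsBy (insertionGen k D ν i n K (.e s)) w 1 w := fun f => by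
  subst hs
  change coef k D ν i _ _ • _ = _
  congr 1
  exact if_pos rfl

theorem actsBy_x (u : List (Option I)) (a : Option I) (v : List (Option I)) {u' : List I} {j : I}
    {v' : List I} (hu : u' = und i u := by first | rfl | assumption | (symm; assumption) | simp [und_cons]) (ha : j = a.getD i := by first | rfl | assumption | (symm; assumption) | simp [Gen.top])
    (hv : v' = und i v := by first | rfl | assumption | (symm; assumption) | simp [und_cons]) :
    ActsBy (insertionGen k D ν i n K (.x u' j v')) (u ++ a :: v) (dotElt k D ν u a v)
      (u ++ a :: v) := fun f => by
  subst hu ha hv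
  rw [← coef_x (i := i)]; rfl

theorem actsBy_t (u : List (Option I)) (a b : Option I) (v : List (Option I)) {u' : List I}
    {j l : I} {v' : List I} (hu : u' = und i u := by first | rfl | assumption | (symm; assumption) | simp [und_cons])
    (ha : j = a.getD i := by first | rfl | assumption | (symm; assumption) | simp [Gen.top]) (hb : l = b.getD i := by first | rfl | assumption | (symm; assumption) | simp [Gen.top])
    (hv : v' = und i v := by first | rfl | assumption | (symm; assumption) | simp [und_cons]) :
    ActsBy (insertionGen k D ν i n K (.t u' j l v')) (u ++ b :: a :: v) (crossElt k D ν i u a b v)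
      (u ++ a :: b :: v) := fun f => by
  subst hu ha hb hv
  nth_rw 2 [← source_t (i := i)]
  rw [← coef_t]; rfl

theorem insertion_smul_eq (f : insertion k D ν n K) (w : List (Option I)) :
    e k D ν w.reduceOption • f.1 w = f.1 w := (f.2 w).1

/-- A nonzero value needs unmarked letters of content `ν` and exactly `n` marks. This makes
idempotents of the wrong content act by zero and the sum of the others by the identity. -/
theorem mem_words_of_insertion_ne_zero {f : insertion k D ν n K} {w : List (Option I)}
    (h : f.1 w ≠ 0) : und i w ∈ words (ν + Multiset.replicate n i) := by
  obtain ⟨h1, h2⟩ := f.2 w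
  have h3 : w.length = w.reduceOption.length + n := by
    by_contra h3; exact h (h2 h3)
  have h4 : (w.reduceOption : Multiset I) = ν := by
    by_contra h4
    rw [e_eq_zero h4, zero_smul] at h1
    exact h h1.symm
  have h5 := coe_und i w
  rw [h3, Multiset.replicate_add, h4, add_left_comm, add_comm] at h5
  rw [mem_words]
  exact add_left_cancel h5

/-- At a marking of the top word each product of generators acts by a product of coefficients, so
each relation reduces to the corresponding identity for `dotElt` and `crossElt`. In the real
relations, letters of real colour are necessarily unmarked. -/
theorem insertionGen_rel (hi : D.IsImaginary i) (a b : FreeAlgebra k (Gen I))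
    (h : Rel k D (ν + Multiset.replicate n i) a b) :
    FreeAlgebra.lift k (insertionGen k D ν i n K) a
      = FreeAlgebra.lift k (insertionGen k D ν i n K) b := by
  have hE : ∀ s, FreeAlgebra.lift k (insertionGen k D ν i n K) (fe k s)
      = insertionGen k D ν i n K (.e s) := fun s => FreeAlgebra.lift_ι_apply _ _
  have hX : ∀ u j v, FreeAlgebra.lift k (insertionGen k D ν i n K) (fx k u j v)
      = insertionGen k D ν i n K (.x u j v) := fun u j v => FreeAlgebra.lift_ι_apply _ _
  have hT : ∀ u j l v, FreeAlgebra.lift k (insertionGen k D ν i n K) (ft k u j l v)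
      = insertionGen k D ν i n K (.t u j l v) := fun u j l v => FreeAlgebra.lift_ι_apply _ _
  have hg := supportedAt_gen (k := k) (D := D) (ν := ν) (i := i) (n := n) (K := K)
  have h0 : ∀ s, SupportedAt i (0 : Module.End k (insertion k D ν n K)) s := fun s w _ f => rfl
  cases h with
  | e_content s h =>
    rw [hE, map_zero]
    refine (hg (.e s)).ext (h0 s) fun w hw f => ?_
    refine (actsBy_e (s := s) w hw.symm f).trans ?_
    rw [one_smul]
    by_contra hf
    have := mem_words_of_insertion_ne_zero (i := i) hf
    rw [show und i w = s from hw] at this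
    exact h (mem_words.1 this)
  | e_sum =>
    rw [map_sum, map_one]
    refine LinearMap.ext fun f => Subtype.ext (funext fun w => ?_)
    rw [LinearMap.sum_apply, Submodule.coe_sum, Finset.sum_apply]
    simp only [hE]
    by_cases hf : f.1 w = 0
    · refine (Finset.sum_eq_zero fun s _ => ?_).trans hf.symm
      by_cases hs : und i w = s
      · rw [actsBy_e w hs.symm f, hf, smul_zero]
      · exact hg (.e s) w hs f
    · refine (Finset.sum_eq_single_of_mem _ (mem_words_of_insertion_ne_zero (i := i) hf)
        fun s _ hs => hg (.e s) w (Ne.symm hs) f).trans ?_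
      rw [actsBy_e w rfl f, one_smul]; rfl
  | e_idem s =>
    simp only [map_mul, hE]
    refine ((hg _).mul _).ext (hg _) fun w hw => ?_
    exact ((actsBy_e w hw.symm).mul (actsBy_e w hw.symm)).apply_eq (actsBy_e w hw.symm) (one_mul 1)
  | e_orth s s' h =>
    simp only [map_mul, map_zero, hE]
    refine ((hg _).mul _).ext (h0 s) fun w hw f => ?_
    refine (actsBy_e w hw.symm _).trans ?_
    rw [hg (.e s') w (by rw [hw]; exact h) f, smul_zero]; rfl
  | e_x u j v =>
    simp only [map_mul, hE, hX]
    refine ((hg _).mul _).ext (hg _) fun w hw => ?_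
    obtain ⟨u, a, v, rfl, rfl, rfl, rfl⟩ := eq_append_cons_of_und hw
    exact ((actsBy_e _ hw.symm).mul (actsBy_x u a v)).apply_eq (actsBy_x u a v) (one_mul _)
  | x_e u j v =>
    simp only [map_mul, hE, hX]
    refine ((hg _).mul _).ext (hg _) fun w hw => ?_
    obtain ⟨u, a, v, rfl, rfl, rfl, rfl⟩ := eq_append_cons_of_und hw
    exact ((actsBy_x u a v).mul (actsBy_e (u ++ a :: v))).apply_eq (actsBy_x u a v) (mul_one _)
  | e_t u j l v =>
    simp only [map_mul, hE, hT]
    refine ((hg _).mul _).ext (hg _) fun w hw => ?_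
    obtain ⟨u, b, a, v, rfl, rfl, rfl, rfl, rfl⟩ := eq_append_cons_cons_of_und hw
    exact ((actsBy_e _ hw.symm).mul (actsBy_t u a b v)).apply_eq (actsBy_t u a b v) (one_mul _)
  | t_e u j l v =>
    simp only [map_mul, hE, hT]
    refine ((hg _).mul _).ext (hg _) fun w hw => ?_
    obtain ⟨u, b, a, v, rfl, rfl, rfl, rfl, rfl⟩ := eq_append_cons_cons_of_und hw
    exact ((actsBy_t u a b v).mul (actsBy_e (u ++ a :: b :: v))).apply_eq (actsBy_t u a b v)
      (mul_one _)
  | x_x u j v l z =>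
    simp only [map_mul, hX]
    refine ((hg _).mul _).ext ((hg _).mul _) (fun w hw => ?_)
    obtain ⟨u, a, w, rfl, rfl, rfl, hw'⟩ := eq_append_cons_of_und hw
    obtain ⟨v, b, z, rfl, rfl, rfl, rfl⟩ := eq_append_cons_of_und hw'
    exact ((actsBy_x u a (v ++ b :: z)).mul (actsBy_x (u ++ a :: v) b z)).apply_eq
      ((actsBy_x (u ++ a :: v) b z).mul (actsBy_x u a (v ++ b :: z)))
      (dotElt_mul_dotElt u a v b z)
  | x_t u j v l l' z =>
    simp only [map_mul, hX, hT]
    refine ((hg _).mul _).ext ((hg _).mul _) (fun w hw => ?_)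
    obtain ⟨u, a, w, rfl, rfl, rfl, hw'⟩ := eq_append_cons_of_und hw
    obtain ⟨v, c, b, z, rfl, rfl, rfl, rfl, rfl⟩ := eq_append_cons_cons_of_und hw'
    exact ((actsBy_x u a (v ++ c :: b :: z)).mul (actsBy_t (u ++ a :: v) b c z)).apply_eq
      ((actsBy_t (u ++ a :: v) b c z).mul (actsBy_x u a (v ++ b :: c :: z)))
      (dotElt_mul_crossElt u a v b c z)
  | t_x u l l' v j z =>
    simp only [map_mul, hX, hT]
    refine ((hg _).mul _).ext ((hg _).mul _) (fun w hw => ?_)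
    obtain ⟨w, a, z, rfl, hw', rfl, rfl⟩ := eq_append_cons_of_und hw
    obtain ⟨u, c, b, v, rfl, rfl, rfl, rfl, rfl⟩ := eq_append_cons_cons_of_und hw'
    exact ((actsBy_x (u ++ c :: b :: v) a z).mul (actsBy_t u b c (v ++ a :: z))).apply_eq
      ((actsBy_t u b c (v ++ a :: z)).mul (actsBy_x (u ++ b :: c :: v) a z))
      (dotElt_mul_crossElt' u b c v a z)
  | t_t u j l v j' l' z =>
    simp only [map_mul, hT]
    refine ((hg _).mul _).ext ((hg _).mul _) (fun w hw => ?_)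
    obtain ⟨u, b, a, w, rfl, rfl, rfl, rfl, hw'⟩ := eq_append_cons_cons_of_und hw
    obtain ⟨v, d, c, z, rfl, rfl, rfl, rfl, rfl⟩ := eq_append_cons_cons_of_und hw'
    exact ((actsBy_t u a b (v ++ d :: c :: z)).mul (actsBy_t (u ++ a :: b :: v) c d z)).apply_eq
      ((actsBy_t (u ++ b :: a :: v) c d z).mul (actsBy_t u a b (v ++ c :: d :: z)))
      (crossElt_mul_crossElt u a b v c d z)
  | sq_same u j v =>
    simp only [map_mul, map_zero, hT]
    refine ((hg _).mul _).ext (h0 (u ++ j :: j :: v)) fun w hw f => ?_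
    obtain ⟨u, a, b, v, rfl, rfl, rfl, hb, rfl⟩ := eq_append_cons_cons_of_und hw
    refine Eq.trans (ActsBy.apply ((actsBy_t u b a v).mul (actsBy_t u a b v)) f) ?_
    rw [crossElt_sq_same u a b v hb.symm, zero_smul]; rfl
  | sq_orth u j l v h h' =>
    simp only [map_mul, hT, hE]
    refine ((hg _).mul _).ext (hg _) fun w hw f => ?_
    obtain ⟨u, a, b, v, rfl, rfl, rfl, rfl, rfl⟩ := eq_append_cons_cons_of_und hw
    refine Eq.trans (ActsBy.apply ((actsBy_t u b a v).mul (actsBy_t u a b v)) f) ?_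
    refine (crossElt_sq_orth u a b v h h' (insertion_smul_eq f _)).trans ?_
    exact (one_smul _ _).symm.trans (ActsBy.apply (actsBy_e (u ++ a :: b :: v)) f).symm
  | sq_ne u j l v h h' =>
    simp only [map_mul, map_add, map_pow, hT, hE, hX]
    refine ((hg _).mul _).ext (((hg _).pow_mul (hg _) _).add ((hg _).pow_mul (hg _) _))
      (fun w hw f => ?_)
    obtain ⟨u, a, b, v, rfl, rfl, rfl, rfl, rfl⟩ := eq_append_cons_cons_of_und hw
    refine Eq.trans (ActsBy.apply ((actsBy_t u b a v).mul (actsBy_t u a b v)) f) ?_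
    rw [crossElt_sq_ne u a b v h h' (insertion_smul_eq f _)]
    refine congrArg₂ (· + ·) ?_ ?_
    · refine Eq.trans ?_ (ActsBy.apply ((ActsBy.pow (actsBy_x u a (b :: v)) _).mul
        (actsBy_e (u ++ a :: b :: v))) f).symm
      rw [mul_one]
    · refine Eq.trans ?_ (ActsBy.apply ((ActsBy.pow (actsBy_x (u ++ [a]) b v) _).mul
        (actsBy_e (u ++ a :: b :: v))) f).symm
      rw [mul_one]
  | real_left u j v h =>
    simp only [map_mul, map_add, hT, hE, hX]
    refine ((hg _).mul _).ext (((hg _).mul _).add (hg _)) fun w hw f => ?_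
    obtain ⟨u, b, a, v, rfl, rfl, rfl, hab, rfl⟩ := eq_append_cons_cons_of_und hw
    obtain rfl : a = b := by
      rw [eq_some_of_isReal hi (a := a) (hab ▸ h), eq_some_of_isReal hi (a := b) h, hab]
    refine Eq.trans (ActsBy.apply ((actsBy_x u a (a :: v)).mul (actsBy_t u a a v)) f) ?_
    refine (dotElt_mul_crossElt_real u a a v hi rfl h (insertion_smul_eq f _)).trans ?_
    exact congrArg₂ (· + ·)
      (ActsBy.apply ((actsBy_t u a a v).mul (actsBy_x (u ++ [a]) a v)) f).symm
      ((one_smul _ _).symm.trans (ActsBy.apply (actsBy_e (u ++ a :: a :: v)) f).symm)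
  | real_right u j v h =>
    simp only [map_mul, map_add, hT, hE, hX]
    refine ((hg _).mul _).ext (((hg _).mul _).add (hg _)) fun w hw f => ?_
    obtain ⟨u, b, a, v, rfl, rfl, rfl, hab, rfl⟩ := eq_append_cons_cons_of_und hw
    obtain rfl : a = b := by
      rw [eq_some_of_isReal hi (a := a) (hab ▸ h), eq_some_of_isReal hi (a := b) h, hab]
    refine Eq.trans (ActsBy.apply ((actsBy_t u a a v).mul (actsBy_x u a (a :: v))) f) ?_
    refine (crossElt_mul_dotElt_real u a a v hi rfl h (insertion_smul_eq f _)).trans ?_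
    exact congrArg₂ (· + ·)
      (ActsBy.apply ((actsBy_x (u ++ [a]) a v).mul (actsBy_t u a a v)) f).symm
      ((one_smul _ _).symm.trans (ActsBy.apply (actsBy_e (u ++ a :: a :: v)) f).symm)
  | slide_left u j l v h =>
    simp only [map_mul, hT, hX]
    refine ((hg _).mul _).ext ((hg _).mul _) fun w hw => ?_
    obtain ⟨u, b, a, v, rfl, rfl, rfl, rfl, rfl⟩ := eq_append_cons_cons_of_und hw
    exact ((actsBy_x u b (a :: v)).mul (actsBy_t u a b v)).apply_eq
      ((actsBy_t u a b v).mul (actsBy_x (u ++ [a]) b v)) (dotElt_mul_crossElt_slide u a b v h)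
  | slide_right u j l v h =>
    simp only [map_mul, hT, hX]
    refine ((hg _).mul _).ext ((hg _).mul _) (fun w hw => ?_)
    obtain ⟨u, b, a, v, rfl, rfl, rfl, rfl, rfl⟩ := eq_append_cons_cons_of_und hw
    exact ((actsBy_t u a b v).mul (actsBy_x u a (b :: v))).apply_eq
      ((actsBy_x (u ++ [b]) a v).mul (actsBy_t u a b v)) (crossElt_mul_dotElt_slide u a b v h)
  | braid_real u j l v h h' h'' =>
    simp only [map_mul, map_add, map_sum, map_pow, hT, hE, hX]
    refine (((hg _).mul _).mul _).ext ((((hg _).mul _).mul _).add (.sum fun c => by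
      rw [mul_assoc]; exact (hg _).pow_mul ((hg _).pow_mul (hg _) _) _)) fun w hw f => ?_
    obtain ⟨u, c, b, w, rfl, rfl, hc, rfl, hw'⟩ := eq_append_cons_cons_of_und hw
    obtain ⟨a, v, rfl, ha, rfl⟩ := eq_cons_of_und hw'
    obtain rfl : a = c := by
      rw [eq_some_of_isReal hi (a := a) (ha ▸ h), eq_some_of_isReal hi (a := c) (hc ▸ h), ha, hc]
    subst ha
    refine Eq.trans (ActsBy.apply (((actsBy_t u b a (a :: v)).mul (actsBy_t (u ++ [b]) a a v)).mul
      (actsBy_t u a b (a :: v))) f) ?_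
    refine (crossElt_braid_real u a b a v hi rfl h h' h'' (insertion_smul_eq f _)).trans ?_
    refine congrArg₂ (· + ·) (ActsBy.apply (((actsBy_t (u ++ [a]) a b v).mul
      (actsBy_t u a a (b :: v))).mul (actsBy_t (u ++ [a]) b a v)) f).symm ?_
    rw [LinearMap.sum_apply, Submodule.coe_sum, Finset.sum_apply]
    refine Finset.sum_congr rfl fun d _ => ?_
    refine Eq.trans ?_ (ActsBy.apply (((ActsBy.pow (actsBy_x u a (b :: a :: v)) d).mul
      (ActsBy.pow (actsBy_x (u ++ [a, b]) a v) _)).mul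
      (actsBy_e (u ++ a :: b :: a :: v))) f).symm
    rw [mul_one]
  | braid u j l m v h =>
    simp only [map_mul, hT]
    refine (((hg _).mul _).mul _).ext (((hg _).mul _).mul _) (fun w hw => ?_)
    obtain ⟨u, c, b, w, rfl, rfl, rfl, rfl, hw'⟩ := eq_append_cons_cons_of_und hw
    obtain ⟨a, v, rfl, rfl, rfl⟩ := eq_cons_of_und hw'
    exact (((actsBy_t u b c (a :: v)).mul (actsBy_t (u ++ [b]) a c v)).mul
      (actsBy_t u a b (c :: v))).apply_eq
      (((actsBy_t (u ++ [c]) a b v).mul (actsBy_t u a c (b :: v))).mul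
        (actsBy_t (u ++ [a]) b c v)) (crossElt_braid u a b c v hi h)

end InsertionModule

end KLR


/-! The highest vectors of the insertion module -/

/-- The marked word whose unmarked letters are those of `s`, followed by `n` marked letters. -/
def markTail {I : Type u} (s : List I) (n : ℕ) : List (Option I) :=
  s.map some ++ List.replicate n none

@[simp] theorem reduceOption_markTail {I : Type u} (s : List I) (n : ℕ) :
    (markTail s n).reduceOption = s := by
  simp [markTail, List.reduceOption_append, List.reduceOption_replicate_none]

@[simp] theorem und_markTail {I : Type u} (i : I) (s : List I) (n : ℕ) :
    und i (markTail s n) = s ++ List.replicate n i := by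
  simp [markTail]

theorem markTail_append_cons {I : Type u} (u : List I) (j : I) (v : List I) (n : ℕ) :
    markTail (u ++ j :: v) n = u.map some ++ some j :: markTail v n := by
  simp [markTail]

theorem markTail_append_cons_cons {I : Type u} (u : List I) (j l : I) (v : List I) (n : ℕ) :
    markTail (u ++ j :: l :: v) n = u.map some ++ some j :: some l :: markTail v n := by
  simp [markTail]

theorem _root_.Borcherds.Gen.top_place {I : Type u} (g : Gen I) (l r : List I) :
    (g.place l r).top = l ++ (g.top ++ r) := by
  cases g <;> simp [Gen.place, Gen.top]

/-- A letter of `markTail s n` behind those of `s` is marked. -/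
theorem markTail_letter {I : Type u} {i : I} {u' : List (Option I)} {a : Option I}
    {v' : List (Option I)} {s l u v : List I} {j : I} {n : ℕ}
    (h : u' ++ a :: v' = markTail s n) (hu : und i u' = l ++ u) (hv : a.getD i :: und i v' = j :: v)
    (huv : u ++ j :: v = List.replicate n i) : a = none := by
  have h1 := congrArg (und i) h
  rw [und_markTail, und_append, und_cons, hu, hv, List.append_assoc, huv] at h1
  obtain rfl := List.append_cancel_right h1
  have hn := congrArg List.length huv
  simp only [List.length_append, List.length_cons, List.length_replicate] at hn
  have hl := congrArg List.length hu
  simp only [und, List.length_map, List.length_append] at hl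
  rw [markTail, show n = u.length + (v.length + 1) by omega, List.replicate_add,
    List.replicate_succ, ← List.append_assoc] at h
  exact (List.cons.inj (List.append_inj h (by simp [hl])).2).1

namespace KLR

section HighestVectors

variable {k : Type u} [Field k] {I : Type u} {D : BorcherdsCartan I} {ν : Multiset I} {i : I}
  {n : ℕ}

theorem e_mul_gen_of_ne {κ : Multiset I} {s : List I} {g : Gen I} (h : s ≠ g.top) :
    e k D κ s * gen k D κ g = 0 := by
  have h1 := e_mul_gen (k := k) (D := D) (κ := κ) g [] []
  have h2 : g.place [] [] = g := by cases g <;> simp [Gen.place]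
  rw [h2, List.nil_append, List.append_nil] at h1
  rw [← h1, ← mul_assoc, e_mul_e_of_ne h, zero_mul]

theorem e_top_mul_gen {κ : Multiset I} (g : Gen I) :
    e k D κ g.top * gen k D κ g = gen k D κ g := by
  have h1 := e_mul_gen (k := k) (D := D) (κ := κ) g [] []
  have h2 : g.place [] [] = g := by cases g <;> simp [Gen.place]
  rwa [h2, List.nil_append, List.append_nil] at h1

variable (k D ν i n) (K : Type u) [AddCommGroup K] [Module k K] [Module (KLRAlg k D ν) K]
  [IsScalarTower k (KLRAlg k D ν) K]

/-- The action of `R(ν + ni)` on the module `insertion`. -/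
def insertionHom (hi : D.IsImaginary i) :
    KLRAlg k D (ν + Multiset.replicate n i) →ₐ[k] Module.End k (insertion k D ν n K) :=
  lift (insertionGen k D ν i n K) (insertionGen_rel hi)

open Classical in
/-- The embedding of `K` in the module `insertion`. -/
def insertionTop : K →ₗ[k] insertion k D ν n K where
  toFun x := ⟨fun w => if w = markTail w.reduceOption n then e k D ν w.reduceOption • x else 0,
    fun w => by
      dsimp only
      split_ifs with h
      · refine ⟨by rw [← mul_smul, e_mul_e], fun h' => absurd ?_ h'⟩
        have := congrArg List.length h
        simpa [markTail] using this
      · exact ⟨smul_zero _, fun _ => rfl⟩⟩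
  map_add' x y := Subtype.ext (funext fun w => by
    change (if w = markTail w.reduceOption n then _ else (0 : K)) = (if w = markTail w.reduceOption n then _ else (0 : K))
      + (if w = markTail w.reduceOption n then _ else (0 : K))
    split_ifs
    · rw [smul_add]
    · rw [add_zero])
  map_smul' c x := Subtype.ext (funext fun w => by
    change (if w = markTail w.reduceOption n then _ else (0 : K))
      = c • (if w = markTail w.reduceOption n then _ else (0 : K))
    split_ifs
    · rw [smul_algebra_smul_comm]
    · rw [smul_zero])

variable {k D ν i n K}

theorem insertionTop_markTail (x : K) (s : List I) :
    (insertionTop k D ν n K x).1 (markTail s n) = e k D ν s • x := by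
  refine (if_pos (by rw [reduceOption_markTail])).trans ?_
  rw [reduceOption_markTail]

theorem insertionTop_eq_zero (x : K) {w : List (Option I)} (h : ∀ s, w ≠ markTail s n) :
    (insertionTop k D ν n K x).1 w = 0 := if_neg (h _)

theorem exists_insertionTop_ne_zero [Nontrivial K] : ∃ x, insertionTop k D ν n K x ≠ 0 := by
  obtain ⟨x, hx⟩ := exists_ne (0 : K)
  refine ⟨x, fun h => hx ?_⟩
  rw [← one_smul (KLRAlg k D ν) x, ← sum_e, Finset.sum_smul]
  refine Finset.sum_eq_zero fun s _ => ?_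
  rw [← insertionTop_markTail (n := n), h]
  rfl

/-- When all marks are at the end, diagrams on the left strands meet unmarked letters only and act
as in `R(ν)`. -/
theorem insertionGen_place_left (g : Gen I) (x : K) :
    insertionGen k D ν i n K (g.place [] (List.replicate n i)) (insertionTop k D ν n K x)
      = insertionTop k D ν n K (gen k D ν g • x) := by
  refine Subtype.ext (funext fun w => ?_)
  have htop : (g.place [] (List.replicate n i)).top = g.top ++ List.replicate n i :=
    Gen.top_place _ _ _
  by_cases hs : ∃ s, w = markTail s n
  · obtain ⟨s, rfl⟩ := hs
    rw [insertionTop_markTail, ← mul_smul]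
    by_cases hg : s = g.top
    · subst hg
      rw [e_top_mul_gen]
      cases g with
      | e s =>
        refine (ActsBy.apply (actsBy_e (markTail s n) (by simp)) _).trans ?_
        rw [one_smul, insertionTop_markTail]; rfl
      | x u j v =>
        simp only [Gen.place, Gen.top, List.nil_append]
        have := ActsBy.apply (actsBy_x (k := k) (D := D) (ν := ν) (i := i) (n := n) (K := K)
          (u.map some) (some j) (markTail v n) (u' := u) (j := j)
          (v' := v ++ List.replicate n i) (by simp) rfl (by simp)) (insertionTop k D ν n K x)
        rw [← markTail_append_cons] at this
        rw [this, insertionTop_markTail, ← mul_smul, dotElt]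
        simp only [reduceOption_map_some, reduceOption_markTail]
        rw [x_mul_e]; rfl
      | t u j l v =>
        simp only [Gen.place, Gen.top, List.nil_append]
        have := ActsBy.apply (actsBy_t (k := k) (D := D) (ν := ν) (i := i) (n := n) (K := K)
          (u.map some) (some j) (some l) (markTail v n) (u' := u) (j := j) (l := l)
          (v' := v ++ List.replicate n i) (by simp) rfl rfl (by simp)) (insertionTop k D ν n K x)
        rw [← markTail_append_cons_cons, ← markTail_append_cons_cons] at this
        rw [this, insertionTop_markTail, ← mul_smul, crossElt]
        simp only [reduceOption_map_some, reduceOption_markTail]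
        rw [t_mul_e]; rfl
    · rw [e_mul_gen_of_ne hg, zero_smul]
      refine supportedAt_gen _ _ (fun h => hg ?_) _
      rw [htop, und_markTail] at h
      exact List.append_cancel_right h
  -- A crossing within the left part cannot carry another marking into one with all marks at the
  -- end, so both sides vanish here.
  · push Not at hs
    rw [insertionTop_eq_zero _ hs]
    by_cases hw : und i w = (g.place [] (List.replicate n i)).top
    swap
    · exact supportedAt_gen _ _ hw _
    refine (congrArg (_ • ·) (insertionTop_eq_zero x fun s hs' => ?_)).trans (smul_zero _)
    cases g with
    | e s' => exact hs s hs'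
    | x u j v => exact hs s hs'
    | t u j l v =>
      simp only [Gen.place, Gen.top, List.nil_append] at hw
      obtain ⟨u', b, a, v', rfl, hu, rfl, rfl, hv⟩ := eq_append_cons_cons_of_und hw
      simp only [Gen.place, List.nil_append] at hs'
      rw [← hu, ← hv, source_t] at hs'
      have h1 := congrArg (und i) hs'
      rw [und_markTail, und_append, und_cons, und_cons, hu, hv] at h1
      have h2 : u ++ a.getD i :: b.getD i :: v = s :=
        List.append_cancel_right (bs := List.replicate n i) (by simpa using h1)
      rw [← h2, markTail_append_cons_cons] at hs'
      have hl := congrArg List.length hu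
      simp only [und, List.length_map] at hl
      obtain ⟨rfl, h3⟩ := List.append_inj hs' (by simp [hl])
      simp only [List.cons.injEq] at h3
      obtain ⟨h4, h5, rfl⟩ := h3
      exact hs (u ++ b.getD i :: a.getD i :: v)
        (by rw [markTail_append_cons_cons, ← h4, ← h5])

/-- Wherever the family is nonzero, the last `n` letters are marked, and a dot on a marked strand
has coefficient `0`. The same applies to crossings of two marked strands in `insertionGen_t_right`.
-/
theorem insertionGen_x_right {l u v : List I} {j : I} (h : u ++ j :: v = List.replicate n i)
    (x : K) : insertionGen k D ν i n K (.x (l ++ u) j v) (insertionTop k D ν n K x) = 0 := by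
  refine Subtype.ext (funext fun w => ?_)
  by_cases hw : und i w = (Gen.x (l ++ u) j v).top
  swap
  · exact supportedAt_gen _ _ hw _
  obtain ⟨u', a, v', rfl, hu, rfl, rfl⟩ := eq_append_cons_of_und hw
  refine (ActsBy.apply (actsBy_x u' a v') _).trans ?_
  by_cases hs : ∃ s, u' ++ a :: v' = markTail s n
  · obtain ⟨s, hs⟩ := hs
    obtain rfl := markTail_letter hs hu rfl h
    rw [dotElt, zero_smul]; rfl
  · push Not at hs
    rw [insertionTop_eq_zero _ hs, smul_zero]; rfl

theorem insertionGen_t_right {l u v : List I} {j m : I}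
    (h : u ++ j :: m :: v = List.replicate n i) (x : K) :
    insertionGen k D ν i n K (.t (l ++ u) j m v) (insertionTop k D ν n K x) = 0 := by
  refine Subtype.ext (funext fun w => ?_)
  by_cases hw : und i w = (Gen.t (l ++ u) j m v).top
  swap
  · exact supportedAt_gen _ _ hw _
  obtain ⟨u', b, a, v', rfl, hu, rfl, rfl, rfl⟩ := eq_append_cons_cons_of_und hw
  refine (ActsBy.apply (actsBy_t u' a b v') _).trans ?_
  by_cases hs : ∃ s, u' ++ a :: b :: v' = markTail s n
  · obtain ⟨s, hs⟩ := hs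
    obtain rfl := markTail_letter hs hu rfl h
    obtain rfl := markTail_letter (i := i) (l := l) (u' := u' ++ [none]) (u := u ++ [i]) (a := b)
      (v' := v') (s := s) (by simpa using hs) (by simp [hu]) rfl (by simpa using h)
    rw [crossElt, zero_smul]; rfl
  · push Not at hs
    rw [insertionTop_eq_zero _ hs, smul_zero]; rfl

variable (hi : D.IsImaginary i)

theorem insertionHom_midL (a : KLRAlg k D ν) (x : K) :
    insertionHom k D ν i n K hi (midL k D ν i n a) (insertionTop k D ν n K x)
      = insertionTop k D ν n K (a • x) := by
  have hg : ∀ g x, insertionHom k D ν i n K hi (midL k D ν i n (gen k D ν g))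
      (insertionTop k D ν n K x) = insertionTop k D ν n K (gen k D ν g • x) := fun g x => by
    rw [midL_gen, insertionHom, lift_gen, insertionGen_place_left]
  induction a using gen_induction generalizing x with
  | hone c =>
    rw [Algebra.algebraMap_eq_smul_one, map_smul, map_smul, ← sum_e, map_sum, map_sum,
      LinearMap.smul_apply, LinearMap.sum_apply, smul_assoc, map_smul, Finset.sum_smul, map_sum]
    exact congrArg (c • ·) (Finset.sum_congr rfl fun s _ => hg (.e s) x)
  | hgen g => exact hg g x
  | hadd a b ha hb => rw [map_add, map_add, LinearMap.add_apply, ha, hb, add_smul, map_add]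
  | hmul a b ha hb => rw [midL_mul, map_mul, Module.End.mul_apply, hb, ha, mul_smul]

theorem insertionHom_midR (b : KLRAlg k D (Multiset.replicate n i)) (x : K) :
    insertionHom k D ν i n K hi (midR k D ν i n b) (insertionTop k D ν n K x)
      = trivHom k hi n b • insertionTop k D ν n K x := by
  have h1 : insertionHom k D ν i n K hi (midR k D ν i n 1) (insertionTop k D ν n K x)
      = insertionTop k D ν n K x := by
    rw [midR_one, ← midL_one, insertionHom_midL, one_smul]
  induction b using gen_induction with
  | hone c =>
    rw [Algebra.algebraMap_eq_smul_one, map_smul, map_smul, LinearMap.smul_apply, h1, map_smul,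
      map_one, smul_assoc, one_smul]
  | hgen g =>
    by_cases hc : (g.bot : Multiset I) = Multiset.replicate n i
    swap
    · rw [gen_eq_zero hc, map_zero, map_zero, map_zero, zero_smul]; rfl
    have hb : g.bot = List.replicate n i := mem_words_replicate.1 (mem_words.2 hc)
    have ht : trivHom k hi n (gen k D _ g) = trivGen k (Multiset.replicate n i) g :=
      lift_gen _ _ _
    cases g with
    | e s =>
      have : (gen k D (Multiset.replicate n i) (.e s)) = 1 := by
        rw [← sum_e, words_replicate, Finset.sum_singleton, ← hb]; rfl
      rw [this, h1, map_one, one_smul]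
    | x u j v =>
      rw [ht, midR_gen, map_sum, LinearMap.sum_apply]
      refine (Finset.sum_eq_zero fun l _ => ?_).trans (zero_smul k _).symm
      rw [insertionHom, lift_gen, Gen.place, List.append_nil, insertionGen_x_right hb]
    | t u j l v =>
      rw [ht, midR_gen, map_sum, LinearMap.sum_apply]
      refine (Finset.sum_eq_zero fun l _ => ?_).trans (zero_smul k _).symm
      rw [insertionHom, lift_gen, Gen.place, List.append_nil, insertionGen_t_right hb]
  | hadd a b ha hb => rw [map_add, map_add, map_add, LinearMap.add_apply, ha, hb, add_smul]
  | hmul a b ha hb =>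
    rw [midR_mul, map_mul, map_mul, Module.End.mul_apply, hb, map_smul, ha, mul_smul,
      smul_comm]

end HighestVectors

end KLR


/-! The modules `V(i^μ)` -/

section Levi

variable {k : Type u} [Field k] {I : Type u} {D : BorcherdsCartan I}

/-- A pure tensor in `R(ν₁) ⊗ ⋯ ⊗ R(νᵣ)`. -/
def leviTmul {ν : Multiset I} {L : List (Multiset I)} (r : KLRAlg k D ν) (b : levi k D L) :
    levi k D (ν :: L) := (r ⊗ₜ[k] b : KLRAlg k D ν ⊗[k] levi k D L)

theorem levi_induction {ν : Multiset I} {L : List (Multiset I)} {p : levi k D (ν :: L) → Prop}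
    (hzero : p 0) (hadd : ∀ a b, p a → p b → p (a + b)) (htmul : ∀ r b, p (leviTmul r b))
    (a : levi k D (ν :: L)) : p a :=
  TensorProduct.induction_on (R := k) (M := klr k D ν) (N := levi k D L) (motive := p) a hzero
    htmul hadd

theorem leviEmb_leviTmul {ν ν' κ : Multiset I} {L : List (Multiset I)} (h : (ν :: L).sum = κ)
    (h' : L.sum = ν') (hl : 0 + ν + ν' = κ) (hr : ν + ν' + 0 = κ) (r : KLRAlg k D ν)
    (b : levi k D L) :
    leviEmb k D (ν :: L) κ h (leviTmul r b)
      = KLR.mid k D hl r * KLR.mid k D hr (leviEmb k D L ν' h' b) := by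
  subst h'
  rfl

namespace KLR

theorem mid_zero_zero {ν : Multiset I} (h : 0 + ν + 0 = ν) (a : KLRAlg k D ν) :
    mid k D h a = a := by
  have hg : ∀ g, mid k D h (gen k D ν g) = gen k D ν g := fun g => by
    rw [mid_gen, midGen, words_zero]
    cases g <;> simp [Gen.place]
  induction a using gen_induction with
  | hone c =>
    rw [Algebra.algebraMap_eq_smul_one, map_smul, ← sum_e, map_sum]
    exact congrArg (c • ·) (Finset.sum_congr rfl fun s _ => hg (.e s))
  | hgen g => exact hg g
  | hadd a b ha hb => rw [map_add, ha, hb]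
  | hmul a b ha hb => rw [mid_mul, ha, hb]

variable {i : I} {p m q N : ℕ} {α β : Multiset I}

theorem one_eq_e_replicate :
    (1 : KLRAlg k D (Multiset.replicate m i)) = gen k D _ (.e (List.replicate m i)) := by
  rw [← sum_e, words_replicate, Finset.sum_singleton]; rfl

/-- The contents `α` and `β` are given up to equality so that `0`, as a power of `i` with exponent
`0`, is included. -/
theorem mid_replicate_gen (hα : α = Multiset.replicate p i) (hβ : β = Multiset.replicate q i)
    (h : α + Multiset.replicate m i + β = Multiset.replicate N i) (g : Gen I) :
    mid k D h (gen k D _ g) = gen k D _ (g.place (List.replicate p i) (List.replicate q i)) := by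
  subst hα hβ
  rw [mid_gen, midGen, words_replicate, words_replicate]
  simp

theorem eq_add_of_replicate (hα : α = Multiset.replicate p i) (hβ : β = Multiset.replicate q i)
    (h : α + Multiset.replicate m i + β = Multiset.replicate N i) : N = p + m + q := by
  subst hα hβ
  simpa using (congrArg Multiset.card h).symm

/-- With a single colour there is only one word of each content, so horizontal juxtaposition is
unital. -/
theorem mid_replicate_one (hα : α = Multiset.replicate p i) (hβ : β = Multiset.replicate q i)
    (h : α + Multiset.replicate m i + β = Multiset.replicate N i) :
    mid k D h (1 : KLRAlg k D (Multiset.replicate m i)) = 1 := by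
  obtain rfl := eq_add_of_replicate hα hβ h
  rw [one_eq_e_replicate, one_eq_e_replicate, mid_replicate_gen hα hβ, Gen.place,
    List.replicate_append_replicate, List.replicate_append_replicate, add_assoc]

theorem trivHom_gen (hi : D.IsImaginary i) (g : Gen I) :
    trivHom k hi m (gen k D _ g) = trivGen k (Multiset.replicate m i) g := lift_gen _ _ _

/-- The restriction of `V(i^N)` to a block of `m` adjacent strands is `V(i^m)`. -/
theorem trivHom_mid (hi : D.IsImaginary i) (hα : α = Multiset.replicate p i)
    (hβ : β = Multiset.replicate q i)
    (h : α + Multiset.replicate m i + β = Multiset.replicate N i)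
    (a : KLRAlg k D (Multiset.replicate m i)) :
    trivHom k hi N (mid k D h a) = trivHom k hi m a := by
  obtain rfl := eq_add_of_replicate hα hβ h
  induction a using gen_induction with
  | hone c =>
    rw [Algebra.algebraMap_eq_smul_one, map_smul, map_smul, map_smul, mid_replicate_one hα hβ,
      map_one, map_one]
  | hadd a b ha hb => rw [map_add, map_add, map_add, ha, hb]
  | hmul a b ha hb => rw [mid_mul, map_mul, map_mul, ha, hb]
  | hgen g =>
    by_cases hc : (g.bot : Multiset I) = Multiset.replicate m i
    swap
    · rw [gen_eq_zero hc, map_zero, map_zero, map_zero]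
    have hb : g.bot = List.replicate m i := mem_words_replicate.1 (mem_words.2 hc)
    cases g with
    | e s =>
      obtain rfl : s = _ := hb
      rw [← one_eq_e_replicate, mid_replicate_one hα hβ, map_one, map_one]
    | x u j v =>
      rw [mid_replicate_gen hα hβ, trivHom_gen, trivHom_gen]
      rfl
    | t u j l v =>
      rw [mid_replicate_gen hα hβ, trivHom_gen, trivHom_gen]
      rfl

theorem mid_tailX (hα : α = Multiset.replicate p i) (hβ : β = Multiset.replicate q i)
    (h : α + Multiset.replicate m i + β = Multiset.replicate N i) {c : ℕ} (hc : c < m) :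
    mid k D h (tailX k D i m c) = tailX k D i N (p + c) := by
  obtain rfl := eq_add_of_replicate hα hβ h
  unfold tailX x
  rw [mid_replicate_gen hα hβ, Gen.place, List.replicate_append_replicate,
    List.replicate_append_replicate]
  congr 3
  omega

end KLR

variable {i : I}

/-- The sequence `(μ₁ i, …, μᵣ i)`. -/
abbrev leviSeq (i : I) (μ : List ℕ) : List (Multiset I) := μ.map fun m => Multiset.replicate m i

theorem sum_leviSeq {μ : List ℕ} {n : ℕ} (h : μ.sum = n) :
    (leviSeq i μ).sum = Multiset.replicate n i := by
  rw [leviSeq, sum_map_replicate, h]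

theorem leviEmb_leviSeq_cons {m n : ℕ} {μ : List ℕ} (h : m + μ.sum = n)
    (hs : (leviSeq i (m :: μ)).sum = Multiset.replicate n i)
    (r : KLRAlg k D (Multiset.replicate m i)) (b : levi k D (leviSeq i μ)) :
    leviEmb k D (leviSeq i (m :: μ)) (Multiset.replicate n i) hs (leviTmul r b)
      = KLR.mid k D (α := 0) (β := Multiset.replicate μ.sum i)
          (by rw [zero_add, ← h, Multiset.replicate_add]) r
        * KLR.mid k D (α := Multiset.replicate m i) (β := 0)
          (by rw [add_zero, ← h, Multiset.replicate_add])
          (leviEmb k D (leviSeq i μ) (Multiset.replicate μ.sum i) (sum_leviSeq rfl) b) :=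
  leviEmb_leviTmul _ _ _ _ _ _

theorem leviEmb_leviSeq_one : ∀ (μ : List ℕ) {n : ℕ} (_ : μ.sum = n)
    (hs : (leviSeq i μ).sum = Multiset.replicate n i),
    leviEmb k D (leviSeq i μ) (Multiset.replicate n i) hs 1 = 1
  | [], _, _, _ => map_one (algebraMap k _)
  | m :: μ, n, h, hs => by
    refine (leviEmb_leviSeq_cons (k := k) (D := D) (by simpa using h) hs 1 1).trans ?_
    rw [leviEmb_leviSeq_one μ rfl,
      KLR.mid_replicate_one (p := 0) (by simp) rfl, KLR.mid_replicate_one (q := 0) rfl (by simp),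
      one_mul]

/-- A dot involves one strand and so belongs to a single block of `μ`, whereas a crossing may join
two blocks. For this reason only the dots of `R(ni)` are known to kill the generators of `Ind K ⊗
V(i^μ)`. -/
theorem exists_leviEmb_eq_tailX : ∀ (μ : List ℕ) {n : ℕ} (_ : μ.sum = n)
    (hs : (leviSeq i μ).sum = Multiset.replicate n i) (c : ℕ),
    ∃ b, leviEmb k D (leviSeq i μ) (Multiset.replicate n i) hs b = KLR.tailX k D i n c
  | [], n, h, hs, c => ⟨0, by
      obtain rfl : 0 = n := h
      rw [map_zero, KLR.tailX_eq_zero (Nat.zero_le c)]⟩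
  | m :: μ, n, h, hs, c => by
    rw [List.sum_cons] at h
    by_cases hc : c < m
    · refine ⟨leviTmul (KLR.tailX k D i m c) 1, ?_⟩
      rw [leviEmb_leviSeq_cons h, leviEmb_leviSeq_one μ rfl, KLR.mid_tailX (p := 0) (by simp) rfl _ hc,
        KLR.mid_replicate_one (q := 0) rfl (by simp), mul_one, zero_add]
    · obtain ⟨c, rfl⟩ : ∃ c', c = m + c' := ⟨c - m, by omega⟩
      by_cases hc' : c < μ.sum
      · obtain ⟨b, hb⟩ := exists_leviEmb_eq_tailX μ rfl (sum_leviSeq rfl) c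
        refine ⟨leviTmul 1 b, ?_⟩
        rw [leviEmb_leviSeq_cons h, hb, KLR.mid_tailX (q := 0) rfl (by simp) _ hc',
          KLR.mid_replicate_one (p := 0) (by simp) rfl, one_mul]
      · exact ⟨0, by rw [map_zero, KLR.tailX_eq_zero (by omega)]⟩

/-- For the composition `(n)` all of `R(ni)`, crossings included, therefore acts on the generators
through the trivial character. -/
theorem leviEmb_singleton_surjective {n : ℕ} (hs : (leviSeq i [n]).sum = Multiset.replicate n i) :
    Function.Surjective (leviEmb k D (leviSeq i [n]) (Multiset.replicate n i) hs) := fun y => by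
  refine ⟨leviTmul y 1, ?_⟩
  rw [leviEmb_leviSeq_cons (by simp), leviEmb_leviSeq_one [] rfl,
    KLR.mid_replicate_one (q := 0) rfl (by simp), mul_one]
  exact KLR.mid_zero_zero _ y

variable (k) (hi : D.IsImaginary i)

/-- `V(i^μ)` is one-dimensional. -/
def vmuEquiv : ∀ μ : List ℕ, Vmu k hi μ ≃ₗ[k] k
  | [] => LinearEquiv.refl k k
  | _ :: μ => (TensorProduct.congr (LinearEquiv.refl k k) (vmuEquiv μ) :
      k ⊗[k] Vmu k hi μ ≃ₗ[k] k ⊗[k] k) ≪≫ₗ TensorProduct.lid k k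

variable {k hi} in
/-- A pure tensor in `V(i^μ)`. -/
def vmuTmul {m : ℕ} {μ : List ℕ} (c : k) (v : Vmu k hi μ) : Vmu k hi (m :: μ) :=
  (c ⊗ₜ[k] v : k ⊗[k] Vmu k hi μ)

variable {k hi} in
theorem vmu_induction {m : ℕ} {μ : List ℕ} {p : Vmu k hi (m :: μ) → Prop} (hzero : p 0)
    (hadd : ∀ v w, p v → p w → p (v + w)) (htmul : ∀ c v, p (vmuTmul c v))
    (v : Vmu k hi (m :: μ)) : p v :=
  TensorProduct.induction_on (R := k) (M := V k hi m) (N := Vmu k hi μ) (motive := p) v hzero htmul hadd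

theorem vmuEquiv_tmul (m : ℕ) (μ : List ℕ) (c : k) (v : Vmu k hi μ) :
    vmuEquiv k hi (m :: μ) (vmuTmul c v) = c * vmuEquiv k hi μ v :=
  rfl

theorem leviTmul_smul_vmuTmul {m : ℕ} {μ : List ℕ} (r : KLRAlg k D (Multiset.replicate m i))
    (b : levi k D (leviSeq i μ)) (c : k) (v : Vmu k hi μ) :
    (show levi k D (leviSeq i (m :: μ)) from leviTmul r b) • (vmuTmul c v : Vmu k hi (m :: μ))
      = vmuTmul (trivHom k hi m r * c) (b • v) := rfl

theorem vmuEquiv_mem : ∀ (μ : List ℕ) (d : ℤ) (v : Vmu k hi μ), v ∈ (Vmu k hi μ).gr d →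
    vmuEquiv k hi μ v ∈ unitGr k d
  | [], _, _, hv => hv
  | m :: μ, d, v, hv => by
    refine Submodule.span_induction (p := fun v _ => vmuEquiv k hi (m :: μ) v ∈ unitGr k d)
      ?_ ?_ ?_ ?_ hv
    · rintro _ ⟨p, q, rfl, c, hc, v, hv, rfl⟩
      exact mul_mem_unitGr (k := k) hc (vmuEquiv_mem μ q v hv)
    · rw [map_zero]; exact zero_mem _
    · intro x y _ _ hx hy
      rw [map_add]; exact add_mem hx hy
    · intro c x _ hx
      rw [map_smul]; exact Submodule.smul_mem _ _ hx

theorem one_mem_unitGr : (1 : k) ∈ unitGr k 0 := by simp [unitGr]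

theorem vmuEquiv_symm_mem : ∀ μ : List ℕ, (vmuEquiv k hi μ).symm 1 ∈ (Vmu k hi μ).gr 0
  | [] => one_mem_unitGr k
  | m :: μ => by
    have h1 : (vmuEquiv k hi (m :: μ)).symm 1 = vmuTmul 1 ((vmuEquiv k hi μ).symm 1) := by
      refine (LinearEquiv.symm_apply_eq _).2 ?_
      rw [vmuEquiv_tmul, LinearEquiv.apply_symm_apply, mul_one]
    rw [h1]
    exact tmul_mem_tensorGr (add_zero 0) (one_mem_unitGr k) (vmuEquiv_symm_mem μ)

/-- `V(i^μ)` is the restriction of `V(i^n)` along the embedding of `R(μ₁ i) ⊗ ⋯ ⊗ R(μᵣ i)` in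
`R(ni)`, as both are the trivial character. -/
theorem vmuEquiv_smul : ∀ (μ : List ℕ) {n : ℕ} (_ : μ.sum = n)
    (hs : (leviSeq i μ).sum = Multiset.replicate n i) (b : levi k D (leviSeq i μ))
    (v : Vmu k hi μ), vmuEquiv k hi μ (b • v)
      = trivHom k hi n (leviEmb k D (leviSeq i μ) (Multiset.replicate n i) hs b)
        * vmuEquiv k hi μ v
  | [], n, _, hs, b, v => by
    have : trivHom k hi n (leviEmb k D (leviSeq i []) (Multiset.replicate n i) hs b)
      = (show k from b) := (trivHom k hi n).commutes (show k from b)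
    rw [this]; rfl
  | m :: μ, n, h, hs, b, v => by
    rw [List.sum_cons] at h
    refine levi_induction (p := fun b => vmuEquiv k hi (m :: μ)
      ((show levi k D (leviSeq i (m :: μ)) from b) • v) = trivHom k hi n (leviEmb k D
        (leviSeq i (m :: μ)) (Multiset.replicate n i) hs b) * vmuEquiv k hi (m :: μ) v)
      ?_ ?_ ?_ b
    · dsimp only
      rw [zero_smul, map_zero, map_zero, map_zero, zero_mul]
    · intro a b ha hb
      dsimp only at ha hb ⊢
      rw [add_smul, map_add, map_add, map_add, ha, hb, add_mul]
    · intro r b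
      induction v using vmu_induction with
      | hzero => rw [smul_zero, map_zero, mul_zero]
      | hadd v w hv hw => rw [smul_add, map_add, map_add, hv, hw, mul_add]
      | htmul c v =>
        rw [leviEmb_leviSeq_cons h, map_mul, KLR.trivHom_mid hi (p := 0) (by simp) rfl,
          KLR.trivHom_mid hi (q := 0) rfl (by simp), vmuEquiv_tmul, leviTmul_smul_vmuTmul,
          vmuEquiv_tmul, vmuEquiv_smul μ rfl (sum_leviSeq rfl)]
        exact mul_mul_mul_comm _ _ _ _

end Levi


/-! The universal property of induction -/

section IndAlong

variable {k : Type u} [Field k] {A B : GrAlg k}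

theorem free_induction {M : GrMod B} {p : GrMod.free A M → Prop} (hzero : p 0)
    (hadd : ∀ s t, p s → p t → p (s + t)) (htmul : ∀ a m, p (GrMod.freeTmul A M a m))
    (t : GrMod.free A M) : p t :=
  TensorProduct.induction_on (R := k) (M := A) (N := M) (motive := p) t hzero htmul hadd

variable (φ : B →ₗ[k] A) (M : GrMod B)
  (hφ : ∀ d, ∀ b ∈ B.gr d, φ b ∈ A.gr d)

/-- The class of `a ⊗ m` in the induced module. -/
def indTmul : A →ₗ[k] M →ₗ[k] indAlong φ M hφ :=
  (GrMod.freeTmul A M).compr₂ ((indRel φ M).mkQ.restrictScalars k)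

theorem indTmul_mul (a : A) (b : B) (m : M) :
    indTmul φ M hφ (a * φ b) m = indTmul φ M hφ a (b • m) :=
  (Submodule.Quotient.eq _).2 (Submodule.subset_span ⟨a, b, m, rfl⟩)

theorem indTmul_mem {c d : ℤ} {a : A} {m : M} (ha : a ∈ A.gr c) (hm : m ∈ M.gr d) :
    indTmul φ M hφ a m ∈ (indAlong φ M hφ).gr (c + d) :=
  ⟨_, GrMod.freeTmul_mem A M ha hm, rfl⟩

variable {φ M hφ}

theorem ind_induction {p : indAlong φ M hφ → Prop} (hzero : p 0)
    (hadd : ∀ s t, p s → p t → p (s + t)) (htmul : ∀ a m, p (indTmul φ M hφ a m))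
    (t : indAlong φ M hφ) : p t := by
  obtain ⟨t, rfl⟩ := Submodule.Quotient.mk_surjective _ t
  induction t using free_induction with
  | hzero => exact hzero
  | hadd s t hs ht => exact hadd _ _ hs ht
  | htmul a m => exact htmul a m

theorem ind_gr_le {d : ℤ} {N : Submodule k (indAlong φ M hφ)}
    (h : ∀ p q, p + q = d → ∀ a ∈ A.gr p, ∀ m ∈ M.gr q, indTmul φ M hφ a m ∈ N) :
    (indAlong φ M hφ).gr d ≤ N := by
  refine Submodule.map_le_iff_le_comap.2 (Submodule.span_le.2 ?_)
  rintro _ ⟨p, q, hpq, a, ha, m, hm, rfl⟩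
  exact h p q hpq a ha m hm

/-- The map `a ⊗ m ↦ ρ(a) f(m)` respects the relations of the induced module by `hf`. The target is
given by an algebra homomorphism `ρ`, the form in which the action on `insertion` is available. -/
theorem exists_ind_lift {X : Type u} [AddCommGroup X] [Module k X] (ρ : A →ₐ[k] Module.End k X)
    (f : M →ₗ[k] X) (hf : ∀ b m, ρ (φ b) (f m) = f (b • m)) :
    ∃ F : indAlong φ M hφ →ₗ[k] X, (∀ a t, F (a • t) = ρ a (F t)) ∧
      ∀ a m, F (indTmul φ M hφ a m) = ρ a (f m) := by
  let F₀ : GrMod.free A M →ₗ[k] X :=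
    TensorProduct.lift ((LinearMap.lcomp k X f) ∘ₗ ρ.toLinearMap)
  have h0 : ∀ a m, F₀ (GrMod.freeTmul A M a m) = ρ a (f m) := fun a m => rfl
  have hsmul : ∀ (a : A) (t : GrMod.free A M), F₀ (a • t) = ρ a (F₀ t) := fun a t => by
    induction t using free_induction with
    | hzero => rw [smul_zero, map_zero, map_zero]
    | hadd s t hs ht => rw [smul_add, map_add, hs, ht, map_add, map_add]
    | htmul b m =>
      change ρ (a * b) (f m) = ρ a (ρ b (f m))
      rw [map_mul]; rfl
  have hker : (indRel φ M).restrictScalars k ≤ LinearMap.ker F₀ := fun t ht => by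
    rw [LinearMap.mem_ker]
    refine Submodule.span_induction (p := fun t _ => F₀ t = 0) ?_ ?_ ?_ ?_ ht
    · rintro _ ⟨a, b, m, rfl⟩
      rw [map_sub, h0, h0, map_mul, ← hf, sub_eq_zero]; rfl
    · rw [map_zero]
    · intro x y _ _ hx hy
      rw [map_add, hx, hy, add_zero]
    · intro a x _ hx
      rw [hsmul, hx, map_zero]
  let F : indAlong φ M hφ →ₗ[k] X := (((indRel φ M).restrictScalars k).liftQ F₀ hker) ∘ₗ
    (Submodule.Quotient.restrictScalarsEquiv k (indRel φ M)).symm.toLinearMap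
  have hF : ∀ t, F ((indRel φ M).mkQ t) = F₀ t := fun t => rfl
  refine ⟨F, fun a t => ?_, fun a m => rfl⟩
  obtain ⟨t, rfl⟩ := Submodule.Quotient.mk_surjective _ t
  exact hsmul a t

end IndAlong

/-! The modules `Ind K ⊗ V(i^μ)` -/

section IndV

variable {k : Type u} [Field k] {I : Type u} {D : BorcherdsCartan I} {ν : Multiset I} {i : I}
  (K : GrMod (klr k D ν)) (hi : D.IsImaginary i) (μ : List ℕ) {n : ℕ} (h : μ.sum = n)

theorem sum_cons_leviSeq (ν : Multiset I) {μ : List ℕ} (h : μ.sum = n) :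
    (ν :: leviSeq i μ).sum = ν + Multiset.replicate n i := by
  rw [List.sum_cons, sum_leviSeq h]

/-- The module `K ⊗ V(i^μ)`. -/
def boxV : GrMod (levi k D (ν :: leviSeq i μ)) := K.tensor (Vmu k hi μ)

variable {K hi μ} in
/-- A pure tensor in `K ⊗ V(i^μ)`. -/
def boxTmul : K →ₗ[k] Vmu k hi μ →ₗ[k] boxV K hi μ := TensorProduct.mk k K (Vmu k hi μ)

variable {K hi μ} in
theorem leviTmul_smul_boxTmul (r : KLRAlg k D ν) (b : levi k D (leviSeq i μ)) (x : K)
    (v : Vmu k hi μ) : leviTmul r b • boxTmul x v = boxTmul (K := K) (r • x) (b • v) := rfl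

variable {K hi μ} in
theorem box_induction {p : boxV K hi μ → Prop} (hzero : p 0)
    (hadd : ∀ s t, p s → p t → p (s + t)) (htmul : ∀ x v, p (boxTmul x v))
    (t : boxV K hi μ) : p t :=
  TensorProduct.induction_on (R := k) (M := K) (N := Vmu k hi μ) (motive := p) t hzero htmul hadd

/-- The embedding of `R(ν) ⊗ R(μ₁ i) ⊗ ⋯ ⊗ R(μᵣ i)` in `R(ν + ni)`. -/
def boxEmb (k : Type u) [Field k] (D : BorcherdsCartan I) (ν : Multiset I) (i : I)
    {μ : List ℕ} {n : ℕ} (h : μ.sum = n) :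
    levi k D (ν :: leviSeq i μ) →ₗ[k] KLRAlg k D (ν + Multiset.replicate n i) :=
  leviEmb k D (ν :: leviSeq i μ) (ν + Multiset.replicate n i) (sum_cons_leviSeq ν h)

theorem boxEmb_leviTmul (r : KLRAlg k D ν) (b : levi k D (leviSeq i μ)) :
    boxEmb k D ν i h (leviTmul r b)
      = KLR.midL k D ν i n r
        * KLR.midR k D ν i n (leviEmb k D (leviSeq i μ) _ (sum_leviSeq h) b) :=
  leviEmb_leviTmul _ _ _ _ _ _

/-- The class of `a ⊗ x ⊗ v` in `Ind K ⊗ V(i^μ)`. -/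
def indVTmul : KLRAlg k D (ν + Multiset.replicate n i) →ₗ[k] boxV K hi μ →ₗ[k] indV K hi μ h :=
  indTmul (A := klr k D (ν + Multiset.replicate n i)) (boxEmb k D ν i h) (boxV K hi μ)
    (leviEmb_mem D _ _ (sum_cons_leviSeq ν h))

theorem smul_indVTmul (a b : KLRAlg k D (ν + Multiset.replicate n i)) (m : boxV K hi μ) :
    a • indVTmul K hi μ h b m = indVTmul K hi μ h (a * b) m := rfl

theorem indVTmul_mul (a : KLRAlg k D (ν + Multiset.replicate n i))
    (b : levi k D (ν :: leviSeq i μ)) (m : boxV K hi μ) :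
    indVTmul K hi μ h (a * boxEmb k D ν i h b) m = indVTmul K hi μ h a (b • m) :=
  indTmul_mul (A := klr k D (ν + Multiset.replicate n i)) (boxEmb k D ν i h) (boxV K hi μ)
    (leviEmb_mem D _ _ (sum_cons_leviSeq ν h)) a b m

variable {K hi μ h} in
theorem indV_induction {p : indV K hi μ h → Prop} (hzero : p 0)
    (hadd : ∀ s t, p s → p t → p (s + t)) (htmul : ∀ a m, p (indVTmul K hi μ h a m))
    (t : indV K hi μ h) : p t :=
  ind_induction (A := klr k D (ν + Multiset.replicate n i)) (φ := boxEmb k D ν i h)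
    (M := boxV K hi μ) (hφ := leviEmb_mem D _ _ (sum_cons_leviSeq ν h)) hzero hadd htmul t

variable {K hi μ h} in
theorem indV_gr_le {d : ℤ} {N : Submodule k (indV K hi μ h)}
    (hN : ∀ p q, p + q = d → ∀ a ∈ KLR.gr k D (ν + Multiset.replicate n i) p,
      ∀ m ∈ (boxV K hi μ).gr q, indVTmul K hi μ h a m ∈ N) : (indV K hi μ h).gr d ≤ N :=
  ind_gr_le (A := klr k D (ν + Multiset.replicate n i)) (φ := boxEmb k D ν i h)
    (M := boxV K hi μ) (hφ := leviEmb_mem D _ _ (sum_cons_leviSeq ν h)) hN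

/-- The map `K → Ind K ⊗ V(i^μ)`, `x ↦ 1 ⊗ x ⊗ v`, where `v` generates `V(i^μ)`. -/
def indVTop : K →ₗ[k] indV K hi μ h :=
  indVTmul K hi μ h 1 ∘ₗ boxTmul.flip ((vmuEquiv k hi μ).symm 1)

theorem indVTop_apply (x : K) :
    indVTop K hi μ h x = indVTmul K hi μ h 1 (boxTmul x ((vmuEquiv k hi μ).symm 1)) := rfl

theorem indVTmul_eq (a : KLRAlg k D (ν + Multiset.replicate n i)) (x : K) (v : Vmu k hi μ) :
    indVTmul K hi μ h a (boxTmul x v) = vmuEquiv k hi μ v • a • indVTop K hi μ h x := by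
  have hv : v = vmuEquiv k hi μ v • (vmuEquiv k hi μ).symm 1 := by
    rw [← map_smul, smul_eq_mul, mul_one, LinearEquiv.symm_apply_apply]
  conv_lhs => rw [hv, map_smul, map_smul]
  congr 1
  rw [indVTop_apply, smul_indVTmul, mul_one]

theorem boxEmb_smul_indVTop (r : KLRAlg k D ν) (b : levi k D (leviSeq i μ)) (x : K) :
    boxEmb k D ν i h (leviTmul r b) • indVTop K hi μ h x
      = trivHom k hi n (leviEmb k D (leviSeq i μ) _ (sum_leviSeq h) b)
        • indVTop K hi μ h (r • x) := by
  have h1 : boxEmb k D ν i h (leviTmul r b) • indVTop K hi μ h x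
      = indVTmul K hi μ h 1 (leviTmul r b • boxTmul x ((vmuEquiv k hi μ).symm 1)) := by
    rw [indVTop_apply, smul_indVTmul, mul_one, ← indVTmul_mul, one_mul]
  rw [h1, leviTmul_smul_boxTmul, indVTmul_eq, vmuEquiv_smul k hi μ h (sum_leviSeq h),
    LinearEquiv.apply_symm_apply, mul_one, one_smul]

theorem midL_smul_indVTop (r : KLRAlg k D ν) (x : K) :
    KLR.midL k D ν i n r • indVTop K hi μ h x = indVTop K hi μ h (r • x) := by
  have h1 := boxEmb_smul_indVTop K hi μ h r 1 x
  rwa [boxEmb_leviTmul, leviEmb_leviSeq_one μ h, KLR.midR_one, ← KLR.midL_one, ← KLR.midL_mul,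
    mul_one, map_one, one_smul] at h1

theorem midR_smul_indVTop (b : levi k D (leviSeq i μ)) (x : K) :
    KLR.midR k D ν i n (leviEmb k D (leviSeq i μ) _ (sum_leviSeq h) b) • indVTop K hi μ h x
      = trivHom k hi n (leviEmb k D (leviSeq i μ) _ (sum_leviSeq h) b) • indVTop K hi μ h x := by
  have h1 := boxEmb_smul_indVTop K hi μ h 1 b x
  rwa [boxEmb_leviTmul, KLR.midL_one, ← KLR.midR_one, ← KLR.midR_mul, one_mul, one_smul] at h1

theorem isHighest_indVTop : KLR.IsHighest D ν i n (indVTop K hi μ h) where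
  midL_smul a x := midL_smul_indVTop K hi μ h a x
  tailX_smul q x := by
    obtain ⟨b, hb⟩ := exists_leviEmb_eq_tailX (k := k) (D := D) μ h (sum_leviSeq h) q
    have h1 := midR_smul_indVTop K hi μ h b x
    rw [hb, show trivHom k hi n (KLR.tailX k D i n q) = 0 from KLR.trivHom_gen hi _,
      zero_smul] at h1
    exact h1

theorem indVTop_mem (d : ℤ) (x : K) (hx : x ∈ K.gr d) :
    indVTop K hi μ h x ∈ (indV K hi μ h).gr d := by
  have h1 := indTmul_mem (A := klr k D (ν + Multiset.replicate n i)) (boxEmb k D ν i h)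
    (boxV K hi μ) (leviEmb_mem D _ _ _) (c := 0) (d := d) KLR.one_mem_gr
    (m := boxTmul x ((vmuEquiv k hi μ).symm 1))
    (tmul_mem_tensorGr (add_zero d) hx (vmuEquiv_symm_mem k hi μ))
  rwa [zero_add] at h1

theorem span_range_indVTop : Submodule.span (KLRAlg k D (ν + Multiset.replicate n i))
    (Set.range (indVTop K hi μ h)) = ⊤ := by
  rw [eq_top_iff]
  rintro t -
  induction t using indV_induction with
  | hzero => exact zero_mem _
  | hadd s t hs ht => exact add_mem hs ht
  | htmul a m =>
    induction m using box_induction with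
    | hzero => rw [map_zero]; exact zero_mem _
    | hadd s t hs ht => rw [map_add]; exact add_mem hs ht
    | htmul x v =>
      rw [indVTmul_eq, ← smul_assoc]
      exact Submodule.smul_mem _ _ (Submodule.subset_span ⟨x, rfl⟩)

/-- The map to lift is `x ⊗ v ↦ v • g x`, with `v` read as a scalar. The condition `hR` concerns all
of `R(ni)`, not only the image of the blocks of `μ`; it holds for the module `insertion` and for the
composition `(n)`. -/
theorem exists_indV_lift {X : Type u} [AddCommGroup X] [Module k X]
    (ρ : KLRAlg k D (ν + Multiset.replicate n i) →ₐ[k] Module.End k X) (g : K →ₗ[k] X)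
    (hL : ∀ (r : KLRAlg k D ν) x, ρ (KLR.midL k D ν i n r) (g x) = g (r • x))
    (hR : ∀ b x, ρ (KLR.midR k D ν i n b) (g x) = trivHom k hi n b • g x) :
    ∃ F : indV K hi μ h →ₗ[k] X,
      (∀ (a : KLRAlg k D (ν + Multiset.replicate n i)) t, F (a • t) = ρ a (F t)) ∧
      ∀ x, F (indVTop K hi μ h x) = g x := by
  let f : boxV K hi μ →ₗ[k] X :=
    TensorProduct.lift (((LinearMap.lsmul k X).flip ∘ₗ g).compl₂ (vmuEquiv k hi μ).toLinearMap)
  have hf : ∀ x v, f (boxTmul x v) = vmuEquiv k hi μ v • g x := fun x v => rfl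
  have hcomp : ∀ b m, ρ (boxEmb k D ν i h b) (f m) = f (b • m) := fun b m => by
    induction b using levi_induction with
    | hzero => rw [map_zero, map_zero, zero_smul, map_zero, LinearMap.zero_apply]
    | hadd a b ha hb => rw [map_add, map_add, add_smul, map_add, LinearMap.add_apply, ha, hb]
    | htmul r b =>
      induction m using box_induction with
      | hzero => rw [smul_zero, map_zero, map_zero]
      | hadd s t hs ht => rw [smul_add, map_add, map_add, map_add, hs, ht]
      | htmul x v =>
        rw [leviTmul_smul_boxTmul, hf, hf, boxEmb_leviTmul, map_mul, Module.End.mul_apply,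
          map_smul, hR, map_smul, map_smul, hL, vmuEquiv_smul k hi μ h (sum_leviSeq h), smul_smul,
          mul_comm]
  obtain ⟨F, hF, hF'⟩ := exists_ind_lift (hφ := leviEmb_mem D _ _ (sum_cons_leviSeq ν h))
    (A := klr k D (ν + Multiset.replicate n i)) ρ f hcomp
  have h1 : ∀ x, ρ 1 (f (boxTmul x ((vmuEquiv k hi μ).symm 1))) = g x := fun x => by
    rw [map_one, Module.End.one_apply, hf, LinearEquiv.apply_symm_apply, one_smul]
  exact ⟨F, hF, fun x => (hF' 1 _).trans (h1 x)⟩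

theorem nontrivial_indV (hK : Nontrivial K) : Nontrivial (indV K hi μ h) := by
  obtain ⟨x, hx⟩ := KLR.exists_insertionTop_ne_zero (k := k) (D := D) (ν := ν) (n := n) (K := K)
  obtain ⟨F, -, hF⟩ := exists_indV_lift K hi μ h (KLR.insertionHom k D ν i n K hi)
    (KLR.insertionTop k D ν n K) (KLR.insertionHom_midL hi) (KLR.insertionHom_midR hi)
  refine ⟨indVTop K hi μ h x, 0, fun h0 => hx ?_⟩
  rw [← hF, h0, map_zero]

/-- The generators of `Ind K ⊗ V(i^n)` transform under `R(ν)` and `R(ni)` as `K` and `V(i^n)`, so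
the generators for `μ` can be sent to them. Surjectivity holds because the target is generated by
these vectors. -/
theorem exists_indV_surjective :
    ∃ F : indV K hi μ h →ₗ[klr k D (ν + Multiset.replicate n i)]
        indV K hi [n] List.sum_singleton,
      (∀ d, ∀ t ∈ (indV K hi μ h).gr d, F t ∈ (indV K hi [n] List.sum_singleton).gr d) ∧
      Function.Surjective F := by
  let γ' := indVTop K hi [n] List.sum_singleton
  obtain ⟨F, hF, hF'⟩ := exists_indV_lift K hi μ h
    (Algebra.lsmul k k (indV K hi [n] List.sum_singleton)) γ'
    (midL_smul_indVTop K hi [n] List.sum_singleton) (fun y x => by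
      obtain ⟨b, rfl⟩ := leviEmb_singleton_surjective (k := k) (D := D) (i := i) (n := n)
        (sum_leviSeq List.sum_singleton) y
      exact midR_smul_indVTop K hi [n] List.sum_singleton b x)
  let G : indV K hi μ h →ₗ[klr k D (ν + Multiset.replicate n i)]
      indV K hi [n] List.sum_singleton := { F with map_smul' := hF }
  have hG : ∀ x, G (indVTop K hi μ h x) = γ' x := hF'
  refine ⟨G, fun d => ?_, ?_⟩
  · refine indV_gr_le (N := ((indV K hi [n] List.sum_singleton).gr d).comap F) ?_
    intro p q hpq a ha m hm
    refine Submodule.span_induction (p := fun m _ => indVTmul K hi μ h a m ∈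
      ((indV K hi [n] List.sum_singleton).gr d).comap F) ?_ ?_ ?_ ?_ hm
    · rintro _ ⟨r, s, rfl, x, hx, v, hv, rfl⟩
      change indVTmul K hi μ h a (boxTmul x v) ∈ _
      rw [indVTmul_eq]
      -- `V(i^μ)` is concentrated in degree `0`, so a vector of any other degree is zero.
      by_cases hs : s = 0
      · subst hs
        refine Submodule.smul_mem _ _ ?_
        rw [Submodule.mem_comap, hF, hF', ← hpq, add_zero]
        exact (indV K hi [n] List.sum_singleton).smul_mem ha
          (indVTop_mem K hi [n] List.sum_singleton r x hx)
      · have hv' := vmuEquiv_mem k hi μ s v hv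
        rw [unitGr, if_neg hs, Submodule.mem_bot] at hv'
        rw [hv', zero_smul]
        exact zero_mem _
    · rw [map_zero]; exact zero_mem _
    · intro x y _ _ hx hy
      rw [map_add]; exact add_mem hx hy
    · intro c x _ hx
      rw [map_smul]; exact Submodule.smul_mem _ _ hx
  · rw [← LinearMap.range_eq_top, eq_top_iff]
    refine (span_range_indVTop K hi [n] List.sum_singleton).ge.trans (Submodule.span_le.2 ?_)
    rintro _ ⟨x, rfl⟩
    exact ⟨indVTop K hi μ h x, hG x⟩

theorem exists_isLargestProper_indV (hK : K.IsGrIrreducible) (hε : epsilon i K = 0) :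
    ∃ J, (indV K hi μ h).IsLargestProper J :=
  exists_isLargestProper hi hK hε (isHighest_indVTop K hi μ h) (indVTop_mem K hi μ h)
    (span_range_indVTop K hi μ h) (nontrivial_indV K hi μ h hK.1)

end IndV

end Borcherds

end

theorem lemmaL4 {k : Type u} [Field k] [IsAlgClosed k] {I : Type u} [Countable I]
    (D : Borcherds.BorcherdsCartan I) (i : I) (hi : D.IsImaginary i) (ν : Multiset I)
    (K : Borcherds.GrMod (Borcherds.klr k D ν)) (hfin : FiniteDimensional k K)
    (hK : K.IsGrIrreducible) (hε : Borcherds.epsilon i K = 0)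
    (n : ℕ) (μ : Composition n) :
    (Borcherds.indV K hi μ.blocks μ.blocks_sum).hd.IsGrIrreducible ∧
      Borcherds.epsilon i (Borcherds.indV K hi μ.blocks μ.blocks_sum).hd = n ∧
      (Borcherds.indV K hi μ.blocks μ.blocks_sum).hd.Iso
        (Borcherds.indV K hi [n] List.sum_singleton).hd := by
  obtain ⟨J, hJ⟩ := Borcherds.exists_isLargestProper_indV K hi μ.blocks μ.blocks_sum hK hε
  obtain ⟨J', hJ'⟩ :=
    Borcherds.exists_isLargestProper_indV K hi [n] List.sum_singleton hK hε
  obtain ⟨F, hF, hsurj⟩ := Borcherds.exists_indV_surjective K hi μ.blocks μ.blocks_sum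
  exact ⟨hJ.hd_isGrIrreducible,
    Borcherds.epsilon_hd hi hε (Borcherds.isHighest_indVTop K hi μ.blocks μ.blocks_sum)
      (Borcherds.span_range_indVTop K hi μ.blocks μ.blocks_sum) hJ,
    Borcherds.GrMod.hd_iso_of_surjective hJ hJ' F hF hsurj⟩
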